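/- **Setting.** Closed polygons are cyclic vertex lists in the plane. A *weakly-simple polygon* $Q$, possibly with holes, is given by an outer closed polygon and finitely many hole polygons with non-degenerate edges such that no two edges cross, the boundary polygons are jointly a uniform limit of families of pairwise disjoint simple closed curves, the outer polygon is clockwise (winding numbers in $\{0,-1\}$), the holes are counterclockwise (winding numbers in $\{0,1\}$), and the total winding number of every point off the boundary is $0$ or $-1$. Its region consists of the boundary and of the points with non-zero winding number; its exterior is the set of points off the outer polygon with winding number $0$ with respect to it. Let $P=(p_1,\dots,p_n)$ be a clockwise weakly-simple polygon without holes and with connected exterior whose topmost point is unique and is $p_1$. Let $\mathcal C$ be a set of *shortcuts*: non-degenerate directed edges between vertices of $P$ in the closed exterior of $P$. Let $\lambda\in[0,1]$. A *$\mathcal C$-hull* of $P$ is a weakly-simple polygon $Q$, possibly with holes, with connected exterior, all of whose directed boundary edges are in $\mathcal C$ and whose region contains that of $P$. Its cost is $c(Q)=\lambda\cdot\mathrm{perimeter}(Q)+(1-\lambda)\cdot\mathrm{area}(Q)$, and it is *optimal* if no $\mathcal C$-hull of $P$ has smaller cost. It is *irredundant* if no proper sub-multiset of its boundary edges is the boundary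 of a $\mathcal C$-hull with the same region up to a null set. Let $\mathcal B=q_1q_2q_3q_4$ (clockwise from the top-left corner) be an axis-aligned rectangle with all vertices of $P$ in its interior and whose two diagonals meet $P$. The *sliced donut* is the closed polygon $D=q_1q_2q_3q_4q_1p_1p_n\cdots p_2p_1$; its cut edge is $e^\star=p_1q_1$. For a set $E$ of edges, an *$E$-triangulation* of $D$ is a finite set of non-degenerate triangles that partition the interior of $D$ and whose sides belong to $E$ (in some direction), each side being an edge of $D$ with the triangle on the interior side of it, or a diagonal whose relative interior lies in the interior of $D$. A directed edge is *part of* the triangulation if it is a side (in some direction) of a triangle and equals every triangle side, directed with its triangle on the left, that has its direction and overlaps it in more than a point. An *enrichment* of $\mathcal C$ and $D$ is a set $\mathcal C^+\supseteq\mathcal C$ of edges contained in $D$ with endpoints at vertices of $D$ such that every set $\mathcal C'\subseteq\mathcal C$ of pairwise non-crossing edges is part of some $\mathcal C^+$-triangulation of $D$. Fix an enrichment $\mathcal C^+$. A *labeled* $\mathcal C^+$-triangulation $\mathbf T$ labels each triangle active or inactive, where the triangles at the cut edge are inactive. A *separator* is a directed triangle side that has an inactive triangle on its left and that is a directed edge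 of $P$ or has an active triangle on its right. The cost $c(\mathbf T)$ is $\lambda$ times the total length of the separators plus $1-\lambda$ times the total area of the active triangles if all separators are in $\mathcal C$, and $\infty$ otherwise. $\mathbf T$ is *optimal* if no labeled $\mathcal C^+$-triangulation of $D$ has smaller cost. The separators *form* $Q$ if they are exactly the directed boundary edges of $Q$, each occurring once. **Statement.** 1. If $\mathbf T$ is optimal and $c(\mathbf T)<\infty$, then the separators of $\mathbf T$ form an optimal $\mathcal C$-hull of $P$. 2. For every $\mathcal C$-hull $Q$ of $P$ there is a labeled $\mathcal C^+$-triangulation $\mathbf T$ of $D$ whose separators are boundary edges of $Q$ and with $c(\mathbf T)+(1-\lambda)\,\mathrm{area}(P)\le c(Q)$; if $Q$ is irredundant, then $\mathbf T$ can moreover be chosen such that its separators form $Q$ and equality holds. 3. For every labeled $\mathcal C^+$-triangulation $\mathbf T$ of $D$ with $c(\mathbf T)<\infty$ the separators of $\mathbf T$ form a $\mathcal C$-hull $Q$ of $P$ with $c(Q)=c(\mathbf T)+(1-\lambda)\,\mathrm{area}(P)$. -/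

import Mathlib

open MeasureTheory

namespace ShortcutHull

/-! The plane is `ℂ`. A directed edge is a pair of points. A closed polygon is the cyclic list of
its vertices. -/

/-- Twice the signed area of the triangle `a b c`; positive iff `c` lies to the left of the directed
line from `a` to `b`. -/
def orient (a b c : ℂ) : ℝ :=
  (b - a).re * (c - a).im - (b - a).im * (c - a).re

/-- The closed segment of a directed edge. -/
def seg (e : ℂ × ℂ) : Set ℂ := segment ℝ e.1 e.2

/-- The edge without its endpoints. -/
def openSeg (e : ℂ × ℂ) : Set ℂ := openSegment ℝ e.1 e.2

/-- Two edges cross: each one has its endpoints strictly on both sides of the line of the other. -/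
def Cross (e f : ℂ × ℂ) : Prop :=
  orient e.1 e.2 f.1 * orient e.1 e.2 f.2 < 0 ∧ orient f.1 f.2 e.1 * orient f.1 f.2 e.2 < 0

/-- Two directed edges point in the same direction and share more than a point. -/
def Overlap (e f : ℂ × ℂ) : Prop :=
  (openSeg e ∩ openSeg f).Nonempty ∧ ∃ r : ℝ, 0 < r ∧ f.2 - f.1 = r • (e.2 - e.1)

/-! ### Closed polygons -/

/-- The directed edges of a closed polygon, including the edge from the last vertex to the first. -/
def edges (l : List ℂ) : List (ℂ × ℂ) := l.zip (l.rotate 1)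

/-- The union of the edges. -/
def trace (l : List ℂ) : Set ℂ := {z | ∃ e ∈ edges l, z ∈ seg e}

/-- The winding number of a closed polygon around a point `z` that is not on its trace
(counterclockwise is positive). -/
noncomputable def winding (l : List ℂ) (z : ℂ) : ℝ :=
  ((edges l).map fun e => Complex.arg ((e.2 - z) / (e.1 - z))).sum / (2 * Real.pi)

/-- The (open) interior of a closed polygon. -/
def inner (l : List ℂ) : Set ℂ := {z | z ∉ trace l ∧ winding l z ≠ 0}

/-- The (open) exterior of a closed polygon. -/
def outside (l : List ℂ) : Set ℂ := {z | z ∉ trace l ∧ winding l z = 0}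

/-- The closed polygon as a closed curve; the `k`-th vertex is visited at time `k`. -/
noncomputable def curve (l : List ℂ) (t : ℝ) : ℂ :=
  AffineMap.lineMap (l.getD (⌊t⌋₊ % l.length) 0) (l.getD ((⌊t⌋₊ + 1) % l.length) 0) (Int.fract t)

/-- A finite family of closed polygons can be approximated arbitrarily well by pairwise disjoint
simple closed curves. -/
def NearlySimple (L : List (List ℂ)) : Prop :=
  ∀ ε : ℝ, 0 < ε → ∃ γ : Fin L.length → ℝ → ℂ,
    (∀ i, Continuous (γ i)) ∧
    (∀ i t, γ i (t + ((L.get i).length : ℝ)) = γ i t) ∧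
    (∀ i j s t, s ∈ Set.Ico (0 : ℝ) ((L.get i).length : ℝ) →
      t ∈ Set.Ico (0 : ℝ) ((L.get j).length : ℝ) → γ i s = γ j t → i = j ∧ s = t) ∧
    ∀ i t, t ∈ Set.Ico (0 : ℝ) ((L.get i).length : ℝ) → dist (γ i t) (curve (L.get i) t) < ε

/-! ### Polygons with holes -/

/-- A polygon given by its outer boundary and the boundaries of its holes. -/
structure HoledPolygon where
  outer : List ℂ
  holes : List (List ℂ)

/-- All closed boundary polygons. -/
def HoledPolygon.cycles (Q : HoledPolygon) : List (List ℂ) := Q.outer :: Q.holes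

/-- The oriented boundary: all directed boundary edges. -/
def HoledPolygon.bdry (Q : HoledPolygon) : List (ℂ × ℂ) := Q.cycles.flatMap edges

/-- The union of the boundary edges. -/
def HoledPolygon.trace (Q : HoledPolygon) : Set ℂ := {z | ∃ e ∈ Q.bdry, z ∈ seg e}

/-- The total winding number of the oriented boundary. -/
noncomputable def HoledPolygon.winding (Q : HoledPolygon) (z : ℂ) : ℝ :=
  (Q.cycles.map fun l => ShortcutHull.winding l z).sum

/-- The closed region covered by the polygon: its interior and its boundary. -/
def HoledPolygon.region (Q : HoledPolygon) : Set ℂ := {z | z ∈ Q.trace ∨ Q.winding z ≠ 0}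

/-- Weakly-simple polygons, possibly with holes: the edges do not cross, the boundary is a limit of
disjoint simple closed curves, the outer boundary is clockwise, the holes are counterclockwise, and
the holes lie inside the outer boundary and have disjoint interiors (so that every point that is not
on the boundary has total winding number `-1` (inside) or `0`). -/
structure HoledPolygon.WeaklySimple (Q : HoledPolygon) : Prop where
  nonempty : ∀ l ∈ Q.cycles, l ≠ []
  nondegenerate : ∀ e ∈ Q.bdry, e.1 ≠ e.2
  noncrossing : ∀ e ∈ Q.bdry, ∀ f ∈ Q.bdry, ¬ Cross e f
  nearlySimple : NearlySimple Q.cycles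
  outer_clockwise : ∀ z, z ∉ ShortcutHull.trace Q.outer →
    ShortcutHull.winding Q.outer z = 0 ∨ ShortcutHull.winding Q.outer z = -1
  holes_counterclockwise : ∀ l ∈ Q.holes, ∀ z, z ∉ ShortcutHull.trace l →
    ShortcutHull.winding l z = 0 ∨ ShortcutHull.winding l z = 1
  total : ∀ z, z ∉ Q.trace → Q.winding z = 0 ∨ Q.winding z = -1

/-- The exterior (of the outer boundary) is one connected region. -/
def HoledPolygon.ConnectedExterior (Q : HoledPolygon) : Prop := IsConnected (outside Q.outer)

/-! ### Input polygon, shortcuts and hulls -/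

/-- A closed polygon regarded as a polygon without holes. -/
def solid (P : List ℂ) : HoledPolygon := ⟨P, []⟩

/-- The input: a clockwise weakly-simple polygon without holes and with connected exterior, whose
first vertex is its unique topmost point. -/
structure IsInput (P : List ℂ) : Prop where
  weaklySimple : (solid P).WeaklySimple
  connectedExterior : (solid P).ConnectedExterior
  topmost : ∀ v ∈ P, v ≠ P.headI → v.im < P.headI.im

/-- `C` is a set of shortcuts of `P`: directed edges between vertices of `P` in the (closed)
exterior of `P`. -/
def IsShortcuts (P : List ℂ) (C : Set (ℂ × ℂ)) : Prop :=
  ∀ e ∈ C, e.1 ≠ e.2 ∧ e.1 ∈ P ∧ e.2 ∈ P ∧ seg e ⊆ closure (outside P)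

/-- `Q` is a `C`-hull of `P`. -/
structure IsHull (P : List ℂ) (C : Set (ℂ × ℂ)) (Q : HoledPolygon) : Prop where
  weaklySimple : Q.WeaklySimple
  connectedExterior : Q.ConnectedExterior
  bdry_mem : ∀ e ∈ Q.bdry, e ∈ C
  contains : (solid P).region ⊆ Q.region

/-- The area of the region covered by a polygon. -/
noncomputable def HoledPolygon.area (Q : HoledPolygon) : ℝ := (volume Q.region).toReal

/-- The length of the boundary of a polygon. -/
noncomputable def HoledPolygon.perimeter (Q : HoledPolygon) : ℝ :=
  (Q.bdry.map fun e => dist e.1 e.2).sum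

/-- The cost of a polygon, balancing perimeter and area. -/
noncomputable def HoledPolygon.cost (lam : ℝ) (Q : HoledPolygon) : ℝ :=
  lam * Q.perimeter + (1 - lam) * Q.area

/-- `Q` is an optimal `C`-hull of `P`. -/
def IsOptimalHull (P : List ℂ) (C : Set (ℂ × ℂ)) (lam : ℝ) (Q : HoledPolygon) : Prop :=
  IsHull P C Q ∧ ∀ Q', IsHull P C Q' → Q.cost lam ≤ Q'.cost lam

/-- A `C`-hull has redundant boundary edges if a proper part of its boundary is already the boundary
of a `C`-hull that covers the same region up to a null set. This happens only for
boundary pieces that are traversed in both directions and bound no area. -/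
def Irredundant (P : List ℂ) (C : Set (ℂ × ℂ)) (Q : HoledPolygon) : Prop :=
  ¬ ∃ Q', IsHull P C Q' ∧ (Q'.bdry : Multiset (ℂ × ℂ)) < (Q.bdry : Multiset (ℂ × ℂ)) ∧
    Q'.region =ᵐ[volume] Q.region

/-! ### Containing box and sliced donut -/

/-- An axis-aligned rectangle. -/
structure Box where
  left : ℝ
  right : ℝ
  bottom : ℝ
  top : ℝ

/-- The top-left corner. -/
def Box.q₁ (B : Box) : ℂ := ⟨B.left, B.top⟩
/-- The top-right corner. -/
def Box.q₂ (B : Box) : ℂ := ⟨B.right, B.top⟩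
/-- The bottom-right corner. -/
def Box.q₃ (B : Box) : ℂ := ⟨B.right, B.bottom⟩
/-- The bottom-left corner. -/
def Box.q₄ (B : Box) : ℂ := ⟨B.left, B.bottom⟩

/-- `B` is a containing box of `P`: it is larger than the bounding box of `P`, and both
diagonals meet `P`. -/
structure IsContainingBox (P : List ℂ) (B : Box) : Prop where
  mem : ∀ v ∈ P, B.left < v.re ∧ v.re < B.right ∧ B.bottom < v.im ∧ v.im < B.top
  diag₁₃ : (seg (B.q₁, B.q₃) ∩ (solid P).region).Nonempty
  diag₂₄ : (seg (B.q₂, B.q₄) ∩ (solid P).region).Nonempty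

/-- The sliced donut `q₁ q₂ q₃ q₄ q₁ p₁ pₙ … p₂ p₁ (q₁)`; the cut edge is `p₁ q₁`. It is clockwise:
its interior lies to the right of its directed edges. -/
def donut (P : List ℂ) (B : Box) : List ℂ :=
  [B.q₁, B.q₂, B.q₃, B.q₄, B.q₁] ++ (P.headI :: P.tail.reverse) ++ [P.headI]

/-! ### Triangulations -/

/-- `(a, b)` is a side of the triangle with vertex set `t`, directed counterclockwise, so that the
triangle lies to the left of it. -/
def IsSide (t : Finset ℂ) (a b : ℂ) : Prop :=
  ∃ c, (t : Set ℂ) = {a, b, c} ∧ 0 < orient a b c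

/-- The closed triangle with vertex set `t`. -/
def body (t : Finset ℂ) : Set ℂ := convexHull ℝ (t : Set ℂ)

/-- `T` is (the set of triangles of) an `E`-triangulation of the clockwise closed polygon `H`: the
triangles partition the interior of `H`, and each of their sides is an edge of `E` that is an edge
of `H` (with the interior of `H` on the side of the triangle) or a diagonal in the interior
of `H`. -/
structure IsTriangulation (H : List ℂ) (E : Set (ℂ × ℂ)) (T : Finset (Finset ℂ)) : Prop where
  triangle : ∀ t ∈ T, ∃ a b, IsSide t a b
  inside : ∀ t ∈ T, interior (body t) ⊆ inner H
  disjoint : ∀ t ∈ T, ∀ t' ∈ T, t ≠ t' → Disjoint (interior (body t)) (interior (body t'))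
  cover : inner H ⊆ ⋃ t ∈ T, body t
  side_mem : ∀ t ∈ T, ∀ a b, IsSide t a b → (a, b) ∈ E ∨ (b, a) ∈ E
  side : ∀ t ∈ T, ∀ a b, IsSide t a b → (b, a) ∈ edges H ∨ openSeg (a, b) ⊆ inner H

/-- The directed edge `e` is part of `T`: it is a side of a triangle, and `T` does not contain a
different edge in its place, that is, any triangle along the left of `e` has `e` as a full side. (For
polygons with vertices in the interior of edges, the two sides of `e` may be subdivided
differently.) -/
def IsPartOf (e : ℂ × ℂ) (T : Finset (Finset ℂ)) : Prop :=
  (∃ t ∈ T, IsSide t e.1 e.2 ∨ IsSide t e.2 e.1) ∧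
    ∀ t ∈ T, ∀ f : ℂ × ℂ, IsSide t f.1 f.2 → Overlap e f → f = e

/-- `E` is an enrichment of `C` and the polygon `D`. -/
structure IsEnrichment (C : Set (ℂ × ℂ)) (D : List ℂ) (E : Set (ℂ × ℂ)) : Prop where
  subset : C ⊆ E
  contained : ∀ e ∈ E, seg e ⊆ trace D ∪ inner D
  endpoints : ∀ e ∈ E, e.1 ∈ D ∧ e.2 ∈ D
  extend : ∀ C' ⊆ C, (∀ e ∈ C', ∀ f ∈ C', ¬ Cross e f) →
    ∃ T, IsTriangulation D E T ∧ ∀ e ∈ C', IsPartOf e T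

/-- A labeled `E`-triangulation of the sliced donut (`label t = true`: `t` is active). The triangles
at the cut edge are inactive. -/
structure Labeled (P : List ℂ) (B : Box) (E : Set (ℂ × ℂ)) where
  tri : Finset (Finset ℂ)
  isTriangulation : IsTriangulation (donut P B) E tri
  label : Finset ℂ → Bool
  cut : ∀ t ∈ tri, IsSide t P.headI B.q₁ ∨ IsSide t B.q₁ P.headI → label t = false

/-- The directed edge `(a, b)` is a separator: it has an inactive triangle on its left, and it is an
edge of `P` or has an active triangle on its right. An edge of `P` with exterior on both
sides consists of two directed edges, each of which may be a separator. -/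
def Labeled.IsSeparator {P : List ℂ} {B : Box} {E : Set (ℂ × ℂ)} (T : Labeled P B E)
    (e : ℂ × ℂ) : Prop :=
  (∃ t ∈ T.tri, T.label t = false ∧ IsSide t e.1 e.2) ∧
    (e ∈ edges P ∨ ∃ t ∈ T.tri, T.label t = true ∧ IsSide t e.2 e.1)

open Classical in
/-- The set of separators; every side of a triangle is a pair of its vertices. -/
noncomputable def Labeled.separators {P : List ℂ} {B : Box} {E : Set (ℂ × ℂ)}
    (T : Labeled P B E) : Finset (ℂ × ℂ) :=
  (T.tri.biUnion fun t => t ×ˢ t).filter T.IsSeparator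

/-- The total area of the active triangles. -/
noncomputable def Labeled.area {P : List ℂ} {B : Box} {E : Set (ℂ × ℂ)} (T : Labeled P B E) : ℝ :=
  ∑ t ∈ T.tri with T.label t = true, (volume (body t)).toReal

open Classical in
/-- The cost of a labeled triangulation. A separator that is not in `C` has infinite length,
and the cost is then infinite (also for `lam = 0`). -/
noncomputable def Labeled.cost {P : List ℂ} {B : Box} {E : Set (ℂ × ℂ)} (C : Set (ℂ × ℂ))
    (lam : ℝ) (T : Labeled P B E) : ENNReal :=
  if ∀ e ∈ T.separators, e ∈ C then
    ENNReal.ofReal (lam * ∑ e ∈ T.separators, dist e.1 e.2 + (1 - lam) * T.area)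
  else ⊤

/-- `T` is optimal among all labeled `E`-triangulations of the sliced donut. -/
def Labeled.IsOptimal {P : List ℂ} {B : Box} {E : Set (ℂ × ℂ)} (C : Set (ℂ × ℂ))
    (lam : ℝ) (T : Labeled P B E) : Prop :=
  ∀ T' : Labeled P B E, T.cost C lam ≤ T'.cost C lam

/-- The separators of `T` form `Q`: they are exactly the directed boundary edges of `Q`, each
of which occurs once. -/
def Labeled.Forms {P : List ℂ} {B : Box} {E : Set (ℂ × ℂ)} (T : Labeled P B E)
    (Q : HoledPolygon) : Prop :=
  (Q.bdry : Multiset (ℂ × ℂ)) = T.separators.val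

end ShortcutHull

/-!
Labeled triangulations of the sliced donut correspond to hulls of `P`: the active triangles are
the part of the hull outside of `P`, and the separators are its boundary.

*Winding numbers.* Everything is expressed through the total angle `asum es z` under which a list
`es` of directed edges is seen from `z`. If `es` is a union of closed chains, it is locally
constant off the edges (`asum_const`, `asum_eventually`), it vanishes at points that a half plane
separates from the edges (`asum_eq_zero`), and across a generic point of an edge it jumps by `2π`
times the signed number of edges that pass through (`jump_eq`). Hence the interior of the donut is
the part of the rectangle around which `P` does not wind (`mem_inner_donut`). The triangles of a
triangulation meet edge to edge at diagonals (`VertexTriangulation.exists_neighbour`,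
`VertexTriangulation.diagonal_unique`).

*From triangulations to hulls.* The inactive triangles are glued along diagonals. Gluing one
triangle after the other produces a disc with a closed boundary walk (`Disc`, `Disc.insert`). A
disc never closes up to an annulus (`Disc.notMem_of_side`): a loop in the annulus that crosses the
closing diagonal once would wind differently around the two endpoints of the diagonal, but the
boundary of the donut connects these outside of the loop. Each disc carries a parametrization up
to its boundary (`Model`) in which the boundary walk is visibly a limit of simple closed curves in
the disc (`Model.nearbyLoop`). So the inactive triangles decompose into discs with disjoint
interiors (`exists_pieces`), whose boundary walks consist of separators, sides of the rectangle
and copies of the cut edge. Only the disc at the cut edge contains the latter two: its boundary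
walk runs along the cut edge, along a closed walk `U` in `P`, back along the cut edge and around
the rectangle (`Labeled.exists_decomposition`). Here `U` is the outer boundary of the hull and the
other boundary walks are its holes. The curves that approximate `U` stay in the disc and step
across the cut edge once (`Model.nearbyLoop_cut`). The winding number of the hull is the number of
inactive triangles at a point minus the winding number of the rectangle
(`Decomposition.asum_bdry`), and the conditions on the hull follow from this formula.

*From hulls to triangulations.* The boundary edges of a hull do not cross, so the enrichment
provides a triangulation that contains all of them. No triangle meets the boundary in its
interior, so each lies inside or outside of the hull and is labeled accordingly
(`IsHull.exists_labeled`). By the jump formula, each separator is a boundary edge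
(`IsHull.separator_mem`). By the first construction, the separators already bound a hull of the
same area, so they are the whole boundary if this is irredundant.

In both directions the hull is, up to a null set, the union of `P` and the active triangles
(`area_of_region_ae`), which compares the costs. Optimality is transferred by combining the two
constructions.
-/

namespace ShortcutHull

open Filter Topology


/-! ### Orientation, segments and triangles -/

lemma orient_rot (a b c : ℂ) : orient b c a = orient a b c := by
  unfold orient; simp only [Complex.sub_re, Complex.sub_im]; ring

lemma orient_swap (a b c : ℂ) : orient b a c = -orient a b c := by
  unfold orient; simp only [Complex.sub_re, Complex.sub_im]; ring

lemma orient_left (a b : ℂ) : orient a b a = 0 := by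
  unfold orient; simp

lemma orient_right (a b : ℂ) : orient a b b = 0 := by
  unfold orient; simp only [Complex.sub_re, Complex.sub_im]; ring

lemma orient_same (a b : ℂ) : orient a a b = 0 := by
  unfold orient; simp

lemma orient_lineMap (a b z w : ℂ) (s : ℝ) :
    orient a b (z + s • (w - z)) = (1 - s) * orient a b z + s * orient a b w := by
  unfold orient
  simp only [Complex.sub_re, Complex.sub_im, Complex.add_re, Complex.add_im, Complex.real_smul,
    Complex.re_ofReal_mul, Complex.im_ofReal_mul]
  ring

/-- Moving to the left of the directed line increases `orient`. -/
lemma orient_add_normal (a b z d : ℂ) (ε r : ℝ) (h : b - a = r • d) :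
    orient a b (z + ε * (Complex.I * d)) = orient a b z + r * ε * Complex.normSq d := by
  unfold orient
  rw [h]
  simp only [Complex.sub_re, Complex.sub_im, Complex.add_re, Complex.add_im, Complex.real_smul,
    Complex.ofReal_re, Complex.ofReal_im, Complex.mul_re, Complex.mul_im, Complex.I_re,
    Complex.I_im, Complex.normSq_apply]
  ring

lemma continuous_orient (a b : ℂ) : Continuous (orient a b) := by
  unfold orient; fun_prop

lemma mem_seg {e : ℂ × ℂ} {z : ℂ} :
    z ∈ seg e ↔ ∃ s : ℝ, 0 ≤ s ∧ s ≤ 1 ∧ z = e.1 + s • (e.2 - e.1) := by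
  unfold seg
  rw [segment_eq_image']
  constructor
  · rintro ⟨s, hs, rfl⟩; exact ⟨s, hs.1, hs.2, rfl⟩
  · rintro ⟨s, h0, h1, rfl⟩; exact ⟨s, ⟨h0, h1⟩, rfl⟩

lemma mem_openSeg {e : ℂ × ℂ} {z : ℂ} :
    z ∈ openSeg e ↔ ∃ s : ℝ, 0 < s ∧ s < 1 ∧ z = e.1 + s • (e.2 - e.1) := by
  unfold openSeg
  rw [openSegment_eq_image']
  constructor
  · rintro ⟨s, hs, rfl⟩; exact ⟨s, hs.1, hs.2, rfl⟩
  · rintro ⟨s, h0, h1, rfl⟩; exact ⟨s, ⟨h0, h1⟩, rfl⟩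

lemma openSeg_subset_seg (e : ℂ × ℂ) : openSeg e ⊆ seg e := openSegment_subset_segment ℝ _ _

lemma left_mem_seg (e : ℂ × ℂ) : e.1 ∈ seg e := left_mem_segment ℝ _ _

lemma right_mem_seg (e : ℂ × ℂ) : e.2 ∈ seg e := right_mem_segment ℝ _ _

lemma seg_swap (a b : ℂ) : seg (a, b) = seg (b, a) := segment_symm ℝ _ _

lemma openSeg_swap (a b : ℂ) : openSeg (a, b) = openSeg (b, a) := openSegment_symm ℝ _ _

lemma mem_openSeg_of_mem_seg {e : ℂ × ℂ} {z : ℂ} (h : z ∈ seg e) (h1 : z ≠ e.1) (h2 : z ≠ e.2) :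
    z ∈ openSeg e := mem_openSegment_of_ne_left_right h1.symm h2.symm h

lemma isCompact_seg (e : ℂ × ℂ) : IsCompact (seg e) := by
  unfold seg
  rw [segment_eq_image']
  exact isCompact_Icc.image (by fun_prop)

lemma isClosed_seg (e : ℂ × ℂ) : IsClosed (seg e) := (isCompact_seg e).isClosed

lemma volume_seg (e : ℂ × ℂ) : volume (seg e) = 0 := by
  have hsub : seg e ⊆ (line[ℝ, e.1, e.2] : Set ℂ) := by
    intro z hz
    obtain ⟨s, -, -, rfl⟩ := mem_seg.1 hz
    have := AffineMap.lineMap_mem_affineSpan_pair s e.1 e.2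
    rwa [AffineMap.lineMap_apply_module', add_comm] at this
  refine measure_mono_null hsub (Measure.addHaar_affineSubspace _ _ ?_)
  intro htop
  have h1 : Module.finrank ℝ (line[ℝ, e.1, e.2]).direction ≤ 1 := by
    rw [direction_affineSpan]
    exact (collinear_iff_finrank_le_one).1 (collinear_pair ℝ e.1 e.2)
  rw [htop, AffineSubspace.direction_top, finrank_top, Complex.finrank_real_complex] at h1
  omega

lemma openSeg_midpoint (e : ℂ × ℂ) : e.1 + (1 / 2 : ℝ) • (e.2 - e.1) ∈ openSeg e :=
  mem_openSeg.2 ⟨1 / 2, by norm_num, by norm_num, rfl⟩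

lemma overlap_orient {e f : ℂ × ℂ} (h : Overlap e f) :
    ∃ r : ℝ, 0 < r ∧ f.2 - f.1 = r • (e.2 - e.1) ∧ ∀ w, orient f.1 f.2 w = r * orient e.1 e.2 w := by
  obtain ⟨⟨z, hz1, hz2⟩, r, hr, hrd⟩ := h
  refine ⟨r, hr, hrd, fun w => ?_⟩
  obtain ⟨s, -, -, hs⟩ := mem_openSeg.1 hz1
  obtain ⟨u, -, -, hu⟩ := mem_openSeg.1 hz2
  have hf1 : f.1 = e.1 + (s - u * r) • (e.2 - e.1) := by
    rw [hu, hrd, smul_smul] at hs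
    rw [sub_smul, ← add_sub_assoc, ← hs]; abel
  unfold orient
  rw [hrd, hf1]
  simp only [Complex.sub_re, Complex.sub_im, Complex.add_re, Complex.add_im, Complex.real_smul,
    Complex.re_ofReal_mul, Complex.im_ofReal_mul]
  ring

/-- Overlapping edges none of which has an endpoint in the relative interior of the other
coincide. -/
lemma Overlap.eq_of_endpoints {e f : ℂ × ℂ} (h : Overlap e f)
    (h1 : e.1 ∉ openSeg f) (h2 : e.2 ∉ openSeg f) (h3 : f.1 ∉ openSeg e) (h4 : f.2 ∉ openSeg e) :
    e = f := by
  obtain ⟨⟨z, hz1, hz2⟩, r, hr, hrd⟩ := h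
  obtain ⟨s, hs0, hs1, hs⟩ := mem_openSeg.1 hz1
  obtain ⟨u, hu0, hu1, hu⟩ := mem_openSeg.1 hz2
  set d := e.2 - e.1 with hd
  set σ := s - u * r with hσ
  have hf1 : f.1 = e.1 + σ • d := by
    rw [hu, hrd, smul_smul] at hs
    rw [hσ, sub_smul, ← add_sub_assoc, ← hs]; abel
  have hf2 : f.2 = e.1 + (σ + r) • d := by
    rw [add_smul, ← hrd, ← add_assoc, ← hf1]; abel
  have he2 : e.2 = e.1 + (1 : ℝ) • d := by rw [one_smul, hd]; abel
  have key : ∀ x : ℝ, σ < x → x < σ + r → e.1 + x • d ∈ openSeg f := by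
    intro x hx1 hx2
    refine mem_openSeg.2 ⟨(x - σ) / r, by apply div_pos <;> linarith, ?_, ?_⟩
    · rw [div_lt_one hr]; linarith
    · rw [hrd, smul_smul, div_mul_cancel₀ _ hr.ne', hf1, sub_smul x]; abel
  have hsσ : σ < s := by nlinarith
  have hsσ' : s < σ + r := by nlinarith
  have a1 : σ ≤ 0 := by
    by_contra hc
    exact h3 (mem_openSeg.2 ⟨σ, not_le.1 hc, by linarith, hf1⟩)
  have a2 : 1 ≤ σ + r := by
    by_contra hc
    exact h4 (mem_openSeg.2 ⟨σ + r, by linarith, not_le.1 hc, hf2⟩)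
  have a3 : 0 ≤ σ := by
    by_contra hc
    exact h1 (by simpa using key 0 (not_le.1 hc) (by linarith))
  have a4 : σ + r ≤ 1 := by
    by_contra hc
    exact h2 (by rw [he2]; exact key 1 (by linarith) (not_le.1 hc))
  have hσ0 : σ = 0 := le_antisymm a1 a3
  have hr1 : σ + r = 1 := le_antisymm a4 a2
  apply Prod.ext
  · rw [hf1, hσ0, zero_smul, add_zero]
  · rw [hf2, hr1, ← he2]

/-! ### Triangles -/

/-- `t` is the triangle with the vertices `a b c` in counterclockwise order. -/
def IsTri (t : Finset ℂ) (a b c : ℂ) : Prop := (t : Set ℂ) = {a, b, c} ∧ 0 < orient a b c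

lemma IsTri.rot {t : Finset ℂ} {a b c : ℂ} (h : IsTri t a b c) : IsTri t b c a := by
  refine ⟨?_, by rw [orient_rot]; exact h.2⟩
  rw [h.1]; ext x; simp only [Set.mem_insert_iff, Set.mem_singleton_iff]; tauto

lemma IsTri.side {t : Finset ℂ} {a b c : ℂ} (h : IsTri t a b c) : IsSide t a b := ⟨c, h⟩

lemma IsSide.tri {t : Finset ℂ} {a b : ℂ} (h : IsSide t a b) : ∃ c, IsTri t a b c := h

lemma IsTri.ne {t : Finset ℂ} {a b c : ℂ} (h : IsTri t a b c) : a ≠ b := by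
  rintro rfl; have := h.2; rw [orient_same] at this; exact lt_irrefl _ this

lemma IsSide.ne {t : Finset ℂ} {a b : ℂ} (h : IsSide t a b) : a ≠ b := h.tri.choose_spec.ne

lemma IsSide.left_mem {t : Finset ℂ} {a b : ℂ} (h : IsSide t a b) : a ∈ t := by
  obtain ⟨c, h, -⟩ := h
  have : a ∈ (t : Set ℂ) := by rw [h]; simp
  exact this

lemma IsSide.right_mem {t : Finset ℂ} {a b : ℂ} (h : IsSide t a b) : b ∈ t := by
  obtain ⟨c, h, -⟩ := h
  have : b ∈ (t : Set ℂ) := by rw [h]; simp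
  exact this

lemma IsTri.side_cases {t : Finset ℂ} {a b c x y : ℂ} (h : IsTri t a b c) (hs : IsSide t x y) :
    (x = a ∧ y = b) ∨ (x = b ∧ y = c) ∨ (x = c ∧ y = a) := by
  obtain ⟨w, hw, ho⟩ := hs
  obtain ⟨h, h0⟩ := h
  rw [h] at hw
  have hx : x ∈ ({a, b, c} : Set ℂ) := by rw [hw]; simp
  have hy : y ∈ ({a, b, c} : Set ℂ) := by rw [hw]; simp
  have hz : w ∈ ({a, b, c} : Set ℂ) := by rw [hw]; simp
  simp only [Set.mem_insert_iff, Set.mem_singleton_iff] at hx hy hz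
  have e1 := orient_rot a b c
  have e2 := orient_rot b c a
  have e3 := orient_swap a b c
  have e4 := orient_swap b c a
  have e5 := orient_swap c a b
  rcases hx with rfl | rfl | rfl <;> rcases hy with rfl | rfl | rfl <;>
    rcases hz with rfl | rfl | rfl <;>
    simp_all [orient_same, orient_left, orient_right] <;> linarith

lemma body_eq {t : Finset ℂ} {a b c : ℂ} (h : IsTri t a b c) :
    body t = {z | 0 ≤ orient a b z ∧ 0 ≤ orient b c z ∧ 0 ≤ orient c a z} := by
  obtain ⟨h, h0⟩ := h
  unfold body
  rw [h]
  apply Set.Subset.antisymm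
  · apply convexHull_min
    · rintro z hz
      simp only [Set.mem_insert_iff, Set.mem_singleton_iff] at hz
      have e1 := orient_rot a b c
      have e2 := orient_rot b c a
      rcases hz with rfl | rfl | rfl <;>
        simp only [Set.mem_ofPred_eq, orient_left, orient_right] <;>
        refine ⟨?_, ?_, ?_⟩ <;> linarith
    · intro z hz w hw p q hp hq hpq
      have hp' : p = 1 - q := by linarith
      have hform : p • z + q • w = z + q • (w - z) := by
        rw [hp', sub_smul, one_smul, smul_sub]; abel
      rw [hform]
      simp only [Set.mem_ofPred_eq, orient_lineMap, ← hp']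
      obtain ⟨z1, z2, z3⟩ := hz
      obtain ⟨w1, w2, w3⟩ := hw
      refine ⟨?_, ?_, ?_⟩ <;> positivity
  · rintro z ⟨h1, h2, h3⟩
    have hsum : orient b c z + orient c a z + orient a b z = orient a b c := by
      unfold orient; simp only [Complex.sub_re, Complex.sub_im]; ring
    set D := orient a b c with hD
    have hz : z = (orient b c z / D) • a + (orient c a z / D) • b + (orient a b z / D) • c := by
      have hne : D ≠ 0 := h0.ne'
      apply Complex.ext
      · simp only [Complex.add_re, Complex.real_smul, Complex.re_ofReal_mul]
        field_simp
        rw [hD]; unfold orient; simp only [Complex.sub_re, Complex.sub_im]; ring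
      · simp only [Complex.add_im, Complex.real_smul, Complex.im_ofReal_mul]
        field_simp
        rw [hD]; unfold orient; simp only [Complex.sub_re, Complex.sub_im]; ring
    have := (convex_convexHull ℝ ({a, b, c} : Set ℂ)).sum_mem (t := Finset.univ)
      (w := ![orient b c z / D, orient c a z / D, orient a b z / D]) (z := ![a, b, c])
      (by
        intro i _
        fin_cases i <;> simp <;> positivity)
      (by
        rw [Fin.sum_univ_three]
        simp
        rw [← add_div, ← add_div, hsum, div_self h0.ne'])
      (by
        intro i _
        apply subset_convexHull
        fin_cases i <;> simp)
    rw [Fin.sum_univ_three] at this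
    simp only [Matrix.cons_val_zero, Matrix.cons_val_one, Matrix.cons_val] at this
    rw [hz]
    exact this

lemma interior_body {t : Finset ℂ} {a b c : ℂ} (h : IsTri t a b c) :
    interior (body t) = {z | 0 < orient a b z ∧ 0 < orient b c z ∧ 0 < orient c a z} := by
  apply Set.Subset.antisymm
  · have key : ∀ {a b c : ℂ}, IsTri t a b c → ∀ z ∈ interior (body t), 0 < orient a b z := by
      intro a b c h z hz
      by_contra hc
      have hcont : Tendsto (fun ε : ℝ => z + ((-ε : ℝ) : ℂ) * (Complex.I * (b - a))) (𝓝[>] 0)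
          (𝓝 z) := by
        have : Tendsto (fun ε : ℝ => z + ((-ε : ℝ) : ℂ) * (Complex.I * (b - a))) (𝓝 0)
          (𝓝 (z + ((-(0 : ℝ) : ℝ) : ℂ) * (Complex.I * (b - a)))) := by
          apply Continuous.tendsto; fun_prop
        simp only [neg_zero, Complex.ofReal_zero, zero_mul, add_zero] at this
        exact this.mono_left nhdsWithin_le_nhds
      have := (hcont.eventually (isOpen_interior.mem_nhds hz)).and self_mem_nhdsWithin
      obtain ⟨ε, h1, h2⟩ := this.exists
      have h3 := interior_subset h1
      rw [body_eq h] at h3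
      have h4 := h3.1
      rw [orient_add_normal a b z (b - a) _ 1 (by simp)] at h4
      have h5 : 0 < Complex.normSq (b - a) := Complex.normSq_pos.2 (sub_ne_zero.2 h.ne.symm)
      have h6 : 0 < ε := h2
      have := mul_pos h6 h5
      linarith
    intro z hz
    exact ⟨key h z hz, key h.rot z hz, key h.rot.rot z hz⟩
  · apply interior_maximal
    · rw [body_eq h]
      rintro z ⟨h1, h2, h3⟩
      exact ⟨h1.le, h2.le, h3.le⟩
    · exact (isOpen_lt continuous_const (continuous_orient _ _)).inter
        ((isOpen_lt continuous_const (continuous_orient _ _)).inter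
        (isOpen_lt continuous_const (continuous_orient _ _)))

lemma isCompact_body (t : Finset ℂ) : IsCompact (body t) :=
  (t.finite_toSet).isCompact_convexHull ℝ

lemma isClosed_body (t : Finset ℂ) : IsClosed (body t) := (isCompact_body t).isClosed

lemma convex_body (t : Finset ℂ) : Convex ℝ (body t) := convex_convexHull ℝ _

lemma volume_frontier_body (t : Finset ℂ) : volume (frontier (body t)) = 0 :=
  (convex_body t).addHaar_frontier _

/-- The orientations with respect to the other two sides are positive on an open side. -/
lemma IsTri.orient_pos_of_mem_openSeg {t : Finset ℂ} {a b c z : ℂ} (h : IsTri t a b c)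
    (hz : z ∈ openSeg (a, b)) : orient a b z = 0 ∧ 0 < orient b c z ∧ 0 < orient c a z := by
  obtain ⟨s, h0, h1, rfl⟩ := mem_openSeg.1 hz
  have e1 := orient_rot a b c
  have e2 := orient_rot b c a
  have := h.2
  simp only [orient_lineMap, orient_left, orient_right]
  rw [e1, e2, e1]
  refine ⟨by ring, ?_, ?_⟩ <;> simp <;> nlinarith

/-- Near a point of an open side, the open triangle is the left side of this side. -/
lemma IsSide.eventually_interior {t : Finset ℂ} {a b z : ℂ} (h : IsSide t a b)
    (hz : z ∈ openSeg (a, b)) :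
    ∀ᶠ w in 𝓝 z, (w ∈ interior (body t) ↔ 0 < orient a b w) := by
  obtain ⟨c, h⟩ := h
  have hpos := IsTri.orient_pos_of_mem_openSeg h hz
  rw [interior_body h]
  filter_upwards [(continuous_orient b c).continuousAt.eventually (lt_mem_nhds hpos.2.1),
    (continuous_orient c a).continuousAt.eventually (lt_mem_nhds hpos.2.2)] with w h1 h2
  exact ⟨fun h => h.1, fun h => ⟨h, h1, h2⟩⟩

lemma tendsto_normal (z d : ℂ) :
    Tendsto (fun ε : ℝ => z + ε * (Complex.I * d)) (𝓝[>] 0) (𝓝 z) := by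
  have : Tendsto (fun ε : ℝ => z + ε * (Complex.I * d)) (𝓝 0)
    (𝓝 (z + (0 : ℝ) * (Complex.I * d))) := by
    apply Continuous.tendsto; fun_prop
  simp only [Complex.ofReal_zero, zero_mul, add_zero] at this
  exact this.mono_left nhdsWithin_le_nhds

lemma tendsto_normal' (z d : ℂ) :
    Tendsto (fun ε : ℝ => z - ε * (Complex.I * d)) (𝓝[>] 0) (𝓝 z) := by
  have : Tendsto (fun ε : ℝ => z - ε * (Complex.I * d)) (𝓝 0)
    (𝓝 (z - (0 : ℝ) * (Complex.I * d))) := by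
    apply Continuous.tendsto; fun_prop
  simp only [Complex.ofReal_zero, zero_mul, sub_zero] at this
  exact this.mono_left nhdsWithin_le_nhds

/-- Just to the left of a point of a side is the open triangle. -/
lemma IsSide.eventually_left {t : Finset ℂ} {a b z d : ℂ} {r : ℝ} (h : IsSide t a b)
    (hz : z ∈ openSeg (a, b)) (hr : 0 < r) (hd : b - a = r • d) :
    ∀ᶠ ε : ℝ in 𝓝[>] 0, z + ε * (Complex.I * d) ∈ interior (body t) := by
  filter_upwards [(tendsto_normal z d).eventually (h.eventually_interior hz), self_mem_nhdsWithin]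
    with ε h1 h2
  rw [h1]
  obtain ⟨c, h⟩ := h
  rw [orient_add_normal a b z d ε r hd, (IsTri.orient_pos_of_mem_openSeg h hz).1, zero_add]
  have hd0 : d ≠ 0 := by
    rintro rfl
    rw [smul_zero, sub_eq_zero] at hd
    exact IsTri.ne h hd.symm
  have : 0 < ε := h2
  have := Complex.normSq_pos.2 hd0
  positivity

lemma IsSide.seg_subset_body {t : Finset ℂ} {a b : ℂ} (h : IsSide t a b) :
    seg (a, b) ⊆ body t :=
  (convex_body t).segment_subset (subset_convexHull ℝ _ h.left_mem)
    (subset_convexHull ℝ _ h.right_mem)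

lemma IsSide.notMem_interior {t : Finset ℂ} {a b z : ℂ} (h : IsSide t a b)
    (hz : z ∈ seg (a, b)) : z ∉ interior (body t) := by
  obtain ⟨c, h⟩ := h
  rw [interior_body h]
  rintro ⟨h1, -, -⟩
  obtain ⟨s, -, -, rfl⟩ := mem_seg.1 hz
  simp only [orient_lineMap, orient_left, orient_right] at h1
  simp at h1

lemma IsSide.body_subset_closure {t : Finset ℂ} {a b : ℂ} (h : IsSide t a b) :
    body t ⊆ closure (interior (body t)) := by
  have hne : (interior (body t)).Nonempty := by
    have hz := openSeg_midpoint (a, b)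
    obtain ⟨ε, hε⟩ := (h.eventually_left hz one_pos (d := b - a) (by simp)).exists
    exact ⟨_, hε⟩
  rw [(convex_body t).closure_interior_eq_closure_of_nonempty_interior hne]
  exact subset_closure

lemma IsSide.interior_nonempty {t : Finset ℂ} {a b : ℂ} (h : IsSide t a b) :
    (interior (body t)).Nonempty := by
  have := h.body_subset_closure (h.seg_subset_body (left_mem_seg (a, b)))
  exact closure_nonempty_iff.1 ⟨_, this⟩

/-- Points of a triangle are interior points, or lie on an open side, or are vertices. -/
lemma IsTri.mem_body_cases {t : Finset ℂ} {a b c z : ℂ} (h : IsTri t a b c) (hz : z ∈ body t) :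
    z ∈ interior (body t) ∨ (∃ x y, IsSide t x y ∧ z ∈ openSeg (x, y)) ∨ z ∈ t := by
  have key : ∀ {a b c : ℂ}, IsTri t a b c → orient a b z = 0 → 0 ≤ orient b c z →
      0 ≤ orient c a z → (∃ x y, IsSide t x y ∧ z ∈ openSeg (x, y)) ∨ z ∈ t := by
    intro a b c h h0 h1 h2
    by_cases hzt : z ∈ t
    · exact Or.inr hzt
    left
    refine ⟨a, b, h.side, ?_⟩
    have hsum : orient b c z + orient c a z + orient a b z = orient a b c := by
      unfold orient; simp only [Complex.sub_re, Complex.sub_im]; ring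
    have hD := h.2
    apply mem_openSeg_of_mem_seg
    · refine mem_seg.2 ⟨orient c a z / orient a b c, by positivity, ?_, ?_⟩
      · rw [div_le_one hD]; linarith
      · have hne : orient a b c ≠ 0 := hD.ne'
        apply Complex.ext
        · simp only [Complex.add_re, Complex.real_smul, Complex.re_ofReal_mul]
          field_simp
          unfold orient at h0 ⊢; simp only [Complex.sub_re, Complex.sub_im] at h0 ⊢
          linear_combination (c.re - a.re) * h0
        · simp only [Complex.add_im, Complex.real_smul, Complex.im_ofReal_mul]
          field_simp
          unfold orient at h0 ⊢; simp only [Complex.sub_re, Complex.sub_im] at h0 ⊢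
          linear_combination (c.im - a.im) * h0
    · rintro rfl; exact hzt h.side.left_mem
    · rintro rfl; exact hzt h.side.right_mem
  have hz' := hz
  rw [body_eq h] at hz'
  obtain ⟨h1, h2, h3⟩ := hz'
  rcases h1.eq_or_lt with h1' | h1'
  · exact Or.inr (key h h1'.symm h2 h3)
  rcases h2.eq_or_lt with h2' | h2'
  · exact Or.inr (key h.rot h2'.symm h3 h1)
  rcases h3.eq_or_lt with h3' | h3'
  · exact Or.inr (key h.rot.rot h3'.symm h1 h2)
  left; rw [interior_body h]; exact ⟨h1', h2', h3'⟩

/-- Overlapping sides of a triangle are equal. -/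
lemma IsSide.eq_of_overlap {t : Finset ℂ} {e f : ℂ × ℂ} (he : IsSide t e.1 e.2)
    (hf : IsSide t f.1 f.2) (h : Overlap e f) : e = f := by
  obtain ⟨r, hr, hd, ho⟩ := overlap_orient h
  obtain ⟨c, hc⟩ := he
  rcases IsTri.side_cases hc hf with ⟨h1, h2⟩ | ⟨h1, h2⟩ | ⟨h1, h2⟩
  · exact Prod.ext h1.symm h2.symm
  · have := ho f.2
    rw [orient_right, h2] at this
    have := hc.2
    nlinarith
  · have := ho f.1
    rw [orient_left, h1] at this
    have := hc.2
    nlinarith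

/-- The open sides of a triangle are disjoint. -/
lemma IsSide.disjoint_openSeg {t : Finset ℂ} {a b x y z : ℂ} (he : IsSide t a b)
    (hf : IsSide t x y) (hz : z ∈ openSeg (a, b)) (hz' : z ∈ openSeg (x, y)) :
    x = a ∧ y = b := by
  obtain ⟨c, hc⟩ := he
  obtain ⟨h1, h2, h3⟩ := IsTri.orient_pos_of_mem_openSeg hc hz
  rcases IsTri.side_cases hc hf with h | h | h
  · exact h
  · rw [h.1, h.2] at hz'
    have := (IsTri.orient_pos_of_mem_openSeg (IsTri.rot hc) hz').1
    linarith
  · rw [h.1, h.2] at hz'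
    have := (IsTri.orient_pos_of_mem_openSeg (IsTri.rot (IsTri.rot hc)) hz').1
    linarith

/-- On every nondegenerate edge that meets an open set there is a point of the open set that avoids
a finite set of points and every segment of a finite family that is not parallel to the edge. -/
lemma exists_generic {e : ℂ × ℂ} (he : e.1 ≠ e.2) {N : Set ℂ} (hN : IsOpen N) {x : ℂ}
    (hx : x ∈ seg e) (hxN : x ∈ N) {V : Set ℂ} (hV : V.Finite) {F : Set (ℂ × ℂ)} (hF : F.Finite) :
    ∃ z ∈ openSeg e, z ∈ N ∧ z ∉ V ∧ ∀ f ∈ F, z ∈ seg f →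
      z ∈ openSeg f ∧ ∃ r : ℝ, r ≠ 0 ∧ f.2 - f.1 = r • (e.2 - e.1) := by
  set d := e.2 - e.1 with hd
  have hd0 : d ≠ 0 := sub_ne_zero.2 he.symm
  let φ : ℝ → ℂ := fun s => e.1 + s • d
  have hφ : Continuous φ := by fun_prop
  have hinj : Function.Injective φ := by
    intro s u h
    have h' : s • d = u • d := add_left_cancel h
    exact smul_left_injective ℝ hd0 h'
  have hopen : IsOpen (φ ⁻¹' N ∩ Set.Ioo 0 1) := (hN.preimage hφ).inter isOpen_Ioo
  have hne : (φ ⁻¹' N ∩ Set.Ioo 0 1).Nonempty := by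
    obtain ⟨s, h0, h1, rfl⟩ := mem_seg.1 hx
    have hs : s ∈ closure (Set.Ioo (0 : ℝ) 1) := by
      rw [closure_Ioo (by norm_num)]; exact ⟨h0, h1⟩
    exact mem_closure_iff.1 hs _ (hN.preimage hφ) hxN
  -- a segment that is not parallel to the edge meets its line in at most one point
  have hbad : ∀ f ∈ F, (¬ ∃ r : ℝ, r ≠ 0 ∧ f.2 - f.1 = r • d) → f.1 ≠ f.2 →
      (φ ⁻¹' seg f).Subsingleton := by
    intro f _ hpar hfne s hs u hu
    obtain ⟨p, -, -, hp⟩ := mem_seg.1 hs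
    obtain ⟨q, -, -, hq⟩ := mem_seg.1 hu
    by_contra hsu
    have h1 : (s - u) • d = (p - q) • (f.2 - f.1) := by
      have : φ s - φ u = (p - q) • (f.2 - f.1) := by
        rw [hp, hq, sub_smul]; abel
      rw [← this]; simp only [φ]; rw [sub_smul]; abel
    have hpq : p - q ≠ 0 := by
      intro h; rw [h, zero_smul] at h1
      rcases smul_eq_zero.1 h1 with h | h
      · exact hsu (sub_eq_zero.1 h)
      · exact hd0 h
    apply hpar
    refine ⟨(s - u) / (p - q), div_ne_zero (sub_ne_zero.2 hsu) hpq, ?_⟩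
    rw [div_eq_inv_mul, mul_smul, h1, smul_smul, inv_mul_cancel₀ hpq, one_smul]
  let W : Set ℂ := V ∪ Prod.fst '' F ∪ Prod.snd '' F
  have hW : W.Finite := (hV.union (hF.image _)).union (hF.image _)
  let Bad : Set ℝ := φ ⁻¹' W ∪ ⋃ f ∈ {f ∈ F | (¬ ∃ r : ℝ, r ≠ 0 ∧ f.2 - f.1 = r • d) ∧ f.1 ≠ f.2},
    φ ⁻¹' seg f
  have hBad : Bad.Finite := by
    apply Set.Finite.union
    · exact hW.preimage hinj.injOn
    · apply Set.Finite.biUnion (hF.subset (Set.sep_subset _ _))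
      rintro f ⟨hf, h1, h2⟩
      exact (hbad f hf h1 h2).finite
  have hinf : (φ ⁻¹' N ∩ Set.Ioo 0 1).Infinite := by
    obtain ⟨s, hs⟩ := hne
    exact infinite_of_mem_nhds s (hopen.mem_nhds hs)
  obtain ⟨s, hs, hsB⟩ := (hinf.sdiff hBad).nonempty
  have hsW : φ s ∉ W := fun h => hsB (Or.inl h)
  refine ⟨φ s, mem_openSeg.2 ⟨s, hs.2.1, hs.2.2, rfl⟩, hs.1, fun h => hsW (Or.inl (Or.inl h)), ?_⟩
  intro f hf hzf
  have hf1 : φ s ≠ f.1 := fun h => hsW (Or.inl (Or.inr ⟨f, hf, h.symm⟩))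
  have hf2 : φ s ≠ f.2 := fun h => hsW (Or.inr ⟨f, hf, h.symm⟩)
  refine ⟨mem_openSeg_of_mem_seg hzf hf1 hf2, ?_⟩
  by_contra hpar
  apply hsB
  right
  simp only [Set.mem_iUnion]
  refine ⟨f, ⟨hf, hpar, ?_⟩, hzf⟩
  rintro heq
  obtain ⟨p, -, -, hp⟩ := mem_seg.1 hzf
  rw [heq, sub_self, smul_zero, add_zero] at hp
  exact hf2 hp


/-! ### Winding numbers of lists of edges -/

/-- The oriented angle under which the directed edge `e` is seen from `z`. -/
noncomputable def ang (e : ℂ × ℂ) (z : ℂ) : ℝ := Complex.arg ((e.2 - z) / (e.1 - z))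

/-- The total angle under which a list of directed edges is seen from `z`. -/
noncomputable def asum (es : List (ℂ × ℂ)) (z : ℂ) : ℝ := (es.map fun e => ang e z).sum

/-- Every point is as often the start as it is the end of an edge in the list. -/
def IsCycle (es : List (ℂ × ℂ)) : Prop := (es.map Prod.fst).Perm (es.map Prod.snd)

/-- The pairs of consecutive members of a list. -/
def pairs (V : List ℂ) : List (ℂ × ℂ) := V.zip V.tail

lemma winding_eq (l : List ℂ) (z : ℂ) : winding l z = asum (edges l) z / (2 * Real.pi) := rfl

lemma asum_nil (z : ℂ) : asum [] z = 0 := rfl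

lemma asum_cons (e : ℂ × ℂ) (es : List (ℂ × ℂ)) (z : ℂ) :
    asum (e :: es) z = ang e z + asum es z := by simp [asum]

lemma asum_append (es fs : List (ℂ × ℂ)) (z : ℂ) :
    asum (es ++ fs) z = asum es z + asum fs z := by simp [asum]

lemma asum_perm {es fs : List (ℂ × ℂ)} (h : es.Perm fs) (z : ℂ) : asum es z = asum fs z :=
  (h.map _).sum_eq

lemma winding_bdry (Q : HoledPolygon) (z : ℂ) : Q.winding z = asum Q.bdry z / (2 * Real.pi) := by
  unfold HoledPolygon.winding HoledPolygon.bdry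
  induction Q.cycles with
  | nil => simp [asum]
  | cons l L ih =>
    rw [List.map_cons, List.sum_cons, ih, List.flatMap_cons, asum_append, add_div]
    rfl

lemma isCycle_edges (l : List ℂ) : IsCycle (edges l) := by
  unfold IsCycle edges
  rw [List.map_fst_zip (by simp), List.map_snd_zip (by simp)]
  exact (List.rotate_perm l 1).symm

lemma IsCycle.append {es fs : List (ℂ × ℂ)} (h : IsCycle es) (h' : IsCycle fs) :
    IsCycle (es ++ fs) := by
  unfold IsCycle at *
  rw [List.map_append, List.map_append]
  exact h.append h'

lemma isCycle_bdry (Q : HoledPolygon) : IsCycle Q.bdry := by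
  unfold HoledPolygon.bdry
  induction Q.cycles with
  | nil => exact List.Perm.refl _
  | cons l L ih => rw [List.flatMap_cons]; exact (isCycle_edges l).append ih

lemma pairs_nil : pairs [] = [] := rfl
lemma pairs_single (x : ℂ) : pairs [x] = [] := rfl
lemma pairs_cons (x y : ℂ) (l : List ℂ) : pairs (x :: y :: l) = (x, y) :: pairs (y :: l) := rfl

lemma pairs_append (A : List ℂ) (x : ℂ) (B : List ℂ) :
    pairs (A ++ x :: B) = pairs (A ++ [x]) ++ pairs (x :: B) := by
  induction A with
  | nil => simp [pairs_single]
  | cons a A ih =>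
    cases A with
    | nil => simp [pairs_cons, pairs_single]
    | cons b A => simp only [List.cons_append, pairs_cons] at ih ⊢; rw [ih]

lemma edges_cons (x : ℂ) (l : List ℂ) : edges (x :: l) = pairs (x :: (l ++ [x])) := by
  unfold edges pairs
  have : (x :: l).rotate 1 = l ++ [x] := by simp
  rw [this]
  have h2 : x :: (l ++ [x]) = (x :: l) ++ [x] := rfl
  rw [List.tail_cons, h2]
  conv_rhs => rw [← List.append_nil (l ++ [x])]
  rw [List.zip_append (by simp)]
  simp

lemma pairs_reverse (V : List ℂ) : pairs V.reverse = ((pairs V).map Prod.swap).reverse := by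
  induction V with
  | nil => rfl
  | cons a V ih =>
    cases V with
    | nil => rfl
    | cons b V =>
      rw [pairs_cons, List.map_cons, List.reverse_cons (a := (a, b).swap), ← ih,
        List.reverse_cons (a := a), List.reverse_cons (a := b), List.append_assoc]
      exact pairs_append V.reverse b [a]

lemma mem_pairs {x y : ℂ} {V : List ℂ} (h : (x, y) ∈ pairs V) : ∃ A B, V = A ++ x :: y :: B := by
  induction V with
  | nil => simp [pairs_nil] at h
  | cons a V ih =>
    cases V with
    | nil => simp [pairs_single] at h
    | cons b V =>
      rw [pairs_cons, List.mem_cons] at h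
      rcases h with h | h
      · obtain ⟨rfl, rfl⟩ := Prod.mk.inj h
        exact ⟨[], V, rfl⟩
      · obtain ⟨A, B, hAB⟩ := ih h
        exact ⟨a :: A, B, by rw [hAB]; rfl⟩

/-! ### Continuity and constancy -/

lemma ratio_mem_slitPlane {e : ℂ × ℂ} {z : ℂ} (h : z ∉ seg e) :
    (e.2 - z) / (e.1 - z) ∈ Complex.slitPlane := by
  have h1 : e.1 - z ≠ 0 := by
    intro h0; apply h; rw [← sub_eq_zero.1 h0]; exact left_mem_seg e
  by_contra hc
  rw [Complex.mem_slitPlane_iff, not_or, not_lt, not_not] at hc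
  set w := (e.2 - z) / (e.1 - z) with hw
  obtain ⟨hre, him⟩ := hc
  have hwr : w = ((w.re : ℝ) : ℂ) := Complex.ext rfl (by simp [him])
  have h2 : e.2 - z = (w.re : ℂ) * (e.1 - z) := by rw [← hwr, hw, div_mul_cancel₀ _ h1]
  apply h
  have hpos : 0 < 1 - w.re := by linarith
  refine mem_seg.2 ⟨1 / (1 - w.re), by positivity, by rw [div_le_one hpos]; linarith, ?_⟩
  have h3 : e.2 - e.1 = (w.re - 1 : ℂ) * (e.1 - z) := by linear_combination h2
  rw [h3, Complex.real_smul]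
  have hne : (1 - w.re : ℂ) ≠ 0 := by exact_mod_cast hpos.ne'
  push_cast
  field_simp
  ring

lemma ang_swap {e : ℂ × ℂ} {z : ℂ} (h : z ∉ seg e) : ang e.swap z = -ang e z := by
  unfold ang
  rw [Prod.fst_swap, Prod.snd_swap, ← inv_div, Complex.arg_inv,
    if_neg (Complex.slitPlane_arg_ne_pi (ratio_mem_slitPlane h))]

lemma continuousAt_ang {e : ℂ × ℂ} {z : ℂ} (h : z ∉ seg e) : ContinuousAt (ang e) z := by
  have h1 : e.1 - z ≠ 0 := by
    intro h0; apply h; rw [← sub_eq_zero.1 h0]; exact left_mem_seg e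
  have hf : ContinuousAt (fun z => (e.2 - z) / (e.1 - z)) z :=
    ContinuousAt.div (by fun_prop) (by fun_prop) h1
  exact ContinuousAt.comp (f := fun z => (e.2 - z) / (e.1 - z)) (g := Complex.arg)
    (Complex.continuousAt_arg (ratio_mem_slitPlane h)) hf

lemma continuousAt_asum {es : List (ℂ × ℂ)} {z : ℂ} (h : ∀ e ∈ es, z ∉ seg e) :
    ContinuousAt (asum es) z := by
  induction es with
  | nil => exact continuousAt_const
  | cons e es ih =>
    have : asum (e :: es) = fun z => ang e z + asum es z := funext fun z => asum_cons e es z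
    rw [this]
    exact (continuousAt_ang (h e List.mem_cons_self)).add
      (ih fun f hf => h f (List.mem_cons_of_mem _ hf))

lemma asum_int {es : List (ℂ × ℂ)} (hes : IsCycle es) {z : ℂ} (h : ∀ e ∈ es, z ∉ seg e) :
    ∃ k : ℤ, asum es z = 2 * Real.pi * k := by
  have h1 : ((asum es z : ℝ) : Real.Angle) = ((0 : ℝ) : Real.Angle) := by
    have h2 : ∀ fs : List (ℂ × ℂ), (∀ e ∈ fs, z ∉ seg e) → ((asum fs z : ℝ) : Real.Angle) =
        ((fs.map Prod.snd).map fun v => ((Complex.arg (v - z) : ℝ) : Real.Angle)).sum -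
        ((fs.map Prod.fst).map fun v => ((Complex.arg (v - z) : ℝ) : Real.Angle)).sum := by
      intro fs
      induction fs with
      | nil => intro; simp [asum]
      | cons e fs ih =>
        intro h
        have ih' := ih fun f hf => h f (List.mem_cons_of_mem _ hf)
        have he := h e List.mem_cons_self
        have e1 : e.1 - z ≠ 0 := by
          intro h0; apply he; rw [← sub_eq_zero.1 h0]; exact left_mem_seg e
        have e2 : e.2 - z ≠ 0 := by
          intro h0; apply he; rw [← sub_eq_zero.1 h0]; exact right_mem_seg e
        rw [asum_cons, Real.Angle.coe_add, ih', ang, Complex.arg_div_coe_angle e2 e1]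
        simp only [List.map_cons, List.sum_cons]
        abel
    rw [h2 es h, ((hes.map _).sum_eq), sub_self, Real.Angle.coe_zero]
  obtain ⟨k, hk⟩ := Real.Angle.angle_eq_iff_two_pi_dvd_sub.1 h1
  exact ⟨k, by simpa using hk⟩

lemma asum_const {es : List (ℂ × ℂ)} (hes : IsCycle es) {S : Set ℂ} (hS : IsPreconnected S)
    (h : ∀ z ∈ S, ∀ e ∈ es, z ∉ seg e) {x y : ℂ} (hx : x ∈ S) (hy : y ∈ S) :
    asum es x = asum es y := by
  have hpi : (2 * Real.pi) ≠ 0 := by positivity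
  have hT : DiscreteTopology (Set.range ((↑) : ℤ → ℝ)) :=
    (Int.isClosedEmbedding_coe_real.isEmbedding.toHomeomorph).symm.isEmbedding.discreteTopology
  have hc : ContinuousOn (fun z => asum es z / (2 * Real.pi)) S := fun z hz =>
    ((continuousAt_asum (h z hz)).div_const _).continuousWithinAt
  have hm : Set.MapsTo (fun z => asum es z / (2 * Real.pi)) S (Set.range ((↑) : ℤ → ℝ)) := by
    intro z hz
    obtain ⟨k, hk⟩ := asum_int hes (h z hz)
    exact ⟨k, by simp only [hk]; field_simp⟩
  have := hS.constant_of_mapsTo ⟨hT⟩ hc hm hx hy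
  simpa [div_left_inj' hpi] using this

lemma isOpen_off (es : List (ℂ × ℂ)) : IsOpen {z | ∀ e ∈ es, z ∉ seg e} := by
  have : {z | ∀ e ∈ es, z ∉ seg e} = ⋂ e ∈ {e | e ∈ es}, (seg e)ᶜ := by
    ext z; simp
  rw [this]
  exact (List.finite_toSet es).isOpen_biInter fun e _ => (isClosed_seg e).isOpen_compl

lemma asum_eventually {es : List (ℂ × ℂ)} (hes : IsCycle es) {z : ℂ} (h : ∀ e ∈ es, z ∉ seg e) :
    ∀ᶠ w in 𝓝 z, (∀ e ∈ es, w ∉ seg e) ∧ asum es w = asum es z := by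
  obtain ⟨ε, hε, hb⟩ := Metric.isOpen_iff.1 (isOpen_off es) z h
  filter_upwards [Metric.ball_mem_nhds z hε] with w hw
  refine ⟨hb hw, asum_const hes (convex_ball z ε).isPreconnected (fun x hx => hb hx) hw
    (Metric.mem_ball_self hε)⟩

lemma ae_off (es : List (ℂ × ℂ)) : ∀ᵐ z : ℂ, ∀ e ∈ es, z ∉ seg e := by
  induction es with
  | nil => simp
  | cons e es ih =>
    have : ∀ᵐ z : ℂ, z ∉ seg e := measure_eq_zero_iff_ae_notMem.1 (volume_seg e)
    filter_upwards [ih, this] with z h1 h2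
    simp only [List.mem_cons, forall_eq_or_imp]
    exact ⟨h2, h1⟩

/-- Seen from a point outside of a half plane that contains all edges, the angles cancel. -/
lemma asum_eq_zero {es : List (ℂ × ℂ)} (hes : IsCycle es) {z n : ℂ}
    (h : ∀ e ∈ es, 0 < ((starRingEnd ℂ) n * (e.1 - z)).re ∧
      0 < ((starRingEnd ℂ) n * (e.2 - z)).re) : asum es z = 0 := by
  have h2 : ∀ fs : List (ℂ × ℂ), (∀ e ∈ fs, 0 < ((starRingEnd ℂ) n * (e.1 - z)).re ∧
      0 < ((starRingEnd ℂ) n * (e.2 - z)).re) → asum fs z =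
      ((fs.map Prod.snd).map fun v => Complex.arg ((starRingEnd ℂ) n * (v - z))).sum -
      ((fs.map Prod.fst).map fun v => Complex.arg ((starRingEnd ℂ) n * (v - z))).sum := by
    intro fs
    induction fs with
    | nil => intro; simp [asum]
    | cons e fs ih =>
      intro h
      have ih' := ih fun f hf => h f (List.mem_cons_of_mem _ hf)
      obtain ⟨h1, h2⟩ := h e List.mem_cons_self
      rw [asum_cons, ih']
      have hn1 : (starRingEnd ℂ) n * (e.1 - z) ≠ 0 := fun h => by simp [h] at h1
      have hn2 : (starRingEnd ℂ) n * (e.2 - z) ≠ 0 := fun h => by simp [h] at h2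
      have hn : (starRingEnd ℂ) n ≠ 0 := left_ne_zero_of_mul hn1
      have hang : ang e z = Complex.arg ((starRingEnd ℂ) n * (e.2 - z)) -
          Complex.arg ((starRingEnd ℂ) n * (e.1 - z)) := by
        unfold ang
        rw [← mul_div_mul_left _ _ hn]
        have a1 := Complex.abs_arg_lt_pi_div_two_iff.2 (Or.inl h1)
        have a2 := Complex.abs_arg_lt_pi_div_two_iff.2 (Or.inl h2)
        rw [abs_lt] at a1 a2
        have hcoe := Complex.arg_div_coe_angle hn2 hn1
        rw [← Real.Angle.coe_sub] at hcoe
        have := congrArg Real.Angle.toReal hcoe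
        rw [Complex.arg_coe_angle_toReal_eq_arg] at this
        rw [this, Real.Angle.toReal_coe_eq_self_iff]
        constructor <;> linarith
      rw [hang]
      simp only [List.map_cons, List.sum_cons]
      ring
  rw [h2 es h, (hes.map _).sum_eq, sub_self]

/-! ### The jump of the winding number across an edge -/

open Classical in
/-- The contribution of the edge `e` to the jump of the winding number at `z`, from right to left
with respect to the direction `d`. -/
noncomputable def jmp (z d : ℂ) (e : ℂ × ℂ) : ℝ :=
  if z ∈ openSeg e then if ∃ r : ℝ, 0 < r ∧ e.2 - e.1 = r • d then 1 else -1 else 0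

/-- `z` lies on the edge `e` only if it is an interior point and `e` is parallel to `d`. -/
def GenericAt (z d : ℂ) (e : ℂ × ℂ) : Prop :=
  z ∈ seg e → z ∈ openSeg e ∧ ∃ r : ℝ, r ≠ 0 ∧ e.2 - e.1 = r • d

/-- A segment on a line through the viewpoint, seen from just left of it, extends over the angle `π`
in the limit. -/
lemma tendsto_arg_left (α β : ℝ) (hα : 0 < α) (hβ : 0 < β) :
    Tendsto (fun ε : ℝ => Complex.arg ((β - ε * Complex.I) / (-α - ε * Complex.I))) (𝓝[>] 0)
      (𝓝 Real.pi) := by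
  have hne : (-α : ℂ) ≠ 0 := by simp [hα.ne']
  have h1 : Tendsto (fun ε : ℝ => (β - ε * Complex.I) / (-α - ε * Complex.I)) (𝓝 0)
      (𝓝 ((β : ℂ) / (-α))) := by
    have : ContinuousAt (fun ε : ℝ => (β - ε * Complex.I) / (-α - ε * Complex.I)) 0 :=
      ContinuousAt.div (by fun_prop) (by fun_prop) (by simpa using hne)
    have := this.tendsto
    simpa using this
  have hval : ((β : ℂ) / (-α)) = ((-(β / α) : ℝ) : ℂ) := by push_cast; rw [div_neg]
  rw [hval] at h1
  refine (Complex.tendsto_arg_nhdsWithin_im_nonneg_of_re_neg_of_im_zero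
    (z := ((-(β / α) : ℝ) : ℂ)) ?_ ?_).comp
    (tendsto_nhdsWithin_iff.2 ⟨h1.mono_left nhdsWithin_le_nhds, ?_⟩)
  · rw [Complex.ofReal_re]; have := div_pos hβ hα; linarith
  · rw [Complex.ofReal_im]
  · filter_upwards [self_mem_nhdsWithin] with ε hε
    have hε' : 0 < ε := hε
    change 0 ≤ _
    simp only [Complex.div_im]
    have hN : 0 ≤ Complex.normSq (-α - ε * Complex.I) := Complex.normSq_nonneg _
    rw [← sub_div]
    apply div_nonneg _ hN
    simp
    positivity

/-- A segment on a line through the viewpoint, seen from just right of it, extends over the angle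
`-π` in the limit. -/
lemma tendsto_arg_right (α β : ℝ) (hα : 0 < α) (hβ : 0 < β) :
    Tendsto (fun ε : ℝ => Complex.arg ((β + ε * Complex.I) / (-α + ε * Complex.I))) (𝓝[>] 0)
      (𝓝 (-Real.pi)) := by
  have hne : (-α : ℂ) ≠ 0 := by simp [hα.ne']
  have h1 : Tendsto (fun ε : ℝ => (β + ε * Complex.I) / (-α + ε * Complex.I)) (𝓝 0)
      (𝓝 ((β : ℂ) / (-α))) := by
    have : ContinuousAt (fun ε : ℝ => (β + ε * Complex.I) / (-α + ε * Complex.I)) 0 :=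
      ContinuousAt.div (by fun_prop) (by fun_prop) (by simpa using hne)
    have := this.tendsto
    simpa using this
  have hval : ((β : ℂ) / (-α)) = ((-(β / α) : ℝ) : ℂ) := by push_cast; rw [div_neg]
  rw [hval] at h1
  refine (Complex.tendsto_arg_nhdsWithin_im_neg_of_re_neg_of_im_zero
    (z := ((-(β / α) : ℝ) : ℂ)) ?_ ?_).comp
    (tendsto_nhdsWithin_iff.2 ⟨h1.mono_left nhdsWithin_le_nhds, ?_⟩)
  · rw [Complex.ofReal_re]; have := div_pos hβ hα; linarith
  · rw [Complex.ofReal_im]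
  · filter_upwards [self_mem_nhdsWithin] with ε hε
    have hε' : 0 < ε := hε
    change _ < 0
    simp only [Complex.div_im]
    have hN : 0 < Complex.normSq (-α + ε * Complex.I) := by
      apply Complex.normSq_pos.2
      intro h
      have := congrArg Complex.re h
      simp at this
      exact hα.ne' this
    rw [← sub_div]
    apply div_neg_of_neg_of_pos _ hN
    simp
    nlinarith [mul_pos hε' hα, mul_pos hε' hβ]

lemma tendsto_ang_sub {e : ℂ × ℂ} {z d : ℂ} (hd : d ≠ 0) (h : GenericAt z d e) :
    Tendsto (fun ε : ℝ => ang e (z + ε * (Complex.I * d)) - ang e (z - ε * (Complex.I * d)))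
      (𝓝[>] 0) (𝓝 (2 * Real.pi * jmp z d e)) := by
  by_cases hz : z ∈ seg e
  · obtain ⟨ho, r, hr, hrd⟩ := h hz
    obtain ⟨s, hs0, hs1, hs⟩ := mem_openSeg.1 ho
    -- with `z` as origin and `d` as unit, the edge runs from `-s * r` to `(1 - s) * r`
    have h1 : e.1 - z = ((-(s * r) : ℝ) : ℂ) * d := by
      rw [hs, hrd, ← Complex.real_smul, smul_smul, neg_smul]; abel
    have h2 : e.2 - z = (((1 - s) * r : ℝ) : ℂ) * d := by
      have : e.2 - z = (e.2 - e.1) + (e.1 - z) := by ring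
      rw [this, h1, hrd, Complex.real_smul]; push_cast; ring
    have l1 : ∀ ε : ℝ, ang e (z + ε * (Complex.I * d)) = Complex.arg
        ((((1 - s) * r : ℝ) - ε * Complex.I) / (((-(s * r) : ℝ) : ℂ) - ε * Complex.I)) := by
      intro ε
      unfold ang
      have a1 : e.1 - (z + ε * (Complex.I * d)) = (((-(s * r) : ℝ) : ℂ) - ε * Complex.I) * d := by
        linear_combination h1
      have a2 : e.2 - (z + ε * (Complex.I * d)) =
          ((((1 - s) * r : ℝ) : ℂ) - ε * Complex.I) * d := by
        linear_combination h2
      rw [a1, a2, mul_div_mul_right _ _ hd]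
    have l2 : ∀ ε : ℝ, ang e (z - ε * (Complex.I * d)) = Complex.arg
        ((((1 - s) * r : ℝ) + ε * Complex.I) / (((-(s * r) : ℝ) : ℂ) + ε * Complex.I)) := by
      intro ε
      unfold ang
      have a1 : e.1 - (z - ε * (Complex.I * d)) = (((-(s * r) : ℝ) : ℂ) + ε * Complex.I) * d := by
        linear_combination h1
      have a2 : e.2 - (z - ε * (Complex.I * d)) =
          ((((1 - s) * r : ℝ) : ℂ) + ε * Complex.I) * d := by
        linear_combination h2
      rw [a1, a2, mul_div_mul_right _ _ hd]
    simp only [l1, l2]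
    unfold jmp
    rw [if_pos ho]
    rcases lt_or_gt_of_ne hr with hneg | hpos
    · have hnot : ¬ ∃ r : ℝ, 0 < r ∧ e.2 - e.1 = r • d := by
        rintro ⟨r', hr', h'⟩
        rw [hrd] at h'
        have : r = r' := smul_left_injective ℝ hd h'
        linarith
      rw [if_neg hnot]
      have t1 := tendsto_arg_right (s * -r) ((1 - s) * -r) (by nlinarith) (by nlinarith)
      have t2 := tendsto_arg_left (s * -r) ((1 - s) * -r) (by nlinarith) (by nlinarith)
      have := t1.sub t2
      have hval : (-Real.pi - Real.pi) = 2 * Real.pi * -1 := by ring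
      rw [hval] at this
      refine this.congr fun ε => ?_
      congr 2
      · rw [← neg_div_neg_eq]; congr 1 <;> push_cast <;> ring
      · rw [← neg_div_neg_eq]; congr 1 <;> push_cast <;> ring
    · rw [if_pos ⟨r, hpos, hrd⟩]
      have t1 := tendsto_arg_left (s * r) ((1 - s) * r) (by nlinarith) (by nlinarith)
      have t2 := tendsto_arg_right (s * r) ((1 - s) * r) (by nlinarith) (by nlinarith)
      have := t1.sub t2
      have hval : (Real.pi - -Real.pi) = 2 * Real.pi * 1 := by ring
      rw [hval] at this
      refine this.congr fun ε => ?_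
      push_cast
      rfl
  · have hj : jmp z d e = 0 := by
      unfold jmp; rw [if_neg fun h => hz (openSeg_subset_seg e h)]
    have := ((continuousAt_ang hz).tendsto.comp (tendsto_normal z d)).sub
      ((continuousAt_ang hz).tendsto.comp (tendsto_normal' z d))
    rw [sub_self] at this
    rw [hj, mul_zero]
    exact this

lemma tendsto_asum_sub {es : List (ℂ × ℂ)} {z d : ℂ} (hd : d ≠ 0)
    (h : ∀ e ∈ es, GenericAt z d e) :
    Tendsto (fun ε : ℝ => asum es (z + ε * (Complex.I * d)) - asum es (z - ε * (Complex.I * d)))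
      (𝓝[>] 0) (𝓝 (2 * Real.pi * (es.map (jmp z d)).sum)) := by
  induction es with
  | nil => simp [asum]
  | cons e es ih =>
    have h1 := (tendsto_ang_sub hd (h e List.mem_cons_self)).add
      (ih fun f hf => h f (List.mem_cons_of_mem _ hf))
    rw [List.map_cons, List.sum_cons, mul_add]
    refine h1.congr fun ε => ?_
    rw [asum_cons, asum_cons]; ring

/-- The jump across a generic point: if the total angles on both sides take the values `u` and `v`
at points arbitrarily close to `z`, then their difference is determined by the edges through `z`.
-/
lemma jump_eq {es : List (ℂ × ℂ)} {z d : ℂ} (hd : d ≠ 0) (h : ∀ e ∈ es, GenericAt z d e)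
    {u v : ℝ} (hu : ∃ᶠ ε : ℝ in 𝓝[>] 0, asum es (z + ε * (Complex.I * d)) = u ∧
      asum es (z - ε * (Complex.I * d)) = v) :
    u - v = 2 * Real.pi * (es.map (jmp z d)).sum := by
  by_contra hne
  have := tendsto_asum_sub hd h
  have hev := this.eventually (isOpen_ne.mem_nhds (Ne.symm hne))
  obtain ⟨ε, ⟨h1, h2⟩, h3⟩ := (hu.and_eventually hev).exists
  rw [h1, h2] at h3
  exact h3 rfl

lemma jmp_le_zero {z d : ℂ} {e : ℂ × ℂ}
    (h : ¬ (z ∈ openSeg e ∧ ∃ r : ℝ, 0 < r ∧ e.2 - e.1 = r • d)) : jmp z d e ≤ 0 := by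
  unfold jmp
  split_ifs with h1 h2
  · exact absurd ⟨h1, h2⟩ h
  · norm_num
  · exact le_rfl

lemma list_sum_nonpos {l : List ℝ} (h : ∀ x ∈ l, x ≤ 0) : l.sum ≤ 0 := by
  induction l with
  | nil => simp
  | cons a l ih =>
    rw [List.sum_cons]
    have := h a List.mem_cons_self
    have := ih fun x hx => h x (List.mem_cons_of_mem _ hx)
    linarith

lemma exists_of_jmp_pos {es : List (ℂ × ℂ)} {z d : ℂ} (h : 0 < (es.map (jmp z d)).sum) :
    ∃ e ∈ es, z ∈ openSeg e ∧ ∃ r : ℝ, 0 < r ∧ e.2 - e.1 = r • d := by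
  by_contra hc
  push Not at hc
  have : (es.map (jmp z d)).sum ≤ 0 := by
    apply list_sum_nonpos
    intro x hx
    obtain ⟨e, he, rfl⟩ := List.mem_map.1 hx
    apply jmp_le_zero
    rintro ⟨h1, r, hr, h2⟩
    exact hc e he h1 r hr h2
  linarith

/-- If the winding number does not jump at a point of an edge, then the edges pass through this
point in both directions. -/
lemma exists_of_jmp_zero {es : List (ℂ × ℂ)} {z d : ℂ} (h : (es.map (jmp z d)).sum = 0)
    {e : ℂ × ℂ} (he : e ∈ es) (hz : z ∈ openSeg e) :
    ∃ e ∈ es, z ∈ openSeg e ∧ ∃ r : ℝ, 0 < r ∧ e.2 - e.1 = r • d := by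
  by_contra hc
  push Not at hc
  have hle : ∀ f ∈ es, jmp z d f ≤ 0 := by
    intro f hf
    apply jmp_le_zero
    rintro ⟨h1, r, hr, h2⟩
    exact hc f hf h1 r hr h2
  have hneg : jmp z d e = -1 := by
    unfold jmp
    rw [if_pos hz, if_neg]
    rintro ⟨r, hr, h2⟩
    exact hc e he hz r hr h2
  obtain ⟨A, B, hAB⟩ := List.append_of_mem he
  subst hAB
  rw [List.map_append, List.map_cons, List.sum_append, List.sum_cons, hneg] at h
  have h1 : (A.map (jmp z d)).sum ≤ 0 := by
    apply list_sum_nonpos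
    intro x hx
    obtain ⟨e, he, rfl⟩ := List.mem_map.1 hx
    exact hle e (by simp [he])
  have h2 : (B.map (jmp z d)).sum ≤ 0 := by
    apply list_sum_nonpos
    intro x hx
    obtain ⟨e, he, rfl⟩ := List.mem_map.1 hx
    exact hle e (by simp [he])
  linarith

lemma jmp_eq_zero {z d : ℂ} {e : ℂ × ℂ} (h : z ∉ seg e) : jmp z d e = 0 := by
  unfold jmp; rw [if_neg fun h' => h (openSeg_subset_seg e h')]

lemma jmp_self {z d : ℂ} {e : ℂ × ℂ} (h : z ∈ openSeg e) (hd : e.2 - e.1 = d) :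
    jmp z d e = 1 := by
  unfold jmp; rw [if_pos h, if_pos ⟨1, one_pos, by rw [one_smul, hd]⟩]


/-! ### Winding numbers of convex polygons -/

/-- The total angle is `2 π` on a connected region that lies on the left of a simple edge of its
boundary, if it vanishes on the right. -/
lemma asum_eq_two_pi {es : List (ℂ × ℂ)} (hes : IsCycle es) {K : Set ℂ} (hK : IsPreconnected K)
    (hoff : ∀ z ∈ K, ∀ e ∈ es, z ∉ seg e) {z d : ℂ} (hd : d ≠ 0)
    (hgen : ∀ e ∈ es, GenericAt z d e) (hjmp : (es.map (jmp z d)).sum = 1)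
    (hl : ∀ᶠ ε : ℝ in 𝓝[>] 0, z + ε * (Complex.I * d) ∈ K)
    (hr : ∀ᶠ ε : ℝ in 𝓝[>] 0, asum es (z - ε * (Complex.I * d)) = 0) {w : ℂ} (hw : w ∈ K) :
    asum es w = 2 * Real.pi := by
  have := jump_eq hd hgen (u := asum es w) (v := 0) ((hl.and hr).mono fun ε h =>
    ⟨asum_const hes hK hoff h.1 hw, h.2⟩).frequently
  rw [hjmp] at this
  linarith

lemma re_conj_I_mul (d v : ℂ) :
    ((starRingEnd ℂ) (Complex.I * d) * v).re = d.re * v.im - d.im * v.re := by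
  simp

lemma orient_eq_zero_of_mem_seg {e : ℂ × ℂ} {z : ℂ} (h : z ∈ seg e) : orient e.1 e.2 z = 0 := by
  obtain ⟨s, -, -, rfl⟩ := mem_seg.1 h
  simp only [orient_lineMap, orient_left, orient_right]
  ring

lemma isCycle_tri (a b c : ℂ) : IsCycle [(a, b), (b, c), (c, a)] := by
  have := isCycle_edges [a, b, c]
  exact this

lemma IsTri.asum_outside {t : Finset ℂ} {a b c z : ℂ} (h : IsTri t a b c) (hz : z ∉ body t) :
    asum [(a, b), (b, c), (c, a)] z = 0 := by
  have key : ∀ {a b c : ℂ}, IsTri t a b c → orient a b z < 0 →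
      asum [(a, b), (b, c), (c, a)] z = 0 := by
    intro a b c h hz
    apply asum_eq_zero (isCycle_tri a b c) (n := Complex.I * (b - a))
    have e1 : ∀ v, ((starRingEnd ℂ) (Complex.I * (b - a)) * (v - z)).re
        = orient a b v - orient a b z := by
      intro v
      rw [re_conj_I_mul]
      unfold orient
      simp only [Complex.sub_re, Complex.sub_im]; ring
    have h1 := orient_left a b
    have h2 := orient_right a b
    have h3 := h.2
    intro e he
    simp only [List.mem_cons, List.not_mem_nil, or_false] at he
    rcases he with rfl | rfl | rfl <;> simp only [e1] <;> constructor <;> linarith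
  rw [body_eq h, Set.mem_ofPred_eq, not_and_or, not_and_or, not_le, not_le, not_le] at hz
  have hp : ∀ a b c : ℂ, asum [(a, b), (b, c), (c, a)] z = asum [(b, c), (c, a), (a, b)] z := by
    intro a b c
    simp only [asum_cons, asum_nil]; ring
  rcases hz with h1 | h1 | h1
  · exact key h h1
  · rw [hp]; exact key h.rot h1
  · rw [hp, hp]; exact key h.rot.rot h1

lemma IsTri.asum_inside {t : Finset ℂ} {a b c z : ℂ} (h : IsTri t a b c)
    (hz : z ∈ interior (body t)) : asum [(a, b), (b, c), (c, a)] z = 2 * Real.pi := by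
  have hd : b - a ≠ 0 := sub_ne_zero.2 h.ne.symm
  set m := a + (1 / 2 : ℝ) • (b - a) with hm
  have hmo : m ∈ openSeg (a, b) := openSeg_midpoint (a, b)
  obtain ⟨o1, o2, o3⟩ := h.orient_pos_of_mem_openSeg hmo
  have hm2 : m ∉ seg (b, c) := fun hh => o2.ne' (orient_eq_zero_of_mem_seg hh)
  have hm3 : m ∉ seg (c, a) := fun hh => o3.ne' (orient_eq_zero_of_mem_seg hh)
  apply asum_eq_two_pi (isCycle_tri a b c) (convex_body t).interior.isPreconnected ?_ hd
    (z := m) ?_ ?_ (h.side.eventually_left hmo one_pos (by simp)) ?_ hz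
  · intro w hw e he hwe
    simp only [List.mem_cons, List.not_mem_nil, or_false] at he
    rcases he with rfl | rfl | rfl
    · exact h.side.notMem_interior hwe hw
    · exact h.rot.side.notMem_interior hwe hw
    · exact h.rot.rot.side.notMem_interior hwe hw
  · intro e he hme
    simp only [List.mem_cons, List.not_mem_nil, or_false] at he
    rcases he with rfl | rfl | rfl
    · exact ⟨hmo, 1, one_ne_zero, by simp⟩
    · exact absurd hme hm2
    · exact absurd hme hm3
  · simp [jmp_eq_zero hm2, jmp_eq_zero hm3, jmp_self hmo rfl]
  · filter_upwards [self_mem_nhdsWithin] with ε hε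
    apply h.asum_outside
    rw [body_eq h]
    rintro ⟨h1, -, -⟩
    have : m - ε * (Complex.I * (b - a)) = m + ((-ε : ℝ) : ℂ) * (Complex.I * (b - a)) := by
      push_cast; ring
    rw [this, orient_add_normal a b m (b - a) _ 1 (by simp), o1] at h1
    have h5 : 0 < Complex.normSq (b - a) := Complex.normSq_pos.2 hd
    have h6 : 0 < ε := hε
    have := mul_pos h6 h5
    linarith

/-- The open rectangle. -/
def Box.inside (B : Box) : Set ℂ :=
  {z | B.left < z.re ∧ z.re < B.right ∧ B.bottom < z.im ∧ z.im < B.top}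

lemma Box.isOpen_inside (B : Box) : IsOpen B.inside := by
  unfold Box.inside
  exact (isOpen_lt continuous_const Complex.continuous_re).inter
    ((isOpen_lt Complex.continuous_re continuous_const).inter
    ((isOpen_lt continuous_const Complex.continuous_im).inter
    (isOpen_lt Complex.continuous_im continuous_const)))

lemma Box.convex_inside (B : Box) : Convex ℝ B.inside := by
  have : B.inside = Complex.reLm ⁻¹' Set.Ioo B.left B.right ∩
      Complex.imLm ⁻¹' Set.Ioo B.bottom B.top := by
    ext z; simp [Box.inside, and_assoc]
  rw [this]
  exact ((convex_Ioo _ _).linear_preimage Complex.reLm).inter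
    ((convex_Ioo _ _).linear_preimage Complex.imLm)

/-- The boundary of the rectangle, counterclockwise. -/
def Box.ccw (B : Box) : List (ℂ × ℂ) := [(B.q₁, B.q₄), (B.q₄, B.q₃), (B.q₃, B.q₂), (B.q₂, B.q₁)]

lemma Box.isCycle_ccw (B : Box) : IsCycle B.ccw := isCycle_edges [B.q₁, B.q₄, B.q₃, B.q₂]

lemma re_seg {e : ℂ × ℂ} {z : ℂ} (h : z ∈ seg e) (x : ℝ) (h1 : e.1.re = x) (h2 : e.2.re = x) :
    z.re = x := by
  obtain ⟨s, -, -, rfl⟩ := mem_seg.1 h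
  simp [h1, h2]

lemma im_seg {e : ℂ × ℂ} {z : ℂ} (h : z ∈ seg e) (x : ℝ) (h1 : e.1.im = x) (h2 : e.2.im = x) :
    z.im = x := by
  obtain ⟨s, -, -, rfl⟩ := mem_seg.1 h
  simp [h1, h2]

lemma Box.off_ccw (B : Box) : ∀ z ∈ B.inside, ∀ e ∈ B.ccw, z ∉ seg e := by
  rintro z ⟨h1, h2, h3, h4⟩ e he hz
  simp only [Box.ccw, List.mem_cons, List.not_mem_nil, or_false] at he
  rcases he with rfl | rfl | rfl | rfl
  · have := re_seg hz B.left rfl rfl; linarith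
  · have := im_seg hz B.bottom rfl rfl; linarith
  · have := re_seg hz B.right rfl rfl; linarith
  · have := im_seg hz B.top rfl rfl; linarith

lemma Box.asum_outside (B : Box) (h : B.left < B.right) (h' : B.bottom < B.top) {z : ℂ}
    (hz : z.re < B.left ∨ B.right < z.re ∨ z.im < B.bottom ∨ B.top < z.im) :
    asum B.ccw z = 0 := by
  have key : ∀ n : ℂ, (∀ v ∈ [B.q₁, B.q₂, B.q₃, B.q₄], 0 < ((starRingEnd ℂ) n * (v - z)).re) →
      asum B.ccw z = 0 := by
    intro n hn
    apply asum_eq_zero B.isCycle_ccw (n := n)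
    intro e he
    simp only [Box.ccw, List.mem_cons, List.not_mem_nil, or_false] at he
    rcases he with rfl | rfl | rfl | rfl <;> exact ⟨hn _ (by simp), hn _ (by simp)⟩
  rcases hz with hz | hz | hz | hz
  · apply key 1
    intro v hv
    simp only [List.mem_cons, List.not_mem_nil, or_false] at hv
    rcases hv with rfl | rfl | rfl | rfl <;> simp [Box.q₁, Box.q₂, Box.q₃, Box.q₄] <;> linarith
  · apply key (-1)
    intro v hv
    simp only [List.mem_cons, List.not_mem_nil, or_false] at hv
    rcases hv with rfl | rfl | rfl | rfl <;> simp [Box.q₁, Box.q₂, Box.q₃, Box.q₄] <;> linarith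
  · apply key Complex.I
    intro v hv
    simp only [List.mem_cons, List.not_mem_nil, or_false] at hv
    rcases hv with rfl | rfl | rfl | rfl <;> simp [Box.q₁, Box.q₂, Box.q₃, Box.q₄] <;> linarith
  · apply key (-Complex.I)
    intro v hv
    simp only [List.mem_cons, List.not_mem_nil, or_false] at hv
    rcases hv with rfl | rfl | rfl | rfl <;> simp [Box.q₁, Box.q₂, Box.q₃, Box.q₄] <;> linarith

lemma Box.asum_inside (B : Box) (h : B.left < B.right) (h' : B.bottom < B.top) {z : ℂ}
    (hz : z ∈ B.inside) : asum B.ccw z = 2 * Real.pi := by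
  set m : ℂ := ⟨(B.left + B.right) / 2, B.bottom⟩ with hm
  have hd : B.q₃ - B.q₄ ≠ 0 := by
    intro h0
    have := congrArg Complex.re h0
    simp [Box.q₃, Box.q₄] at this
    linarith
  have hmo : m ∈ openSeg (B.q₄, B.q₃) := by
    refine mem_openSeg.2 ⟨1 / 2, by norm_num, by norm_num, ?_⟩
    apply Complex.ext <;> simp [hm, Box.q₃, Box.q₄]
    ring
  have n1 : m ∉ seg (B.q₁, B.q₄) := fun hh => by
    have := re_seg hh B.left rfl rfl; simp only [hm] at this; linarith
  have n2 : m ∉ seg (B.q₃, B.q₂) := fun hh => by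
    have := re_seg hh B.right rfl rfl; simp only [hm] at this; linarith
  have n3 : m ∉ seg (B.q₂, B.q₁) := fun hh => by
    have := im_seg hh B.top rfl rfl; simp only [hm] at this; linarith
  apply asum_eq_two_pi B.isCycle_ccw B.convex_inside.isPreconnected B.off_ccw hd (z := m) ?_ ?_ ?_
    ?_ hz
  · intro e he hme
    simp only [Box.ccw, List.mem_cons, List.not_mem_nil, or_false] at he
    rcases he with rfl | rfl | rfl | rfl
    · exact absurd hme n1
    · exact ⟨hmo, 1, one_ne_zero, by simp⟩
    · exact absurd hme n2
    · exact absurd hme n3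
  · simp [Box.ccw, jmp_eq_zero n1, jmp_eq_zero n2, jmp_eq_zero n3, jmp_self hmo rfl]
  · have h1 : ∀ᶠ w in 𝓝 m, w.im < B.top ∧ B.left < w.re ∧ w.re < B.right := by
      have o : IsOpen {w : ℂ | w.im < B.top ∧ B.left < w.re ∧ w.re < B.right} :=
        (isOpen_lt Complex.continuous_im continuous_const).inter
        ((isOpen_lt continuous_const Complex.continuous_re).inter
        (isOpen_lt Complex.continuous_re continuous_const))
      exact o.mem_nhds ⟨h', by simp only [hm]; linarith, by simp only [hm]; linarith⟩
    filter_upwards [(tendsto_normal m (B.q₃ - B.q₄)).eventually h1, self_mem_nhdsWithin]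
      with ε h2 h3
    have h3 : 0 < ε := h3
    refine ⟨h2.2.1, h2.2.2, ?_, h2.1⟩
    simp [hm, Box.q₃, Box.q₄]
    nlinarith
  · filter_upwards [self_mem_nhdsWithin] with ε h3
    have h3 : 0 < ε := h3
    apply B.asum_outside h h'
    right; right; left
    simp [hm, Box.q₃, Box.q₄]
    nlinarith

/-! ### Triangulations of closed polygons -/

/-- A triangulation whose triangles have their vertices at vertices of the polygon. -/
structure VertexTriangulation (H : List ℂ) (T : Finset (Finset ℂ)) : Prop where
  triangle : ∀ t ∈ T, ∃ a b, IsSide t a b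
  inside : ∀ t ∈ T, interior (body t) ⊆ inner H
  disjoint : ∀ t ∈ T, ∀ t' ∈ T, t ≠ t' → Disjoint (interior (body t)) (interior (body t'))
  cover : inner H ⊆ ⋃ t ∈ T, body t
  side : ∀ t ∈ T, ∀ a b, IsSide t a b → (b, a) ∈ edges H ∨ openSeg (a, b) ⊆ inner H
  vertex : ∀ t ∈ T, ∀ v ∈ t, v ∈ H

lemma IsTriangulation.vertexTriangulation {H : List ℂ} {E : Set (ℂ × ℂ)} {T : Finset (Finset ℂ)}
    (h : IsTriangulation H E T) (hE : ∀ e ∈ E, e.1 ∈ H ∧ e.2 ∈ H) : VertexTriangulation H T where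
  triangle := h.triangle
  inside := h.inside
  disjoint := h.disjoint
  cover := h.cover
  side := h.side
  vertex := by
    intro t ht v hv
    obtain ⟨a, b, c, hc⟩ := h.triangle t ht
    have hc : IsTri t a b c := hc
    have key : ∀ x y, IsSide t x y → x ∈ H := by
      intro x y hxy
      rcases h.side_mem t ht x y hxy with h1 | h1
      · exact (hE _ h1).1
      · exact (hE _ h1).2
    have hv' : v ∈ (t : Set ℂ) := hv
    rw [hc.1] at hv'
    rcases hv' with rfl | rfl | rfl
    · exact key _ _ hc.side
    · exact key _ _ hc.rot.side
    · exact key _ _ hc.rot.rot.side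

lemma mem_of_mem_edges {l : List ℂ} {e : ℂ × ℂ} (h : e ∈ edges l) : e.1 ∈ l ∧ e.2 ∈ l := by
  have := List.of_mem_zip (l₁ := l) (l₂ := l.rotate 1) (a := e.1) (b := e.2) h
  exact ⟨this.1, by simpa using this.2⟩

lemma mem_trace_of_mem {l : List ℂ} {v : ℂ} (h : v ∈ l) : v ∈ trace l := by
  have : v ∈ (edges l).map Prod.fst := by
    unfold edges; rw [List.map_fst_zip (by simp)]; exact h
  obtain ⟨e, he, rfl⟩ := List.mem_map.1 this
  exact ⟨e, he, left_mem_seg e⟩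

lemma notMem_trace {l : List ℂ} {z : ℂ} : z ∉ trace l ↔ ∀ e ∈ edges l, z ∉ seg e := by
  unfold trace; simp only [Set.mem_ofPred_eq, not_exists, not_and]

lemma isPreconnected_pairs (x : ℂ) (V : List ℂ) :
    IsPreconnected ({x} ∪ {z | ∃ e ∈ pairs (x :: V), z ∈ seg e}) := by
  induction V generalizing x with
  | nil => simp [pairs_single]; exact isPreconnected_singleton
  | cons y V ih =>
    have : ({x} ∪ {z | ∃ e ∈ pairs (x :: y :: V), z ∈ seg e}) =
        seg (x, y) ∪ ({y} ∪ {z | ∃ e ∈ pairs (y :: V), z ∈ seg e}) := by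
      ext z
      simp only [pairs_cons, List.mem_cons, Set.mem_union, Set.mem_singleton_iff, Set.mem_ofPred_eq,
        exists_eq_or_imp]
      constructor
      · rintro (rfl | h | h)
        · exact Or.inl (left_mem_seg _)
        · exact Or.inl h
        · exact Or.inr (Or.inr h)
      · rintro (h | rfl | h)
        · exact Or.inr (Or.inl h)
        · exact Or.inr (Or.inl (right_mem_seg (x, z)))
        · exact Or.inr (Or.inr h)
    rw [this]
    exact IsPreconnected.union y (right_mem_seg (x, y)) (Or.inl rfl)
      (convex_segment _ _).isPreconnected (ih y)

lemma isPreconnected_trace (l : List ℂ) : IsPreconnected (trace l) := by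
  cases l with
  | nil => 
    have : trace [] = ∅ := by ext z; simp [trace, edges]
    rw [this]; exact isPreconnected_empty
  | cons x l =>
    have h := isPreconnected_pairs x (l ++ [x])
    have hx : x ∈ trace (x :: l) := mem_trace_of_mem List.mem_cons_self
    have : trace (x :: l) = {x} ∪ {z | ∃ e ∈ pairs (x :: (l ++ [x])), z ∈ seg e} := by
      unfold trace at hx ⊢
      rw [edges_cons] at hx ⊢
      rw [Set.union_eq_self_of_subset_left (Set.singleton_subset_iff.2 hx)]
    rw [this]; exact h

lemma isOpen_inner (l : List ℂ) : IsOpen (inner l) := by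
  rw [isOpen_iff_mem_nhds]
  rintro z ⟨h1, h2⟩
  filter_upwards [asum_eventually (isCycle_edges l) (notMem_trace.1 h1)] with w hw
  refine ⟨notMem_trace.2 hw.1, ?_⟩
  rw [winding_eq] at h2 ⊢
  rw [hw.2]; exact h2

/-- All directed triangle sides. -/
def sides (T : Finset (Finset ℂ)) : Set (ℂ × ℂ) := {e | ∃ t ∈ T, IsSide t e.1 e.2}

lemma finite_sides (T : Finset (Finset ℂ)) : (sides T).Finite := by
  apply Set.Finite.subset ((T.biUnion fun t => t ×ˢ t).finite_toSet)
  rintro e ⟨t, ht, he⟩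
  simp only [Finset.coe_biUnion, Set.mem_iUnion, Finset.mem_coe, Finset.mem_product]
  exact ⟨t, ht, he.left_mem, he.right_mem⟩

lemma VertexTriangulation.eq_of_mem_interior {H : List ℂ} {T : Finset (Finset ℂ)}
    (hT : VertexTriangulation H T) {t t' : Finset ℂ} (ht : t ∈ T) (ht' : t' ∈ T) {z : ℂ}
    (h : z ∈ interior (body t)) (h' : z ∈ interior (body t')) : t = t' := by
  by_contra hne
  exact Set.disjoint_left.1 (hT.disjoint t ht t' ht' hne) h h'

/-- Triangle sides that run along each other in the same direction are equal. -/
lemma VertexTriangulation.eq_of_overlap {H : List ℂ} {T : Finset (Finset ℂ)}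
    (hT : VertexTriangulation H T) {t t' : Finset ℂ} (ht : t ∈ T) (ht' : t' ∈ T) {e f : ℂ × ℂ}
    (he : IsSide t e.1 e.2) (hf : IsSide t' f.1 f.2) (h : Overlap e f) : t = t' ∧ e = f := by
  have htt : t = t' := by
    obtain ⟨r, hr, hd, -⟩ := overlap_orient h
    obtain ⟨⟨z, hz1, hz2⟩, -⟩ := h
    obtain ⟨ε, h1, h2⟩ := ((he.eventually_left hz1 one_pos (d := e.2 - e.1) (by simp)).and
      (hf.eventually_left hz2 hr hd)).exists
    exact hT.eq_of_mem_interior ht ht' h1 h2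
  subst htt
  exact ⟨rfl, he.eq_of_overlap hf h⟩

lemma overlap_self {a b : ℂ} : Overlap (a, b) (a, b) :=
  ⟨⟨_, openSeg_midpoint (a, b), openSeg_midpoint (a, b)⟩, 1, one_pos, by simp⟩

lemma VertexTriangulation.eq_of_side {H : List ℂ} {T : Finset (Finset ℂ)}
    (hT : VertexTriangulation H T) {t t' : Finset ℂ} (ht : t ∈ T) (ht' : t' ∈ T) {a b : ℂ}
    (he : IsSide t a b) (hf : IsSide t' a b) : t = t' :=
  (hT.eq_of_overlap ht ht' (e := (a, b)) (f := (a, b)) he hf overlap_self).1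

lemma VertexTriangulation.notMem_interior {H : List ℂ} {T : Finset (Finset ℂ)}
    (hT : VertexTriangulation H T) {t t' : Finset ℂ} (ht : t ∈ T) (ht' : t' ∈ T) {a b z : ℂ}
    (he : IsSide t a b) (hz : z ∈ seg (a, b)) : z ∉ interior (body t') := by
  intro hz'
  have h1 := he.body_subset_closure (he.seg_subset_body hz)
  obtain ⟨w, hw1, hw2⟩ := mem_closure_iff.1 h1 _ isOpen_interior hz'
  have := hT.eq_of_mem_interior ht ht' hw2 hw1
  subst this
  exact he.notMem_interior hz hz'

lemma VertexTriangulation.vertex_notMem_inner {H : List ℂ} {T : Finset (Finset ℂ)}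
    (hT : VertexTriangulation H T) {t : Finset ℂ} (ht : t ∈ T) {v : ℂ} (hv : v ∈ t) :
    v ∉ inner H := fun h => h.1 (mem_trace_of_mem (hT.vertex t ht v hv))

/-- A side with a point in the interior of the polygon is a diagonal. -/
lemma VertexTriangulation.diagonal {H : List ℂ} {T : Finset (Finset ℂ)}
    (hT : VertexTriangulation H T) {t : Finset ℂ} (ht : t ∈ T) {a b z : ℂ}
    (he : IsSide t a b) (hz : z ∈ seg (a, b)) (hzi : z ∈ inner H) : openSeg (a, b) ⊆ inner H := by
  rcases hT.side t ht a b he with h | h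
  · exact absurd ⟨_, h, by rw [seg_swap]; exact hz⟩ hzi.1
  · exact h

/-- Triangle sides do not meet transversally. -/
lemma VertexTriangulation.parallel {H : List ℂ} {T : Finset (Finset ℂ)}
    (hT : VertexTriangulation H T) {t t' : Finset ℂ} (ht : t ∈ T) (ht' : t' ∈ T) {a b x y z : ℂ}
    (he : IsSide t a b) (hf : IsSide t' x y) (hz : z ∈ openSeg (a, b)) (hz' : z ∈ openSeg (x, y)) :
    (b - a).re * (y - x).im - (b - a).im * (y - x).re = 0 := by
  -- if the left half planes meet near `z`, both sides belong to the same triangle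
  have key : ∀ u : ℂ, 0 < orient a b (z + u) → 0 < orient x y (z + u) → x = a ∧ y = b := by
    intro u hu hu'
    have hza := (IsTri.orient_pos_of_mem_openSeg he.choose_spec hz).1
    have hzx := (IsTri.orient_pos_of_mem_openSeg hf.choose_spec hz').1
    have htend : Tendsto (fun ε : ℝ => z + ε • (z + u - z)) (𝓝[>] 0) (𝓝 z) := by
      have : Tendsto (fun ε : ℝ => z + ε • (z + u - z)) (𝓝 0) (𝓝 (z + (0 : ℝ) • (z + u - z))) := by
        apply Continuous.tendsto; fun_prop
      rw [zero_smul, add_zero] at this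
      exact this.mono_left nhdsWithin_le_nhds
    obtain ⟨ε, ⟨h1, h2⟩, h3⟩ := ((htend.eventually ((he.eventually_interior hz).and
      (hf.eventually_interior hz'))).and self_mem_nhdsWithin).exists
    have h3 : 0 < ε := h3
    rw [orient_lineMap] at h1 h2
    have := hT.eq_of_mem_interior ht ht' (h1.2 (by rw [hza]; nlinarith))
      (h2.2 (by rw [hzx]; nlinarith))
    subst this
    exact he.disjoint_openSeg hf hz hz'
  have hor : ∀ p q : ℂ, z ∈ openSeg (p, q) → ∀ u, orient p q (z + u) =
      (q - p).re * u.im - (q - p).im * u.re := by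
    intro p q hpq u
    have := orient_eq_zero_of_mem_seg (openSeg_subset_seg _ hpq)
    unfold orient at this ⊢
    simp only [Complex.sub_re, Complex.sub_im, Complex.add_re, Complex.add_im] at this ⊢
    linarith
  by_contra hne
  have hxy : x = a ∧ y = b := by
    rcases lt_or_gt_of_ne hne with hk | hk
    · apply key ((b - a) - (y - x))
      · rw [hor a b hz]; simp only [Complex.sub_re, Complex.sub_im] at hk ⊢; linarith
      · rw [hor x y hz']; simp only [Complex.sub_re, Complex.sub_im] at hk ⊢; linarith
    · apply key ((y - x) - (b - a))
      · rw [hor a b hz]; simp only [Complex.sub_re, Complex.sub_im] at hk ⊢; linarith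
      · rw [hor x y hz']; simp only [Complex.sub_re, Complex.sub_im] at hk ⊢; linarith
  obtain ⟨rfl, rfl⟩ := hxy
  exact hne (by ring)

/-- A diagonal meets no other side, except for its reversal. -/
lemma VertexTriangulation.diagonal_unique {H : List ℂ} {T : Finset (Finset ℂ)}
    (hT : VertexTriangulation H T) {t t' : Finset ℂ} (ht : t ∈ T) (ht' : t' ∈ T) {a b x y z : ℂ}
    (he : IsSide t a b) (hf : IsSide t' x y) (hd : openSeg (a, b) ⊆ inner H)
    (hz : z ∈ openSeg (a, b)) (hz' : z ∈ openSeg (x, y)) :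
    (x = a ∧ y = b) ∨ (x = b ∧ y = a) := by
  have hd' : openSeg (x, y) ⊆ inner H :=
    hT.diagonal ht' hf (openSeg_subset_seg _ hz') (hd hz)
  have hk := hT.parallel ht ht' he hf hz hz'
  have hba : b - a ≠ 0 := sub_ne_zero.2 he.ne.symm
  have hyx : y - x ≠ 0 := sub_ne_zero.2 hf.ne.symm
  obtain ⟨r, hr⟩ : ∃ r : ℝ, y - x = r • (b - a) := by
    have hN : Complex.normSq (b - a) ≠ 0 := (Complex.normSq_pos.2 hba).ne'
    refine ⟨((y - x).re * (b - a).re + (y - x).im * (b - a).im) / Complex.normSq (b - a), ?_⟩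
    rw [Complex.normSq_apply] at hN ⊢
    apply Complex.ext
    · rw [Complex.real_smul, Complex.re_ofReal_mul, div_mul_eq_mul_div, eq_div_iff hN]
      linear_combination -(b - a).im * hk
    · rw [Complex.real_smul, Complex.im_ofReal_mul, div_mul_eq_mul_div, eq_div_iff hN]
      linear_combination (b - a).re * hk
  rcases lt_trichotomy r 0 with h0 | h0 | h0
  · right
    have hov : Overlap (b, a) (x, y) := by
      refine ⟨⟨z, by rw [openSeg_swap]; exact hz, hz'⟩, -r, by linarith, ?_⟩
      simp only
      rw [hr, ← neg_sub b a, smul_neg, neg_smul, neg_neg]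
    have := hov.eq_of_endpoints
      (fun h => hT.vertex_notMem_inner ht he.right_mem (hd' h))
      (fun h => hT.vertex_notMem_inner ht he.left_mem (hd' h))
      (fun h => hT.vertex_notMem_inner ht' hf.left_mem (hd (by rw [openSeg_swap]; exact h)))
      (fun h => hT.vertex_notMem_inner ht' hf.right_mem (hd (by rw [openSeg_swap]; exact h)))
    obtain ⟨h1, h2⟩ := Prod.mk.inj this
    exact ⟨h1.symm, h2.symm⟩
  · rw [h0, zero_smul] at hr; exact absurd hr hyx
  · left
    have := (hT.eq_of_overlap ht ht' (e := (a, b)) (f := (x, y)) he hf ⟨⟨z, hz, hz'⟩, r, h0, hr⟩).2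
    obtain ⟨h1, h2⟩ := Prod.mk.inj this
    exact ⟨h1.symm, h2.symm⟩

/-- Triangle sides do not cross. -/
lemma VertexTriangulation.not_cross {H : List ℂ} {T : Finset (Finset ℂ)}
    (hT : VertexTriangulation H T) {t t' : Finset ℂ} (ht : t ∈ T) (ht' : t' ∈ T) {a b x y : ℂ}
    (he : IsSide t a b) (hf : IsSide t' x y) : ¬ Cross (a, b) (x, y) := by
  rintro ⟨h1, h2⟩
  simp only at h1 h2
  -- the crossing point divides each segment in the ratio of the distances to the other line
  have key : ∀ u v : ℝ, u * v < 0 → 0 < u / (u - v) ∧ u / (u - v) < 1 := by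
    intro u v h
    rcases mul_neg_iff.1 h with ⟨h3, h4⟩ | ⟨h3, h4⟩
    · exact ⟨by apply div_pos <;> linarith, by rw [div_lt_one] <;> linarith⟩
    · exact ⟨by apply div_pos_of_neg_of_neg <;> linarith,
        by rw [div_lt_one_of_neg] <;> linarith⟩
  have hd : orient a b x - orient a b y ≠ 0 := by
    intro h
    have : orient a b x = orient a b y := by linarith
    rw [this] at h1
    nlinarith [mul_self_nonneg (orient a b y)]
  have hdd : orient x y a - orient x y b = -(orient a b x - orient a b y) := by
    unfold orient; simp only [Complex.sub_re, Complex.sub_im]; ring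
  have hdd' : orient a b x - orient a b y =
      -((b - a).re * (y - x).im - (b - a).im * (y - x).re) := by
    unfold orient; simp only [Complex.sub_re, Complex.sub_im]; ring
  obtain ⟨s1, s2⟩ := key _ _ h1
  obtain ⟨r1, r2⟩ := key _ _ h2
  have hz : x + (orient a b x / (orient a b x - orient a b y)) • (y - x) =
      a + (orient x y a / (orient x y a - orient x y b)) • (b - a) := by
    rw [hdd]
    have hd2 := neg_ne_zero.2 hd
    apply Complex.ext
    · simp only [Complex.add_re, Complex.real_smul, Complex.re_ofReal_mul]
      field_simp
      unfold orient; simp only [Complex.sub_re, Complex.sub_im]; ring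
    · simp only [Complex.add_im, Complex.real_smul, Complex.im_ofReal_mul]
      field_simp
      unfold orient; simp only [Complex.sub_re, Complex.sub_im]; ring
  have hm' : x + (orient a b x / (orient a b x - orient a b y)) • (y - x) ∈ openSeg (x, y) :=
    mem_openSeg.2 ⟨_, s1, s2, rfl⟩
  have hm : x + (orient a b x / (orient a b x - orient a b y)) • (y - x) ∈ openSeg (a, b) :=
    mem_openSeg.2 ⟨_, r1, r2, hz⟩
  have := hT.parallel ht ht' he hf (z := x + (orient a b x / (orient a b x - orient a b y)) • (y - x))
    hm hm'
  rw [this, neg_zero] at hdd'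
  exact hd hdd'

/-- If the points to the left of a generic point `z` with respect to the direction `d` are
repeatedly covered by the triangles of `S`, then one of these has a side in direction `d`
through `z`. -/
lemma exists_side_of_frequently {S : Finset (Finset ℂ)} (hS : ∀ t ∈ S, ∃ a b, IsSide t a b)
    {z d : ℂ} (hd : d ≠ 0) (hgen : ∀ e ∈ sides S, GenericAt z d e)
    (hint : ∀ t ∈ S, z ∉ interior (body t))
    (hf : ∃ᶠ ε : ℝ in 𝓝[>] 0, z + ε * (Complex.I * d) ∈ ⋃ t ∈ S, body t) :
    ∃ t ∈ S, ∃ x y, IsSide t x y ∧ z ∈ openSeg (x, y) ∧ ∃ r : ℝ, 0 < r ∧ y - x = r • d := by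
  obtain ⟨t, ht, hft⟩ : ∃ t ∈ S, ∃ᶠ ε : ℝ in 𝓝[>] 0, z + ε * (Complex.I * d) ∈ body t := by
    by_contra hc
    push Not at hc
    have hall := (Filter.eventually_all_finset S).2 fun t ht => hc t ht
    obtain ⟨ε, h1, h2⟩ := (hf.and_eventually hall).exists
    simp only [Set.mem_iUnion] at h1
    obtain ⟨t, ht, h1⟩ := h1
    exact h2 t ht h1
  have hzt : z ∈ body t := by
    by_contra hc
    have := (tendsto_normal z d).eventually ((isClosed_body t).isOpen_compl.mem_nhds hc)
    obtain ⟨ε, h1, h2⟩ := (hft.and_eventually this).exists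
    exact h2 h1
  obtain ⟨a, b, c, htri⟩ := hS t ht
  have htri : IsTri t a b c := htri
  have hvert : z ∉ t := by
    intro hv
    have key : ∀ x y, IsSide t x y → z ≠ x := by
      rintro x y hxy rfl
      have h1 := (hgen (z, y) ⟨t, ht, hxy⟩ (left_mem_seg (z, y))).1
      obtain ⟨s, hs0, -, hs⟩ := mem_openSeg.1 h1
      have : s • (y - z) = 0 := by simpa using hs.symm
      rcases smul_eq_zero.1 this with h | h
      · exact hs0.ne' h
      · exact hxy.ne (sub_eq_zero.1 h).symm
    have hv' : z ∈ (t : Set ℂ) := hv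
    rw [htri.1] at hv'
    rcases hv' with h | h | h
    · exact key _ _ htri.side h
    · exact key _ _ htri.rot.side h
    · exact key _ _ htri.rot.rot.side h
  rcases htri.mem_body_cases hzt with h | ⟨x, y, hxy, hzo⟩ | h
  · exact absurd h (hint t ht)
  · refine ⟨t, ht, x, y, hxy, hzo, ?_⟩
    obtain ⟨-, r, hr, hrd⟩ := hgen (x, y) ⟨t, ht, hxy⟩ (openSeg_subset_seg _ hzo)
    refine ⟨r, ?_, hrd⟩
    by_contra hneg
    have hneg : r < 0 := lt_of_le_of_ne (not_lt.1 hneg) hr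
    obtain ⟨ε, h1, h2⟩ := (hft.and_eventually self_mem_nhdsWithin).exists
    have h2 : 0 < ε := h2
    obtain ⟨w, hw⟩ := hxy
    rw [body_eq hw] at h1
    have h3 := h1.1
    rw [orient_add_normal x y z d ε r hrd,
      orient_eq_zero_of_mem_seg (openSeg_subset_seg _ hzo), zero_add] at h3
    have := mul_pos h2 (Complex.normSq_pos.2 hd)
    nlinarith
  · exact absurd h hvert

/-- The triangle on the other side of a diagonal. -/
lemma VertexTriangulation.exists_neighbour {H : List ℂ} {T : Finset (Finset ℂ)}
    (hT : VertexTriangulation H T) {t : Finset ℂ} (ht : t ∈ T) {a b : ℂ} (he : IsSide t a b)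
    (hd : openSeg (a, b) ⊆ inner H) : ∃ t' ∈ T, IsSide t' b a := by
  obtain ⟨z, hz, -, -, hgen⟩ := exists_generic (e := (b, a)) he.ne.symm isOpen_univ
    (left_mem_seg _) (Set.mem_univ _) Set.finite_empty (finite_sides T)
  have hzi : z ∈ inner H := hd (by rw [openSeg_swap]; exact hz)
  obtain ⟨t', ht', x, y, hxy, hzo, r, hr, hrd⟩ := exists_side_of_frequently hT.triangle
    (sub_ne_zero.2 he.ne) (fun e he => hgen e he) (fun t' ht' => hT.notMem_interior ht ht' he
      (by rw [seg_swap]; exact openSeg_subset_seg _ hz))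
    (((tendsto_normal z (a - b)).eventually ((isOpen_inner H).mem_nhds hzi)).mono
      fun ε h => hT.cover h).frequently
  refine ⟨t', ht', ?_⟩
  rcases hT.diagonal_unique ht ht' he hxy hd (by rw [openSeg_swap]; exact hz) hzo with
    ⟨rfl, rfl⟩ | ⟨rfl, rfl⟩
  · exfalso
    have h1 : y - x = (-r) • (y - x) := by
      rw [neg_smul, ← smul_neg, neg_sub]; exact hrd
    have h2 : (1 + r) • (y - x) = 0 := by
      rw [add_smul, one_smul]; nth_rewrite 1 [h1]; rw [neg_smul]; abel
    rcases smul_eq_zero.1 h2 with h | h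
    · linarith
    · exact he.ne (sub_eq_zero.1 h).symm
  · exact hxy

/-- If an open set that meets a boundary edge is almost covered by the triangles of `S`, then one of
these has a side along this edge in the same direction. -/
lemma VertexTriangulation.exists_side_of_cover {H : List ℂ} {T : Finset (Finset ℂ)}
    (hT : VertexTriangulation H T) {S : Finset (Finset ℂ)} (hS : S ⊆ T) {N : Set ℂ}
    (hN : IsOpen N) (hcov : ∀ᵐ z : ℂ, z ∈ N → ∃ t ∈ S, z ∈ body t) {e : ℂ × ℂ} (he : e.1 ≠ e.2)
    (heH : seg e ⊆ trace H) {p : ℂ} (hp : p ∈ seg e) (hpN : p ∈ N) :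
    ∃ t ∈ S, ∃ x y, IsSide t x y ∧ (y, x) ∈ edges H ∧ Overlap e (x, y) ∧
      ∃ z ∈ N, z ∈ openSeg (x, y) ∧ z ∈ openSeg e := by
  obtain ⟨z, hz, hzN, -, hgen⟩ := exists_generic he hN hp hpN Set.finite_empty (finite_sides S)
  have hzH : z ∈ trace H := heH (openSeg_subset_seg _ hz)
  have hcov' : N ⊆ ⋃ t ∈ S, body t := by
    have hcl : IsClosed (⋃ t ∈ S, body t) :=
      S.finite_toSet.isClosed_biUnion fun t _ => isClosed_body t
    have hdense : Dense {z : ℂ | z ∈ N → ∃ t ∈ S, z ∈ body t} := Measure.dense_of_ae hcov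
    intro w hw
    by_contra hc
    obtain ⟨u, hu1, hu2⟩ := hdense.inter_open_nonempty (N ∩ (⋃ t ∈ S, body t)ᶜ)
      (hN.inter hcl.isOpen_compl) ⟨w, hw, hc⟩
    apply hu1.2
    simp only [Set.mem_iUnion]
    obtain ⟨t, ht, h⟩ := hu2 hu1.1
    exact ⟨t, ht, h⟩
  obtain ⟨t, ht, x, y, hxy, hzo, r, hr, hrd⟩ := exists_side_of_frequently
    (fun t ht => hT.triangle t (hS ht)) (sub_ne_zero.2 he.symm) (fun e he => hgen e he)
    (fun t ht h => (hT.inside t (hS ht) h).1 hzH)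
    (((tendsto_normal z (e.2 - e.1)).eventually (hN.mem_nhds hzN)).mono
      fun ε h => hcov' h).frequently
  refine ⟨t, ht, x, y, hxy, ?_, ⟨⟨z, hz, hzo⟩, r, hr, hrd⟩, z, hzN, hzo, hz⟩
  rcases hT.side t (hS ht) x y hxy with h | h
  · exact h
  · exact absurd hzH (h hzo).1


/-! ### Models of triangulated discs -/

/-- A model of a disc with the closed boundary walk `V` (first vertex repeated at the end) and the
open interior `O`: a continuous map `F` of time `θ` and height `h`. At the height `g θ` it traverses
the boundary walk, the `k`-th vertex at time `k`; above this height and below height `1` it is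
injective and stays in `O`. -/
structure Model (O : Set ℂ) (V : List ℂ) (n : ℕ) (F : ℝ → ℝ → ℂ) (g : ℝ → ℝ) : Prop where
  length : V.length = n + 1
  contF : Continuous fun p : ℝ × ℝ => F p.1 p.2
  contg : Continuous g
  nonpos : ∀ θ, g θ ≤ 0
  g_per : g 0 = g n
  F_per : ∀ h, F 0 h = F n h
  bdry : ∀ k : ℕ, k < n → ∀ s : ℝ, 0 ≤ s → s ≤ 1 →
    F (k + s) (g (k + s)) = V.getD k 0 + s • (V.getD (k + 1) 0 - V.getD k 0)
  mem : ∀ θ : ℝ, 0 ≤ θ → θ < n → ∀ h : ℝ, g θ < h → h < 1 → F θ h ∈ O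
  inj : ∀ θ θ' : ℝ, 0 ≤ θ → θ < n → 0 ≤ θ' → θ' < n → ∀ h h' : ℝ, g θ < h → h < 1 → g θ' < h' → h' < 1 →
    F θ h = F θ' h' → θ = θ' ∧ h = h'

/-- The model of a single triangle: the height interpolates between boundary and centroid. -/
lemma exists_model_tri {t : Finset ℂ} {a b c : ℂ} (ht : IsTri t a b c) :
    ∃ F g, Model (interior (body t)) [a, b, c, a] 3 F g := by
  -- the boundary point at time `θ` has the barycentric coordinates `la θ`, `lb θ`, `lc θ`
  let lb : ℝ → ℝ := fun θ => max 0 (1 - |θ - 1|)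
  let lc : ℝ → ℝ := fun θ => max 0 (1 - |θ - 2|)
  let la : ℝ → ℝ := fun θ => 1 - lb θ - lc θ
  let F : ℝ → ℝ → ℂ := fun θ h => ((1 - h) * la θ + h / 3) • a + ((1 - h) * lb θ + h / 3) • b +
    ((1 - h) * lc θ + h / 3) • c
  have hcases : ∀ θ, 0 ≤ θ → θ ≤ 3 → (θ ≤ 1 ∧ la θ = 1 - θ ∧ lb θ = θ ∧ lc θ = 0) ∨
      (1 ≤ θ ∧ θ ≤ 2 ∧ la θ = 0 ∧ lb θ = 2 - θ ∧ lc θ = θ - 1) ∨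
      (2 ≤ θ ∧ la θ = θ - 2 ∧ lb θ = 0 ∧ lc θ = 3 - θ) := by
    intro θ h0 h3
    have hb : ∀ x, θ ≤ x → 0 ≤ 1 - (x - θ) → max 0 (1 - |θ - x|) = 1 - (x - θ) := by
      intro x h1 h2
      rw [abs_of_nonpos (by linarith), max_eq_right] <;> linarith
    have hb' : ∀ x, x ≤ θ → 0 ≤ 1 - (θ - x) → max 0 (1 - |θ - x|) = 1 - (θ - x) := by
      intro x h1 h2
      rw [abs_of_nonneg (by linarith), max_eq_right]; linarith
    have hz : ∀ x, θ ≤ x → 1 - (x - θ) ≤ 0 → max 0 (1 - |θ - x|) = 0 := by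
      intro x h1 h2
      rw [abs_of_nonpos (by linarith), max_eq_left]; linarith
    have hz' : ∀ x, x ≤ θ → 1 - (θ - x) ≤ 0 → max 0 (1 - |θ - x|) = 0 := by
      intro x h1 h2
      rw [abs_of_nonneg (by linarith), max_eq_left]; linarith
    rcases le_total θ 1 with h | h
    · left
      have e1 : lb θ = θ := by simp only [lb]; rw [hb 1 h (by linarith)]; ring
      have e2 : lc θ = 0 := by simp only [lc]; exact hz 2 (by linarith) (by linarith)
      exact ⟨h, by simp only [la]; rw [e1, e2]; ring, e1, e2⟩
    rcases le_total θ 2 with h' | h'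
    · right; left
      have e1 : lb θ = 2 - θ := by simp only [lb]; rw [hb' 1 h (by linarith)]; ring
      have e2 : lc θ = θ - 1 := by simp only [lc]; rw [hb 2 h' (by linarith)]; ring
      exact ⟨h, h', by simp only [la]; rw [e1, e2]; ring, e1, e2⟩
    · right; right
      have e1 : lb θ = 0 := by simp only [lb]; exact hz' 1 h (by linarith)
      have e2 : lc θ = 3 - θ := by simp only [lc]; rw [hb' 2 h' (by linarith)]; ring
      exact ⟨h', by simp only [la]; rw [e1, e2]; ring, e1, e2⟩
  have hnn : ∀ θ, 0 ≤ θ → θ ≤ 3 → 0 ≤ la θ ∧ 0 ≤ lb θ ∧ 0 ≤ lc θ ∧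
      (la θ = 0 ∨ lb θ = 0 ∨ lc θ = 0) := by
    intro θ h0 h3
    rcases hcases θ h0 h3 with ⟨h, e1, e2, e3⟩ | ⟨h, h', e1, e2, e3⟩ | ⟨h, e1, e2, e3⟩ <;>
      rw [e1, e2, e3] <;> refine ⟨by linarith, by linarith, by linarith, ?_⟩ <;> simp
  have hD := ht.2
  -- the barycentric coordinates of `F θ h`
  have horient : ∀ θ h, orient b c (F θ h) = ((1 - h) * la θ + h / 3) * orient a b c ∧
      orient c a (F θ h) = ((1 - h) * lb θ + h / 3) * orient a b c ∧
      orient a b (F θ h) = ((1 - h) * lc θ + h / 3) * orient a b c := by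
    intro θ h
    have hsum : la θ = 1 - lb θ - lc θ := rfl
    simp only [F, hsum]
    generalize lb θ = u
    generalize lc θ = v
    unfold orient
    simp only [Complex.sub_re, Complex.sub_im, Complex.add_re, Complex.add_im, Complex.real_smul,
      Complex.re_ofReal_mul, Complex.im_ofReal_mul]
    refine ⟨?_, ?_, ?_⟩ <;> ring
  refine ⟨F, fun _ => 0, ⟨rfl, ?_, continuous_const, fun _ => le_rfl, rfl, ?_, ?_, ?_, ?_⟩⟩
  · simp only [F, la, lb, lc]; fun_prop
  · intro h
    have e0 : la 0 = 1 ∧ lb 0 = 0 ∧ lc 0 = 0 := by simp [la, lb, lc]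
    have e3 : la 3 = 1 ∧ lb 3 = 0 ∧ lc 3 = 0 := by
      simp only [la, lb, lc]; norm_num
    simp only [F, Nat.cast_ofNat, e0, e3]
  · intro k hk s h0 h1
    have hk3 : (k : ℝ) + 1 ≤ 3 := by exact_mod_cast hk
    have hk0 : (0 : ℝ) ≤ k := Nat.cast_nonneg k
    have e := hcases (k + s) (by linarith) (by linarith)
    interval_cases k
    · have : la s = 1 - s ∧ lb s = s ∧ lc s = 0 := by
        norm_num at e
        rcases e with ⟨h, e1, e2, e3⟩ | ⟨h, h', e1, e2, e3⟩ | ⟨h, e1, e2, e3⟩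
        · exact ⟨e1, e2, e3⟩
        · rw [e1, e2, e3]; refine ⟨by linarith, by linarith, by linarith⟩
        · linarith
      simp [F, this]
      ring
    · have : la (1 + s) = 0 ∧ lb (1 + s) = 1 - s ∧ lc (1 + s) = s := by
        norm_num at e
        rcases e with ⟨h, e1, e2, e3⟩ | ⟨h, h', e1, e2, e3⟩ | ⟨h, e1, e2, e3⟩
        · rw [e1, e2, e3]; refine ⟨by linarith, by linarith, by linarith⟩
        · rw [e1, e2, e3]; refine ⟨by linarith, by linarith, by linarith⟩
        · rw [e1, e2, e3]; refine ⟨by linarith, by linarith, by linarith⟩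
      simp [F, this]
      ring
    · have : la (2 + s) = s ∧ lb (2 + s) = 0 ∧ lc (2 + s) = 1 - s := by
        norm_num at e
        rcases e with ⟨h, e1, e2, e3⟩ | ⟨h, h', e1, e2, e3⟩ | ⟨h, e1, e2, e3⟩
        · linarith
        · rw [e1, e2, e3]; refine ⟨by linarith, by linarith, by linarith⟩
        · rw [e1, e2, e3]; refine ⟨by linarith, by linarith, by linarith⟩
      simp [F, this]
      ring
  · intro θ h0 h3 h hh hh1
    have h3 : θ < 3 := by simpa using h3
    obtain ⟨n1, n2, n3, -⟩ := hnn θ h0 h3.le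
    obtain ⟨o1, o2, o3⟩ := horient θ h
    rw [interior_body ht]
    have h1' : 0 ≤ 1 - h := by linarith
    refine ⟨?_, ?_, ?_⟩
    · rw [o3]; positivity
    · rw [o1]; positivity
    · rw [o2]; positivity
  · intro θ θ' h0 h3 h0' h3' h h' hh hh1 hh' hh1' heq
    have h3 : θ < 3 := by simpa using h3
    have h3' : θ' < 3 := by simpa using h3'
    obtain ⟨o1, o2, o3⟩ := horient θ h
    obtain ⟨p1, p2, p3⟩ := horient θ' h'
    rw [heq] at o1 o2 o3
    have w1 := mul_right_cancel₀ hD.ne' (o1.symm.trans p1)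
    have w2 := mul_right_cancel₀ hD.ne' (o2.symm.trans p2)
    have w3 := mul_right_cancel₀ hD.ne' (o3.symm.trans p3)
    obtain ⟨n1, n2, n3, n4⟩ := hnn θ h0 h3.le
    obtain ⟨m1, m2, m3, m4⟩ := hnn θ' h0' h3'.le
    have k1 : 0 < 1 - h := by linarith
    have k1' : 0 < 1 - h' := by linarith
    have a1 := mul_nonneg k1.le n1
    have a2 := mul_nonneg k1.le n2
    have a3 := mul_nonneg k1.le n3
    have b1 := mul_nonneg k1'.le m1
    have b2 := mul_nonneg k1'.le m2
    have b3 := mul_nonneg k1'.le m3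
    have hle : h' ≤ h := by
      rcases n4 with e | e | e
      · rw [e] at w1; linarith
      · rw [e] at w2; linarith
      · rw [e] at w3; linarith
    have hle' : h ≤ h' := by
      rcases m4 with e | e | e
      · rw [e] at w1; linarith
      · rw [e] at w2; linarith
      · rw [e] at w3; linarith
    have hEq : h = h' := le_antisymm hle' hle
    subst hEq
    refine ⟨?_, rfl⟩
    have w1 := mul_left_cancel₀ k1.ne' (add_right_cancel w1)
    have w2 := mul_left_cancel₀ k1.ne' (add_right_cancel w2)
    have w3 := mul_left_cancel₀ k1.ne' (add_right_cancel w3)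
    rcases hcases θ h0 h3.le with ⟨h, e1, e2, e3⟩ | ⟨h, h', e1, e2, e3⟩ | ⟨h, e1, e2, e3⟩ <;>
      rcases hcases θ' h0' h3'.le with ⟨i, f1, f2, f3⟩ | ⟨i, i', f1, f2, f3⟩ | ⟨i, f1, f2, f3⟩ <;>
      rw [e1, f1] at w1 <;> rw [e2, f2] at w2 <;> rw [e3, f3] at w3 <;> linarith

lemma getD_append_length (A L : List ℂ) (i : ℕ) : (A ++ L).getD (A.length + i) 0 = L.getD i 0 := by
  rw [List.getD_append_right _ _ _ _ (by omega)]
  congr 1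
  omega

/-- Gluing a triangle to the boundary edge `x y` of a disc. The time of the edge is doubled, and
over this time the lower end of the height interval is extended downwards by a tent, in which the
triangle is placed. -/
lemma Model.insert {O : Set ℂ} {A B : List ℂ} {x y c : ℂ} {n : ℕ} {F : ℝ → ℝ → ℂ} {g : ℝ → ℝ}
    (M : Model O (A ++ x :: y :: B) n F g) {tr : Finset ℂ} (ht : IsTri tr y x c)
    (h1 : Disjoint (openSeg (x, y)) O) (h2 : Disjoint (interior (body tr)) O) :
    ∃ F' g', Model (O ∪ openSeg (x, y) ∪ interior (body tr)) (A ++ x :: c :: y :: B) (n + 1)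
      F' g' := by
  set k := A.length with hk
  have hlen := M.length
  have hkn : k + 1 ≤ n := by
    rw [List.length_append, List.length_cons, List.length_cons] at hlen
    omega
  have hknR : (k : ℝ) + 1 ≤ n := by exact_mod_cast hkn
  have hk0 : (0 : ℝ) ≤ k := Nat.cast_nonneg k
  -- `ρ` is the old time, and `T` is the tent; `w` points from the midpoint of `x y` to `c`
  let ρ : ℝ → ℝ := fun t => t - max 0 (min 2 (t - k)) / 2
  let T : ℝ → ℝ := fun t => max 0 (1 - |t - (k + 1)|)
  let w : ℂ := c - (1 / 2 : ℝ) • (x + y)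
  have ρ1 : ∀ t : ℝ, t ≤ k → ρ t = t := by
    intro t h
    simp only [ρ]
    rw [max_eq_left]
    · ring
    · exact (min_le_right _ _).trans (by linarith)
  have ρ2 : ∀ t : ℝ, k ≤ t → t ≤ k + 2 → ρ t = k + (t - k) / 2 := by
    intro t h h'
    simp only [ρ]
    rw [min_eq_right (by linarith), max_eq_right (by linarith)]
    ring
  have ρ3 : ∀ t : ℝ, k + 2 ≤ t → ρ t = t - 1 := by
    intro t h
    simp only [ρ]
    rw [min_eq_left (by linarith), max_eq_right (by norm_num)]
    ring
  have ρinj : ∀ t t' : ℝ, ρ t = ρ t' → t = t' := by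
    intro t t' h
    rcases le_total t k with a | a
    · rw [ρ1 t a] at h
      rcases le_total t' k with b | b
      · rw [ρ1 t' b] at h; linarith
      rcases le_total t' (k + 2) with b' | b'
      · rw [ρ2 t' b b'] at h; linarith
      · rw [ρ3 t' b'] at h; linarith
    rcases le_total t (k + 2) with a' | a'
    · rw [ρ2 t a a'] at h
      rcases le_total t' k with b | b
      · rw [ρ1 t' b] at h; linarith
      rcases le_total t' (k + 2) with b' | b'
      · rw [ρ2 t' b b'] at h; linarith
      · rw [ρ3 t' b'] at h; linarith
    · rw [ρ3 t a'] at h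
      rcases le_total t' k with b | b
      · rw [ρ1 t' b] at h; linarith
      rcases le_total t' (k + 2) with b' | b'
      · rw [ρ2 t' b b'] at h; linarith
      · rw [ρ3 t' b'] at h; linarith
  have ρrange : ∀ t : ℝ, 0 ≤ t → t < n + 1 → 0 ≤ ρ t ∧ ρ t < n := by
    intro t h0 h1
    rcases le_total t k with a | a
    · rw [ρ1 t a]; constructor <;> linarith
    rcases le_total t (k + 2) with a' | a'
    · rw [ρ2 t a a']; constructor <;> linarith
    · rw [ρ3 t a']; constructor <;> linarith
  have T0 : ∀ t : ℝ, t ≤ k ∨ k + 2 ≤ t → T t = 0 := by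
    intro t h
    simp only [T]
    apply max_eq_left
    rcases h with h | h
    · rw [abs_of_nonpos (by linarith)]; linarith
    · rw [abs_of_nonneg (by linarith)]; linarith
  have T1 : ∀ t : ℝ, k ≤ t → t ≤ k + 1 → T t = t - k := by
    intro t h h'
    simp only [T]
    rw [abs_of_nonpos (by linarith), max_eq_right] <;> linarith
  have T2 : ∀ t : ℝ, k + 1 ≤ t → t ≤ k + 2 → T t = k + 2 - t := by
    intro t h h'
    simp only [T]
    rw [abs_of_nonneg (by linarith), max_eq_right] <;> linarith
  have Tnn : ∀ t, 0 ≤ T t := fun t => le_max_left _ _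
  let g' : ℝ → ℝ := fun t => g (ρ t) - T t
  let F' : ℝ → ℝ → ℂ := fun t h => F (ρ t) (max h (g (ρ t))) +
    (min (T t) (max 0 (g (ρ t) - h))) • w
  have F'_hi : ∀ t h : ℝ, g (ρ t) ≤ h → F' t h = F (ρ t) h := by
    intro t h hh
    simp only [F']
    rw [max_eq_left hh, max_eq_left (by linarith), min_eq_right (Tnn t), zero_smul, add_zero]
  have F'_T0 : ∀ t : ℝ, T t = 0 → F' t (g' t) = F (ρ t) (g (ρ t)) := by
    intro t h
    have : g' t = g (ρ t) := by simp only [g']; rw [h, sub_zero]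
    rw [this, F'_hi t _ le_rfl]
  -- values over the glued edge
  have hxy : ∀ s : ℝ, 0 ≤ s → s ≤ 1 → F (k + s) (g (k + s)) = x + s • (y - x) := by
    intro s h0 h1
    rw [M.bdry k hkn s h0 h1]
    have e0 := getD_append_length A (x :: y :: B) 0
    have e1 := getD_append_length A (x :: y :: B) 1
    simp only [List.getD_cons_zero, List.getD_cons_succ, add_zero] at e0 e1
    rw [hk, e0, e1]
  have F'_lo : ∀ t h : ℝ, k ≤ t → t ≤ k + 2 → g' t ≤ h → h ≤ g (ρ t) →
      F' t h = x + ((t - k) / 2) • (y - x) + (g (ρ t) - h) • w := by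
    intro t h a b hh hh'
    simp only [F']
    simp only [g'] at hh
    rw [max_eq_right hh', max_eq_right (by linarith), min_eq_right (by linarith), ρ2 t a b,
      hxy _ (by linarith) (by linarith)]
  have hor : ∀ s d : ℝ, orient y x (x + s • (y - x) + d • w) = d * orient y x c ∧
      orient x c (x + s • (y - x) + d • w) = (s - d / 2) * orient y x c ∧
      orient c y (x + s • (y - x) + d • w) = (1 - s - d / 2) * orient y x c := by
    intro s d
    simp only [w]
    unfold orient
    simp only [Complex.sub_re, Complex.sub_im, Complex.add_re, Complex.add_im, Complex.real_smul,
      Complex.re_ofReal_mul, Complex.im_ofReal_mul]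
    refine ⟨?_, ?_, ?_⟩ <;> ring
  have hD := ht.2
  -- below the old height the time belongs to the glued edge, and the value lies in the triangle
  have hlow : ∀ t : ℝ, 0 ≤ t → t < n + 1 → ∀ h : ℝ, g' t < h → h ≤ g (ρ t) → k < t ∧ t < k + 2 ∧
      F' t h ∈ openSeg (x, y) ∪ interior (body tr) := by
    intro t h0 h1 h hh hh'
    have hT : 0 < T t := by simp only [g'] at hh; linarith
    have a : k < t := by
      by_contra hc
      rw [T0 t (Or.inl (not_lt.1 hc))] at hT; exact lt_irrefl _ hT
    have b : t < k + 2 := by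
      by_contra hc
      rw [T0 t (Or.inr (not_lt.1 hc))] at hT; exact lt_irrefl _ hT
    refine ⟨a, b, ?_⟩
    rw [F'_lo t h a.le b.le hh.le hh']
    rcases hh'.eq_or_lt with e | e
    · left
      rw [e, sub_self, zero_smul, add_zero]
      exact mem_openSeg.2 ⟨(t - k) / 2, by linarith, by linarith, rfl⟩
    · right
      rw [interior_body ht]
      obtain ⟨o1, o2, o3⟩ := hor ((t - k) / 2) (g (ρ t) - h)
      have hd : g (ρ t) - h < T t := by simp only [g'] at hh; linarith
      have hd1 : g (ρ t) - h < t - k ∧ g (ρ t) - h < k + 2 - t := by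
        rcases le_total t (k + 1) with q | q
        · rw [T1 t a.le q] at hd; constructor <;> linarith
        · rw [T2 t q b.le] at hd; constructor <;> linarith
      refine ⟨?_, ?_, ?_⟩
      · rw [o1]; exact mul_pos (by linarith) hD
      · rw [o2]; exact mul_pos (by linarith) hD
      · rw [o3]; exact mul_pos (by linarith) hD
  have hdisj : ∀ z, z ∈ openSeg (x, y) ∪ interior (body tr) → z ∉ O := by
    rintro z (hz | hz) hzO
    · exact Set.disjoint_left.1 h1 hz hzO
    · exact Set.disjoint_left.1 h2 hz hzO
  refine ⟨F', g', ⟨?_, ?_, ?_, ?_, ?_, ?_, ?_, ?_, ?_⟩⟩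
  · rw [List.length_append, List.length_cons, List.length_cons] at hlen ⊢
    simp only [List.length_cons] at hlen ⊢
    omega
  · have hρ : Continuous ρ := by simp only [ρ]; fun_prop
    have hT : Continuous T := by simp only [T]; fun_prop
    have hg := M.contg
    have hF := M.contF
    simp only [F']
    have : Continuous fun p : ℝ × ℝ => (ρ p.1, max p.2 (g (ρ p.1))) := by fun_prop
    have := hF.comp this
    exact this.add (by fun_prop)
  · have hρ : Continuous ρ := by simp only [ρ]; fun_prop
    have hT : Continuous T := by simp only [T]; fun_prop
    have hg := M.contg
    simp only [g']; fun_prop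
  · intro θ
    have := M.nonpos (ρ θ)
    have := Tnn θ
    simp only [g']; linarith
  · simp only [g']
    rw [T0 0 (Or.inl hk0), ρ1 0 hk0]
    push_cast
    rw [T0 (n + 1) (Or.inr (by linarith)), ρ3 (n + 1) (by linarith), M.g_per]
    simp
  · intro h
    simp only [F']
    rw [T0 0 (Or.inl hk0), ρ1 0 hk0]
    push_cast
    rw [T0 (n + 1) (Or.inr (by linarith)), ρ3 (n + 1) (by linarith), add_sub_cancel_right, M.g_per,
      M.F_per]
  · intro j hj s h0 h1
    have e0 := getD_append_length A (x :: c :: y :: B) 0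
    have e1 := getD_append_length A (x :: c :: y :: B) 1
    have e2 := getD_append_length A (x :: c :: y :: B) 2
    simp only [List.getD_cons_zero, List.getD_cons_succ, add_zero] at e0 e1 e2
    rcases lt_trichotomy j k with hjk | hjk | hjk
    · have hjk' : (j : ℝ) + 1 ≤ k := by exact_mod_cast hjk
      rw [F'_T0 _ (T0 _ (Or.inl (by linarith))), ρ1 _ (by linarith), M.bdry j (by omega) s h0 h1]
      have q1 : (A ++ x :: c :: y :: B).getD j 0 = (A ++ x :: y :: B).getD j 0 := by
        rw [List.getD_append _ _ _ _ hjk, List.getD_append _ _ _ _ hjk]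
      have q2 : (A ++ x :: c :: y :: B).getD (j + 1) 0 = (A ++ x :: y :: B).getD (j + 1) 0 := by
        rcases Nat.lt_or_ge (j + 1) k with h | h
        · rw [List.getD_append _ _ _ _ h, List.getD_append _ _ _ _ h]
        · have : j + 1 = A.length + 0 := by omega
          rw [this, getD_append_length, getD_append_length]; rfl
      rw [q1, q2]
    · subst hjk
      have hT := T1 (k + s) (by linarith) (by linarith)
      rw [F'_lo _ _ (by linarith) (by linarith) le_rfl (by simp only [g']; linarith [Tnn (k + s)])]
      simp only [g']
      rw [hT, hk, e0, e1]
      simp only [w]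
      simp only [Complex.real_smul]; push_cast; ring
    · rcases Nat.lt_or_ge (k + 1) j with hjk2 | hjk2
      · obtain ⟨i, rfl⟩ : ∃ i, j = k + 2 + i := ⟨j - (k + 2), by omega⟩
        have hi : (0 : ℝ) ≤ i := Nat.cast_nonneg i
        have hcast : ((k + 2 + i : ℕ) : ℝ) + s - 1 = ((k + 1 + i : ℕ) : ℝ) + s := by
          push_cast; ring
        have hge : (k : ℝ) + 2 ≤ ((k + 2 + i : ℕ) : ℝ) + s := by push_cast; linarith
        rw [F'_T0 _ (T0 _ (Or.inr hge)), ρ3 _ hge, hcast, M.bdry (k + 1 + i) (by omega) s h0 h1]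
        have q1 : ∀ i, (A ++ x :: c :: y :: B).getD (k + 2 + i) 0
            = (A ++ x :: y :: B).getD (k + 1 + i) 0 := by
          intro i
          have a1 := getD_append_length A (x :: c :: y :: B) (i + 2)
          have a2 := getD_append_length A (x :: y :: B) (i + 1)
          simp only [List.getD_cons_succ] at a1 a2
          rw [show k + 2 + i = A.length + (i + 2) by omega,
            show k + 1 + i = A.length + (i + 1) by omega, a1, a2]
        have q2 := q1 (i + 1)
        rw [show k + 2 + (i + 1) = k + 2 + i + 1 by omega,
            show k + 1 + (i + 1) = k + 1 + i + 1 by omega] at q2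
        rw [q1 i, q2]
      · obtain rfl : j = k + 1 := by omega
        push_cast
        have hT := T2 (k + 1 + s) (by linarith) (by linarith)
        rw [F'_lo _ _ (by linarith) (by linarith) le_rfl
          (by simp only [g']; linarith [Tnn (k + 1 + s)])]
        simp only [g']
        rw [hT, hk, e1, show A.length + 1 + 1 = A.length + 2 by omega, e2]
        simp only [w]
        simp only [Complex.real_smul]; push_cast; ring
  · intro θ h0 h1 h hh hh1
    push_cast at h1
    rcases le_or_gt h (g (ρ θ)) with q | q
    · rcases (hlow θ h0 h1 h hh q).2.2 with r | r
      · exact Or.inl (Or.inr r)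
      · exact Or.inr r
    · left; left
      rw [F'_hi θ h q.le]
      obtain ⟨r1, r2⟩ := ρrange θ h0 h1
      exact M.mem _ r1 r2 h q hh1
  · intro θ θ' h0 h1 h0' h1' h h' hh hh1 hh' hh1' heq
    push_cast at h1 h1'
    obtain ⟨r1, r2⟩ := ρrange θ h0 h1
    obtain ⟨r1', r2'⟩ := ρrange θ' h0' h1'
    rcases le_or_gt h (g (ρ θ)) with q | q <;> rcases le_or_gt h' (g (ρ θ')) with q' | q'
    · obtain ⟨a, b, -⟩ := hlow θ h0 h1 h hh q
      obtain ⟨a', b', -⟩ := hlow θ' h0' h1' h' hh' q'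
      rw [F'_lo θ h a.le b.le hh.le q, F'_lo θ' h' a'.le b'.le hh'.le q'] at heq
      obtain ⟨o1, o2, -⟩ := hor ((θ - k) / 2) (g (ρ θ) - h)
      obtain ⟨p1, p2, -⟩ := hor ((θ' - k) / 2) (g (ρ θ') - h')
      rw [heq] at o1 o2
      have w1 := mul_right_cancel₀ hD.ne' (o1.symm.trans p1)
      have w2 := mul_right_cancel₀ hD.ne' (o2.symm.trans p2)
      have : θ = θ' := by linarith
      subst this
      exact ⟨rfl, by linarith⟩
    · exfalso
      apply hdisj _ (hlow θ h0 h1 h hh q).2.2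
      rw [heq, F'_hi θ' h' q'.le]
      exact M.mem _ r1' r2' h' q' hh1'
    · exfalso
      apply hdisj _ (hlow θ' h0' h1' h' hh' q').2.2
      rw [← heq, F'_hi θ h q.le]
      exact M.mem _ r1 r2 h q hh1
    · rw [F'_hi θ h q.le, F'_hi θ' h' q'.le] at heq
      obtain ⟨e1, e2⟩ := M.inj _ _ r1 r2 r1' r2' h h' q hh1 q' hh1' heq
      exact ⟨ρinj _ _ e1, e2⟩


/-! ### Growing discs from triangles -/

/-- The union of the open triangles of `S` and of the open diagonals in `Γ`. -/
def discOpen (S : Finset (Finset ℂ)) (Γ : Set (ℂ × ℂ)) : Set ℂ :=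
  {z | (∃ t ∈ S, z ∈ interior (body t)) ∨ ∃ e ∈ Γ, z ∈ openSeg e}

/-- There is a polygonal path from `u` to `v` in `O`. -/
def PolyJoined (O : Set ℂ) : ℂ → ℂ → Prop := Relation.ReflTransGen fun u v => seg (u, v) ⊆ O

/-- The triangles in `S`, glued along the diagonals in `Γ`, form a disc with the closed boundary
walk `V`. The walk starts and ends at `a`, and its first edge is `a b` if this is not a diagonal.
-/
structure Disc (H : List ℂ) (T : Finset (Finset ℂ)) (a b : ℂ) (S : Finset (Finset ℂ))
    (Γ : Set (ℂ × ℂ)) (V : List ℂ) : Prop where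
  sub : S ⊆ T
  head : V.head? = some a
  last : V.getLast? = some a
  root : ¬ openSeg (a, b) ⊆ inner H → ∃ V', V = a :: b :: V'
  nodup : (pairs V).Nodup
  side_of_pair : ∀ e ∈ pairs V, ∃ t ∈ S, IsSide t e.1 e.2
  pair_of_side : ∀ t ∈ S, ∀ x y, IsSide t x y → (x, y) ∈ pairs V ∨ (x, y) ∈ Γ ∨ (y, x) ∈ Γ
  glued_notMem : ∀ e ∈ Γ, e ∉ pairs V ∧ e.swap ∉ pairs V
  glued_inner : ∀ e ∈ Γ, openSeg e ⊆ inner H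
  glued_side : ∀ e ∈ Γ, (∃ t ∈ S, IsSide t e.1 e.2) ∧ ∃ t ∈ S, IsSide t e.2 e.1
  joined : ∀ u ∈ discOpen S Γ, ∀ v ∈ discOpen S Γ, PolyJoined (discOpen S Γ) u v
  wind : ∀ z, (∀ t ∈ T, z ∉ frontier (body t)) →
    asum (pairs V) z = ∑ t ∈ S, (interior (body t)).indicator (fun _ => 2 * Real.pi) z
  model : ∃ n F g, Model (discOpen S Γ) V n F g

lemma PolyJoined.mono {O O' : Set ℂ} (h : O ⊆ O') {u v : ℂ} (hj : PolyJoined O u v) :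
    PolyJoined O' u v := by
  unfold PolyJoined at *
  induction hj with
  | refl => exact Relation.ReflTransGen.refl
  | tail _ h' ih => exact Relation.ReflTransGen.tail ih (Set.Subset.trans h' h)

lemma PolyJoined.symm {O : Set ℂ} {u v : ℂ} (hj : PolyJoined O u v) : PolyJoined O v u := by
  unfold PolyJoined at *
  induction hj with
  | refl => exact Relation.ReflTransGen.refl
  | tail _ h ih => exact Relation.ReflTransGen.head (by rw [seg_swap]; exact h) ih

/-- A polygonal path can be closed to a cycle by one more edge. -/
lemma PolyJoined.exists_cycle {O : Set ℂ} {u v : ℂ} (hj : PolyJoined O v u) :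
    ∃ es : List (ℂ × ℂ), (∀ e ∈ es, seg e ⊆ O) ∧ IsCycle (es ++ [(u, v)]) := by
  unfold PolyJoined at hj
  induction hj with
  | refl => exact ⟨[], by simp, by simp [IsCycle]⟩
  | @tail b c _ h ih =>
    obtain ⟨es, h1, h2⟩ := ih
    refine ⟨es ++ [(b, c)], ?_, ?_⟩
    · intro e he
      rw [List.mem_append, List.mem_singleton] at he
      rcases he with he | rfl
      · exact h1 e he
      · exact h
    · unfold IsCycle at h2 ⊢
      simp only [List.map_append, List.map_cons, List.map_nil] at h2 ⊢
      have := h2.append_right [c]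
      refine this.trans ?_
      rw [List.append_assoc, List.append_assoc]
      exact List.Perm.append_left _ (List.Perm.swap _ _ _)

lemma PolyJoined.isPreconnected {O : Set ℂ} (h : ∀ u ∈ O, ∀ v ∈ O, PolyJoined O u v) :
    IsPreconnected O := by
  apply isPreconnected_of_forall_pair
  intro u hu v hv
  have : ∀ v, PolyJoined O u v → v ∈ O → ∃ t ⊆ O, u ∈ t ∧ v ∈ t ∧ IsPreconnected t := by
    intro v hj
    unfold PolyJoined at hj
    induction hj with
    | refl => intro _; exact ⟨{u}, by simpa using hu, rfl, rfl, isPreconnected_singleton⟩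
    | @tail b c _ h ih =>
      intro _
      obtain ⟨t, h1, h2, h3, h4⟩ := ih (h (left_mem_seg (b, c)))
      refine ⟨t ∪ seg (b, c), Set.union_subset h1 h, Or.inl h2, Or.inr (right_mem_seg (b, c)), ?_⟩
      exact IsPreconnected.union b h3 (left_mem_seg (b, c)) h4 (convex_segment _ _).isPreconnected
  exact this v (h u hu v hv) hv

lemma IsSide.notMem_seg {t : Finset ℂ} {x y z : ℂ} (h : IsSide t x y)
    (hz : z ∉ frontier (body t)) : z ∉ seg (x, y) := fun hzs =>
  hz ⟨subset_closure (h.seg_subset_body hzs), h.notMem_interior hzs⟩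

lemma IsTri.asum {t : Finset ℂ} {a b c z : ℂ} (h : IsTri t a b c) (hz : z ∉ frontier (body t)) :
    asum [(a, b), (b, c), (c, a)] z = (interior (body t)).indicator (fun _ => 2 * Real.pi) z := by
  by_cases hzi : z ∈ interior (body t)
  · rw [h.asum_inside hzi, Set.indicator_of_mem hzi]
  · rw [Set.indicator_of_notMem hzi]
    apply h.asum_outside
    intro hzb
    exact hz ⟨subset_closure hzb, hzi⟩

section
variable {H : List ℂ} {T : Finset (Finset ℂ)} {a b : ℂ} {S : Finset (Finset ℂ)}
  {Γ : Set (ℂ × ℂ)} {V : List ℂ}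

lemma Disc.discOpen_subset_inner (hT : VertexTriangulation H T) (D : Disc H T a b S Γ V) :
    discOpen S Γ ⊆ inner H := by
  rintro z (⟨t, ht, hz⟩ | ⟨e, he, hz⟩)
  · exact hT.inside t (D.sub ht) hz
  · exact D.glued_inner e he hz

lemma Disc.openSeg_disjoint (hT : VertexTriangulation H T) (D : Disc H T a b S Γ V) {x y : ℂ}
    {t : Finset ℂ} (ht : t ∈ T) (hs : IsSide t x y) (h : (x, y) ∉ Γ) (h' : (y, x) ∉ Γ) :
    Disjoint (openSeg (x, y)) (discOpen S Γ) := by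
  rw [Set.disjoint_left]
  rintro z hz (⟨t', ht', hz'⟩ | ⟨⟨p, q⟩, he, hz'⟩)
  · exact hT.notMem_interior ht (D.sub ht') hs (openSeg_subset_seg _ hz) hz'
  · obtain ⟨⟨t1, ht1, hs1⟩, -⟩ := D.glued_side _ he
    rcases hT.diagonal_unique (D.sub ht1) ht hs1 hs (D.glued_inner _ he) hz' hz with
      ⟨rfl, rfl⟩ | ⟨rfl, rfl⟩
    · exact h he
    · exact h' he

/-- The discs do not close up to annuli: a triangle that is glued to a boundary edge is new.
Otherwise there is a loop in the interior of the polygon that crosses this edge exactly once. It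
has different winding numbers around the endpoints of the edge, although these are connected by
the boundary of the polygon. -/
lemma Disc.notMem_of_side (hT : VertexTriangulation H T) (D : Disc H T a b S Γ V) {x y : ℂ}
    (hxy : (x, y) ∈ pairs V) (hin : openSeg (x, y) ⊆ inner H) {t' : Finset ℂ}
    (hs' : IsSide t' y x) : t' ∉ S := by
  intro ht'
  obtain ⟨t, ht, hs⟩ := D.side_of_pair _ hxy
  have hs : IsSide t x y := hs
  set O := discOpen S Γ with hO
  have hOin : O ⊆ inner H := D.discOpen_subset_inner hT
  have hdisj : Disjoint (openSeg (x, y)) O := D.openSeg_disjoint hT (D.sub ht) hs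
    (fun h => (D.glued_notMem _ h).1 hxy) (fun h => (D.glued_notMem _ h).2 hxy)
  set d := y - x with hd
  have hd0 : d ≠ 0 := sub_ne_zero.2 hs.ne.symm
  set m := x + (1 / 2 : ℝ) • d with hm
  have hmo : m ∈ openSeg (x, y) := openSeg_midpoint (x, y)
  obtain ⟨r, hr, hball⟩ := Metric.isOpen_iff.1 (isOpen_inner H) m (hin hmo)
  have hmo' : m ∈ openSeg (y, x) := by rw [openSeg_swap]; exact hmo
  obtain ⟨ε, ⟨⟨h1, h2⟩, h3, h4⟩, hε⟩ := (((hs.eventually_left hmo one_pos (d := d) (by simp [hd])).and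
    (hs'.eventually_left hmo' one_pos (d := -d) (by simp [hd]))).and
    (((tendsto_normal m d).eventually (Metric.ball_mem_nhds m hr)).and
    ((tendsto_normal m (-d)).eventually (Metric.ball_mem_nhds m hr)))).and
    self_mem_nhdsWithin |>.exists
  have hε : 0 < ε := hε
  -- the loop: from `u` to `v` across the midpoint `m` of the edge, and back in the disc
  set u := m + ε * (Complex.I * d) with hu
  set v := m + ε * (Complex.I * -d) with hv
  have huv : seg (u, v) ⊆ inner H := ((convex_ball m r).segment_subset h3 h4).trans hball
  obtain ⟨es, hes, hcyc⟩ := (D.joined v (Or.inl ⟨t', ht', h2⟩) u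
    (Or.inl ⟨t, ht, h1⟩)).exists_cycle
  have hvu : v - u = ((2 * ε : ℝ) : ℂ) * (Complex.I * -d) := by
    rw [hu, hv]; push_cast; ring
  have hnormal : ∀ δ : ℝ, (δ : ℂ) * (Complex.I * (v - u)) = ((2 * δ * ε : ℝ) : ℂ) * d := by
    intro δ
    rw [hvu]; push_cast
    linear_combination (-2 * δ * ε * d : ℂ) * Complex.I_mul_I
  have hline : ∀ σ : ℝ, σ ≠ 0 → m + (σ : ℂ) * d ∉ seg (u, v) := by
    intro σ hσ hmem
    obtain ⟨s, -, -, hs⟩ := mem_seg.1 hmem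
    simp only at hs
    rw [hvu, hu, Complex.real_smul] at hs
    have h5 : (σ : ℂ) * d = (((1 - 2 * s) * ε : ℝ) : ℂ) * Complex.I * d := by
      push_cast at hs ⊢; linear_combination hs
    have h6 := congrArg Complex.re (mul_right_cancel₀ hd0 h5)
    simp at h6
    exact hσ h6
  have hK : ∀ I : Set ℝ, IsPreconnected I → IsPreconnected ((fun σ : ℝ => m + (σ : ℂ) * d) '' I) :=
    fun I hI => hI.image _ (by fun_prop)
  -- `K` connects the two sides of the loop: it consists of the edge without `m`, and of the boundary
  set K := (fun σ : ℝ => m + (σ : ℂ) * d) '' Set.Ico (-1 / 2) 0 ∪ trace H ∪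
    (fun σ : ℝ => m + (σ : ℂ) * d) '' Set.Ioc 0 (1 / 2) with hKdef
  have hxH : x ∈ trace H := mem_trace_of_mem (hT.vertex t (D.sub ht) x hs.left_mem)
  have hyH : y ∈ trace H := mem_trace_of_mem (hT.vertex t (D.sub ht) y hs.right_mem)
  have hx' : m + ((-1 / 2 : ℝ) : ℂ) * d = x := by
    rw [hm, Complex.real_smul]; push_cast; ring
  have hy' : m + ((1 / 2 : ℝ) : ℂ) * d = y := by
    rw [hm, hd, Complex.real_smul]; push_cast; ring
  have hKconn : IsPreconnected K := by
    have hy2 : y ∈ (fun σ : ℝ => m + (σ : ℂ) * d) '' Set.Ioc 0 (1 / 2) :=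
      ⟨1 / 2, by norm_num, hy'⟩
    have hx2 : x ∈ (fun σ : ℝ => m + (σ : ℂ) * d) '' Set.Ico (-1 / 2) 0 :=
      ⟨-1 / 2, by norm_num, hx'⟩
    refine IsPreconnected.union y (Or.inr hyH) hy2 ?_ (hK _ isPreconnected_Ioc)
    exact IsPreconnected.union x hx2 hxH (hK _ isPreconnected_Ico)
      (isPreconnected_trace H)
  have hoff : ∀ σ : ℝ, -1 / 2 ≤ σ → σ ≤ 1 / 2 → m + (σ : ℂ) * d ∉ O := by
    intro σ h5 h6 hc
    rcases h5.eq_or_lt with e | h5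
    · rw [← e, hx'] at hc; exact (hOin hc).1 hxH
    rcases h6.eq_or_lt with e | h6
    · rw [e, hy'] at hc; exact (hOin hc).1 hyH
    refine Set.disjoint_left.1 hdisj (mem_openSeg.2 ⟨1 / 2 + σ, by linarith, by linarith, ?_⟩) hc
    simp only [hm, hd, Complex.real_smul]; push_cast; ring
  have hKoff : ∀ z ∈ K, ∀ e ∈ es ++ [(u, v)], z ∉ seg e := by
    intro z hz e he hze
    rw [List.mem_append, List.mem_singleton] at he
    rcases hz with (⟨σ, hσ, rfl⟩ | hz) | ⟨σ, hσ, rfl⟩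
    · rcases he with he | rfl
      · exact hoff σ hσ.1 (by linarith [hσ.2]) (hes e he hze)
      · exact hline σ hσ.2.ne hze
    · rcases he with he | rfl
      · exact (hOin (hes e he hze)).1 hz
      · exact (huv hze).1 hz
    · rcases he with he | rfl
      · exact hoff σ (by linarith [hσ.1]) hσ.2 (hes e he hze)
      · exact hline σ hσ.1.ne' hze
  have hvu0 : v - u ≠ 0 := by
    rw [hvu]
    refine mul_ne_zero (by exact_mod_cast (by positivity)) (mul_ne_zero Complex.I_ne_zero
      (neg_ne_zero.2 hd0))
  have hmes : ∀ e ∈ es, m ∉ seg e := fun e he hme => by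
    have := hoff 0 (by norm_num) (by norm_num)
    simp at this
    exact this (hes e he hme)
  have hmuv : m ∈ openSeg (u, v) := by
    refine mem_openSeg.2 ⟨1 / 2, by norm_num, by norm_num, ?_⟩
    rw [hvu, hu, Complex.real_smul]; push_cast; ring
  have hsum : ((es ++ [(u, v)]).map (jmp m (v - u))).sum = 1 := by
    rw [List.map_append, List.sum_append]
    have h0 : (es.map (jmp m (v - u))).sum = 0 := by
      apply List.sum_eq_zero
      intro w hw
      obtain ⟨e, he, rfl⟩ := List.mem_map.1 hw
      exact jmp_eq_zero (hmes e he)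
    rw [h0]
    simp [jmp_self hmuv rfl]
  have hgen : ∀ e ∈ es ++ [(u, v)], GenericAt m (v - u) e := by
    intro e he hme
    rw [List.mem_append, List.mem_singleton] at he
    rcases he with he | rfl
    · exact absurd hme (hmes e he)
    · exact ⟨hmuv, 1, one_ne_zero, by simp⟩
  have hev : ∀ᶠ δ : ℝ in 𝓝[>] 0, δ < 1 / (4 * ε) ∧ 0 < δ := by
    filter_upwards [Ioo_mem_nhdsGT (show (0 : ℝ) < 1 / (4 * ε) by positivity)] with δ hδ
    exact ⟨hδ.2, hδ.1⟩
  have := jump_eq hvu0 hgen (u := asum (es ++ [(u, v)]) x) (v := asum (es ++ [(u, v)]) x)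
    (hev.mono fun δ hδ => by
      have h5 : 0 < 2 * δ * ε := by have := hδ.2; positivity
      have h6 : 2 * δ * ε < 1 / 2 := by
        have := (lt_div_iff₀ (by positivity)).1 hδ.1
        linarith
      have hxK : x ∈ K := Or.inl (Or.inr hxH)
      refine ⟨asum_const hcyc hKconn hKoff (Or.inr ⟨2 * δ * ε, ⟨h5, h6.le⟩, ?_⟩) hxK,
        asum_const hcyc hKconn hKoff (Or.inl (Or.inl ⟨-(2 * δ * ε), ⟨by linarith, by linarith⟩, ?_⟩))
          hxK⟩
      · rw [hnormal]
      · simp only [hnormal, Complex.ofReal_neg, neg_mul]; ring).frequently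
  rw [hsum, sub_self] at this
  have := Real.pi_pos
  linarith

lemma discOpen_insert (t : Finset ℂ) (x y : ℂ) : discOpen (insert t S) (insert (x, y) Γ) =
    discOpen S Γ ∪ openSeg (x, y) ∪ interior (body t) := by
  ext z
  simp only [discOpen, Finset.mem_insert, Set.mem_insert_iff, exists_eq_or_imp, Set.mem_union,
    Set.mem_ofPred_eq]
  constructor
  · rintro ((h | h) | h | h)
    · exact Or.inr h
    · exact Or.inl (Or.inl (Or.inl h))
    · exact Or.inl (Or.inr h)
    · exact Or.inl (Or.inl (Or.inr h))
  · rintro (((h | h) | h) | h)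
    · exact Or.inl (Or.inr h)
    · exact Or.inr (Or.inr h)
    · exact Or.inr (Or.inl h)
    · exact Or.inl (Or.inl h)

/-- Gluing the neighbouring triangle along a diagonal of the boundary walk. -/
lemma Disc.insert (hT : VertexTriangulation H T) {A B : List ℂ} {x y c : ℂ}
    (D : Disc H T a b S Γ (A ++ x :: y :: B)) (hin : openSeg (x, y) ⊆ inner H) {t' : Finset ℂ}
    (ht'T : t' ∈ T) (ht' : IsTri t' y x c) :
    Disc H T a b (insert t' S) (insert (x, y) Γ) (A ++ x :: c :: y :: B) := by
  have hsplit : pairs (A ++ x :: y :: B) = pairs (A ++ [x]) ++ (x, y) :: pairs (y :: B) := by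
    rw [pairs_append, pairs_cons]
  have hsplit' : pairs (A ++ x :: c :: y :: B) =
      pairs (A ++ [x]) ++ (x, c) :: (c, y) :: pairs (y :: B) := by
    rw [pairs_append, pairs_cons, pairs_cons]
  have hxyV : (x, y) ∈ pairs (A ++ x :: y :: B) := by rw [hsplit]; simp
  have hnew : t' ∉ S := D.notMem_of_side hT hxyV hin ht'.side
  obtain ⟨t, ht, hs⟩ := D.side_of_pair _ hxyV
  have hs : IsSide t x y := hs
  have hold : ∀ e ∈ pairs (A ++ x :: y :: B), ¬ IsSide t' e.1 e.2 := by
    intro e he hse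
    obtain ⟨t1, ht1, hs1⟩ := D.side_of_pair e he
    have := hT.eq_of_side (D.sub ht1) ht'T hs1 hse
    exact hnew (this ▸ ht1)
  have hrest : ∀ e, e ∈ pairs (A ++ [x]) ∨ e ∈ pairs (y :: B) → e ∈ pairs (A ++ x :: y :: B) := by
    intro e he
    rw [hsplit, List.mem_append, List.mem_cons]; tauto
  have hmem' : ∀ e, e ∈ pairs (A ++ x :: c :: y :: B) ↔
      (e ∈ pairs (A ++ [x]) ∨ e ∈ pairs (y :: B)) ∨ e = (x, c) ∨ e = (c, y) := by
    intro e
    rw [hsplit', List.mem_append, List.mem_cons, List.mem_cons]; tauto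
  have hmem : ∀ e, e ∈ pairs (A ++ x :: y :: B) ↔
      (e ∈ pairs (A ++ [x]) ∨ e ∈ pairs (y :: B)) ∨ e = (x, y) := by
    intro e
    rw [hsplit, List.mem_append, List.mem_cons]; tauto
  have hnd := D.nodup
  rw [hsplit, List.nodup_middle, List.nodup_cons, List.mem_append] at hnd
  obtain ⟨n1, n2⟩ := hnd
  have hyx := ht'.ne
  have hxc := ht'.rot.ne
  have hcy := ht'.rot.rot.ne
  have hsxc : IsSide t' x c := ht'.rot.side
  have hscy : IsSide t' c y := ht'.rot.rot.side
  have hxyΓ : (x, y) ∉ Γ := fun h => (D.glued_notMem _ h).1 hxyV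
  have hyxΓ : (y, x) ∉ Γ := fun h => (D.glued_notMem _ h).2 hxyV
  have hd1 : Disjoint (openSeg (x, y)) (discOpen S Γ) :=
    D.openSeg_disjoint hT (D.sub ht) hs hxyΓ hyxΓ
  refine ⟨?_, ?_, ?_, ?_, ?_, ?_, ?_, ?_, ?_, ?_, ?_, ?_, ?_⟩
  · exact Finset.insert_subset ht'T D.sub
  · have := D.head
    cases A <;> simpa using this
  · have := D.last
    simpa using this
  · intro hroot
    obtain ⟨V', hV'⟩ := D.root hroot
    rcases A with _ | ⟨p, _ | ⟨q, A⟩⟩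
    · simp only [List.nil_append, List.cons.injEq] at hV'
      obtain ⟨rfl, rfl, -⟩ := hV'
      exact absurd hin hroot
    · simp only [List.cons_append, List.nil_append, List.cons.injEq] at hV'
      obtain ⟨rfl, rfl, -⟩ := hV'
      exact ⟨_, rfl⟩
    · simp only [List.cons_append, List.cons.injEq] at hV'
      obtain ⟨rfl, rfl, -⟩ := hV'
      exact ⟨_, rfl⟩
  · rw [hsplit', List.nodup_middle, List.nodup_cons]
    constructor
    · intro h
      have h : (x, c) ∈ pairs (A ++ [x]) ∨ (x, c) = (c, y) ∨ (x, c) ∈ pairs (y :: B) := by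
        simpa using h
      rcases h with h | h | h
      · exact hold _ (hrest _ (Or.inl h)) hsxc
      · exact hxc (Prod.mk.inj h).1
      · exact hold _ (hrest _ (Or.inr h)) hsxc
    · rw [List.nodup_middle, List.nodup_cons]
      refine ⟨fun h => ?_, n2⟩
      rw [List.mem_append] at h
      exact hold _ (hrest _ h) hscy
  · intro e he
    rcases (hmem' e).1 he with h | rfl | rfl
    · obtain ⟨t1, ht1, hs1⟩ := D.side_of_pair e (hrest e h)
      exact ⟨t1, Finset.mem_insert_of_mem ht1, hs1⟩
    · exact ⟨t', Finset.mem_insert_self _ _, hsxc⟩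
    · exact ⟨t', Finset.mem_insert_self _ _, hscy⟩
  · intro t1 ht1 p q hpq
    rcases Finset.mem_insert.1 ht1 with rfl | ht1
    · rcases ht'.side_cases hpq with ⟨rfl, rfl⟩ | ⟨rfl, rfl⟩ | ⟨rfl, rfl⟩
      · right; right; exact Set.mem_insert _ _
      · left; rw [hmem']; tauto
      · left; rw [hmem']; tauto
    · rcases D.pair_of_side t1 ht1 p q hpq with h | h | h
      · rcases (hmem _).1 h with h | h
        · left; rw [hmem']; exact Or.inl h
        · right; left; rw [h]; exact Set.mem_insert _ _
      · right; left; exact Set.mem_insert_of_mem _ h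
      · right; right; exact Set.mem_insert_of_mem _ h
  · intro e he
    rcases Set.mem_insert_iff.1 he with rfl | he
    · constructor
      · intro h
        rcases (hmem' _).1 h with h | h | h
        · exact n1 h
        · exact hcy (Prod.mk.inj h).2.symm
        · exact hxc (Prod.mk.inj h).1
      · intro h
        rcases (hmem' _).1 h with h | h | h
        · exact hold _ (hrest _ h) ht'.side
        · exact hyx (Prod.mk.inj h).1
        · exact hyx (Prod.mk.inj h).2.symm
    · obtain ⟨⟨t1, ht1, hs1⟩, t2, ht2, hs2⟩ := D.glued_side e he
      have q1 : ∀ p q, IsSide t' p q → e ≠ (p, q) := by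
        rintro p q hpq rfl
        have := hT.eq_of_side (D.sub ht1) ht'T hs1 hpq
        exact hnew (this ▸ ht1)
      have q2 : ∀ p q, IsSide t' p q → e.swap ≠ (p, q) := by
        rintro p q hpq heq
        have h1 : e.2 = p := congrArg Prod.fst heq
        have h2 : e.1 = q := congrArg Prod.snd heq
        rw [h1, h2] at hs2
        have := hT.eq_of_side (D.sub ht2) ht'T hs2 hpq
        exact hnew (this ▸ ht2)
      obtain ⟨g1, g2⟩ := D.glued_notMem e he
      constructor
      · intro h
        rcases (hmem' _).1 h with h | h | h
        · exact g1 (hrest _ h)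
        · exact q1 _ _ hsxc h
        · exact q1 _ _ hscy h
      · intro h
        rcases (hmem' _).1 h with h | h | h
        · exact g2 (hrest _ h)
        · exact q2 _ _ hsxc h
        · exact q2 _ _ hscy h
  · intro e he
    rcases Set.mem_insert_iff.1 he with rfl | he
    · exact hin
    · exact D.glued_inner e he
  · intro e he
    rcases Set.mem_insert_iff.1 he with rfl | he
    · exact ⟨⟨t, Finset.mem_insert_of_mem ht, hs⟩, t', Finset.mem_insert_self _ _, ht'.side⟩
    · obtain ⟨⟨t1, ht1, hs1⟩, t2, ht2, hs2⟩ := D.glued_side e he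
      exact ⟨⟨t1, Finset.mem_insert_of_mem ht1, hs1⟩, t2, Finset.mem_insert_of_mem ht2, hs2⟩
  · rw [discOpen_insert]
    set O' := discOpen S Γ ∪ openSeg (x, y) ∪ interior (body t') with hO'
    set m := x + (1 / 2 : ℝ) • (y - x) with hm
    have hmo : m ∈ openSeg (x, y) := openSeg_midpoint (x, y)
    -- the midpoint of the glued diagonal sees both triangles
    have hsee : ∀ {t : Finset ℂ}, m ∈ body t → ∀ u ∈ interior (body t),
        interior (body t) ⊆ O' → PolyJoined O' m u := by
      intro t hmt u hu hsub
      apply Relation.ReflTransGen.single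
      intro w hw
      by_cases hwm : w = m
      · rw [hwm]; exact Or.inl (Or.inr hmo)
      by_cases hwu : w = u
      · rw [hwu]; exact hsub hu
      apply hsub
      have := (convex_body t).openSegment_closure_interior_subset_interior (subset_closure hmt) hu
      exact this (mem_openSeg_of_mem_seg hw hwm hwu)
    have hs1 : interior (body t) ⊆ O' := fun w hw => Or.inl (Or.inl (Or.inl ⟨t, ht, hw⟩))
    have hs2 : interior (body t') ⊆ O' := fun w hw => Or.inr hw
    have hmt : m ∈ body t := hs.seg_subset_body (openSeg_subset_seg _ hmo)
    have hmt' : m ∈ body t' := ht'.side.seg_subset_body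
      (by rw [seg_swap]; exact openSeg_subset_seg _ hmo)
    have hto : ∀ u ∈ O', PolyJoined O' m u := by
      rintro u ((hu | hu) | hu)
      · obtain ⟨w, hw⟩ := hs.interior_nonempty
        have j1 := hsee hmt w hw hs1
        have j2 := D.joined w (Or.inl ⟨t, ht, hw⟩) u hu
        exact j1.trans (j2.mono (fun z hz => Or.inl (Or.inl hz)))
      · apply Relation.ReflTransGen.single
        have : seg (m, u) ⊆ openSeg (x, y) :=
          (convex_openSegment x y).segment_subset hmo hu
        exact this.trans fun z hz => Or.inl (Or.inr hz)
      · exact hsee hmt' u hu hs2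
    intro u hu v hv
    exact (hto u hu).symm.trans (hto v hv)
  · intro z hz
    have h1 := D.wind z hz
    have h2 := ht'.asum (hz t' ht'T)
    have h3 : z ∉ seg (x, y) := hs.notMem_seg (hz t (D.sub ht))
    have h4 := ang_swap h3
    rw [Finset.sum_insert hnew, ← h1, ← h2, hsplit, hsplit']
    simp only [asum_append, asum_cons, asum_nil]
    simp only [Prod.swap_prod_mk] at h4
    rw [h4]; ring
  · obtain ⟨n, F, g, M⟩ := D.model
    rw [discOpen_insert]
    have hd2 : Disjoint (interior (body t')) (discOpen S Γ) := by
      rw [Set.disjoint_left]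
      rintro z hz (⟨t1, ht1, hz1⟩ | ⟨e, he, hz1⟩)
      · have := hT.eq_of_mem_interior ht'T (D.sub ht1) hz hz1
        exact hnew (this ▸ ht1)
      · obtain ⟨⟨t1, ht1, hs1⟩, -⟩ := D.glued_side e he
        exact hT.notMem_interior (D.sub ht1) ht'T hs1 (openSeg_subset_seg _ hz1) hz
    obtain ⟨F', g', M'⟩ := M.insert ht' hd1 hd2
    exact ⟨_, F', g', M'⟩

lemma Disc.single {t : Finset ℂ} {c : ℂ} (htT : t ∈ T) (ht : IsTri t a b c) :
    Disc H T a b {t} ∅ [a, b, c, a] := by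
  have hO : discOpen {t} ∅ = interior (body t) := by ext z; simp [discOpen]
  have hp : pairs [a, b, c, a] = [(a, b), (b, c), (c, a)] := rfl
  have h1 := ht.ne
  have h2 := ht.rot.ne
  have h3 := ht.rot.rot.ne
  refine ⟨by simpa using htT, rfl, rfl, fun _ => ⟨_, rfl⟩, ?_, ?_, ?_, by simp, by simp, by simp,
    ?_, ?_, ?_⟩
  · rw [hp]; simp [h1, h2, h3, h3.symm]
  · intro e he
    rw [hp] at he
    simp only [List.mem_cons, List.not_mem_nil, or_false] at he
    refine ⟨t, Finset.mem_singleton_self t, ?_⟩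
    rcases he with rfl | rfl | rfl
    · exact ht.side
    · exact ht.rot.side
    · exact ht.rot.rot.side
  · intro t' ht' x y hxy
    rw [Finset.mem_singleton.1 ht'] at hxy
    left
    rw [hp]
    rcases ht.side_cases hxy with ⟨rfl, rfl⟩ | ⟨rfl, rfl⟩ | ⟨rfl, rfl⟩ <;> simp
  · rw [hO]
    intro u hu v hv
    exact Relation.ReflTransGen.single ((convex_body t).interior.segment_subset hu hv)
  · intro z hz
    rw [hp, ht.asum (hz t htT), Finset.sum_singleton]
  · obtain ⟨F, g, M⟩ := exists_model_tri ht
    rw [hO]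
    exact ⟨3, F, g, M⟩

/-- Every triangle of `R` belongs to a disc of triangles of `R` that cannot be extended within
`R`. -/
lemma exists_saturated_disc (hT : VertexTriangulation H T) {R : Finset (Finset ℂ)} (hR : R ⊆ T)
    {t : Finset ℂ} (ht : t ∈ R) (hs : IsSide t a b) :
    ∃ S Γ V, Disc H T a b S Γ V ∧ S ⊆ R ∧ t ∈ S ∧
      ∀ x y, (x, y) ∈ pairs V → openSeg (x, y) ⊆ inner H → ∀ t' ∈ R, ¬ IsSide t' y x := by
  have key : ∀ n : ℕ, ∀ S Γ V, Disc H T a b S Γ V → S ⊆ R → t ∈ S → R.card - S.card ≤ n →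
      ∃ S Γ V, Disc H T a b S Γ V ∧ S ⊆ R ∧ t ∈ S ∧
      ∀ x y, (x, y) ∈ pairs V → openSeg (x, y) ⊆ inner H → ∀ t' ∈ R, ¬ IsSide t' y x := by
    intro n
    induction n with
    | zero =>
      intro S Γ V D hSR htS hn
      have hSR' : S = R := Finset.eq_of_subset_of_card_le hSR (by omega)
      refine ⟨S, Γ, V, D, hSR, htS, ?_⟩
      intro x y hxy hin t' ht' hs'
      exact D.notMem_of_side hT hxy hin hs' (hSR' ▸ ht')
    | succ n ih =>
      intro S Γ V D hSR htS hn
      by_cases hsat : ∀ x y, (x, y) ∈ pairs V → openSeg (x, y) ⊆ inner H →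
          ∀ t' ∈ R, ¬ IsSide t' y x
      · exact ⟨S, Γ, V, D, hSR, htS, hsat⟩
      push Not at hsat
      obtain ⟨x, y, hxy, hin, t', ht', c, hc⟩ := hsat
      obtain ⟨A, B, rfl⟩ := mem_pairs hxy
      have hnew := D.notMem_of_side hT hxy hin ⟨c, hc⟩
      have hsub : insert t' S ⊆ R := Finset.insert_subset ht' hSR
      refine ih _ _ _ (D.insert hT hin (hR ht') hc) hsub
        (Finset.mem_insert_of_mem htS) ?_
      have := Finset.card_le_card hsub
      rw [Finset.card_insert_of_notMem hnew] at this ⊢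
      omega
  obtain ⟨c, hc⟩ := hs
  exact key _ {t} ∅ _ (Disc.single (hR ht) hc) (by simpa using ht) (Finset.mem_singleton_self t)
    le_rfl

end

/-! ### Approximation of boundary walks by simple closed curves -/

/-- The closed polygon `l` is a uniform limit of simple closed curves in `O`. -/
def NearbyLoop (O : Set ℂ) (l : List ℂ) : Prop :=
  ∀ ε : ℝ, 0 < ε → ∃ γ : ℝ → ℂ, Continuous γ ∧ (∀ t, γ (t + (l.length : ℝ)) = γ t) ∧
    (∀ s t, s ∈ Set.Ico (0 : ℝ) l.length → t ∈ Set.Ico (0 : ℝ) l.length → γ s = γ t → s = t) ∧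
    (∀ t, t ∈ Set.Ico (0 : ℝ) l.length → dist (γ t) (curve l t) < ε) ∧
    ∀ t, t ∈ Set.Ico (0 : ℝ) l.length → γ t ∈ O

lemma nearlySimple_of_disjoint {L : List (List ℂ)} (O : Fin L.length → Set ℂ)
    (hO : ∀ i j, i ≠ j → Disjoint (O i) (O j)) (h : ∀ i, NearbyLoop (O i) (L.get i)) :
    NearlySimple L := by
  intro ε hε
  choose γ h1 h2 h3 h4 h5 using fun i => h i ε hε
  refine ⟨γ, h1, h2, ?_, h4⟩
  intro i j s t hs ht heq
  have hij : i = j := by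
    by_contra hne
    exact Set.disjoint_left.1 (hO i j hne) (h5 i s hs) (heq ▸ h5 j t ht)
  subst hij
  exact ⟨rfl, h3 i s t hs ht heq⟩

lemma exists_periodic {n : ℕ} (hn : 0 < n) {γ : ℝ → ℂ} (hγ : Continuous γ) (h0 : γ 0 = γ n) :
    ∃ γ' : ℝ → ℂ, Continuous γ' ∧ (∀ t, γ' (t + n) = γ' t) ∧
      ∀ t, t ∈ Set.Ico (0 : ℝ) n → γ' t = γ t := by
  have hn' : (0 : ℝ) < n := by exact_mod_cast hn
  refine ⟨fun t => γ (n * Int.fract (t / n)), ?_, ?_, ?_⟩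
  · have h1 : Continuous ((fun s : ℝ => γ (n * s)) ∘ Int.fract) := by
      apply ContinuousOn.comp_fract''
      · exact (hγ.comp (continuous_const.mul continuous_id)).continuousOn
      · simpa using h0
    exact h1.comp (continuous_id.div_const _)
  · intro t
    simp only
    rw [add_div, div_self hn'.ne', Int.fract_add_one]
  · intro t ht
    simp only
    rw [Int.fract_eq_self.2 ⟨div_nonneg ht.1 hn'.le, (div_lt_one hn').2 ht.2⟩,
      mul_div_cancel₀ _ hn'.ne']

lemma exists_eq_of_closed {V : List ℂ} {a : ℂ} (h1 : V.head? = some a) (h2 : V.getLast? = some a)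
    (h3 : 2 ≤ V.length) : ∃ l, V = a :: (l ++ [a]) := by
  cases V with
  | nil => simp at h1
  | cons b W =>
    simp only [List.head?_cons, Option.some.injEq] at h1
    subst h1
    have hW : W ≠ [] := by
      rintro rfl; simp at h3
    refine ⟨W.dropLast, ?_⟩
    congr 1
    have h4 : W.getLast hW = b := by
      have h5 := List.getLast?_cons (a := b) (l := W)
      rw [h5, List.getLast?_eq_some_getLast hW] at h2
      simpa using h2
    conv_lhs => rw [← List.dropLast_append_getLast hW, h4]

lemma edges_dropLast {V : List ℂ} {a : ℂ} (h1 : V.head? = some a) (h2 : V.getLast? = some a)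
    (h3 : 2 ≤ V.length) : edges V.dropLast = pairs V := by
  obtain ⟨l, rfl⟩ := exists_eq_of_closed h1 h2 h3
  have : (a :: (l ++ [a])).dropLast = a :: l := by
    rw [← List.cons_append, List.dropLast_concat]
  rw [this, edges_cons]

lemma curve_dropLast {V : List ℂ} {a : ℂ} (h1 : V.head? = some a) (h2 : V.getLast? = some a)
    (h3 : 2 ≤ V.length) {t : ℝ} (ht0 : 0 ≤ t) (ht : t < (V.dropLast.length : ℝ)) :
    curve V.dropLast t = V.getD ⌊t⌋₊ 0 +
      (t - ⌊t⌋₊) • (V.getD (⌊t⌋₊ + 1) 0 - V.getD ⌊t⌋₊ 0) := by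
  obtain ⟨l, rfl⟩ := exists_eq_of_closed h1 h2 h3
  have hd : (a :: (l ++ [a])).dropLast = a :: l := by
    rw [← List.cons_append, List.dropLast_concat]
  rw [hd] at ht ⊢
  have hk : ⌊t⌋₊ < (a :: l).length := (Nat.floor_lt ht0).2 ht
  have hfr : Int.fract t = t - ⌊t⌋₊ := by
    rw [Int.fract, ← natCast_floor_eq_intCast_floor ht0]
  have hg : ∀ i, i < (a :: l).length → (a :: (l ++ [a])).getD i 0 = (a :: l).getD i 0 := by
    intro i hi
    rw [← List.cons_append, List.getD_append _ _ _ _ hi]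
  unfold curve
  rw [Nat.mod_eq_of_lt hk, hfr, AffineMap.lineMap_apply_module', add_comm, hg _ hk]
  congr 3
  rcases Nat.lt_or_ge (⌊t⌋₊ + 1) (a :: l).length with h | h
  · rw [Nat.mod_eq_of_lt h, hg _ h]
  · have he : ⌊t⌋₊ + 1 = (a :: l).length := by omega
    rw [he, Nat.mod_self, ← List.cons_append]
    have := getD_append_length (a :: l) [a] 0
    rw [add_zero] at this
    rw [this]; rfl

/-- Uniform continuity of a model near the boundary. -/
lemma Model.uniform {O : Set ℂ} {V : List ℂ} {n : ℕ} {F : ℝ → ℝ → ℂ} {g : ℝ → ℝ}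
    (M : Model O V n F g) {ε : ℝ} (hε : 0 < ε) :
    ∃ r, 0 < r ∧ r < 1 ∧ ∀ θ θ' h : ℝ, 0 ≤ θ → θ ≤ n → 0 ≤ θ' → θ' ≤ n → |θ - θ'| ≤ r → 0 ≤ h →
      h ≤ r → dist (F θ (g θ + h)) (F θ' (g θ')) < ε := by
  have hg := M.contg
  have hc : Continuous fun p : ℝ × ℝ => F p.1 (g p.1 + p.2) :=
    M.contF.comp (f := fun p : ℝ × ℝ => (p.1, g p.1 + p.2)) (by fun_prop)
  have hK : IsCompact (Set.Icc (0 : ℝ) n ×ˢ Set.Icc (0 : ℝ) 1) := isCompact_Icc.prod isCompact_Icc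
  obtain ⟨δ, hδ, hu⟩ := Metric.uniformContinuousOn_iff.1
    (hK.uniformContinuousOn_of_continuous hc.continuousOn) ε hε
  refine ⟨min (δ / 2) (1 / 2), by positivity, ?_, ?_⟩
  · exact (min_le_right _ _).trans_lt (by norm_num)
  · intro θ θ' h a1 a2 a3 a4 a5 a6 a7
    have b1 := a5.trans (min_le_left _ _)
    have b2 := a7.trans (min_le_left _ _)
    have b3 := a7.trans (min_le_right _ _)
    have := hu (θ, h) ⟨⟨a1, a2⟩, a6, by linarith⟩ (θ', 0) ⟨⟨a3, a4⟩, le_rfl, by norm_num⟩ (by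
      rw [Prod.dist_eq, max_lt_iff]
      simp only [Real.dist_eq, sub_zero, abs_of_nonneg a6]
      constructor <;> linarith)
    simpa using this

lemma Model.bdry_floor {O : Set ℂ} {V : List ℂ} {n : ℕ} {F : ℝ → ℝ → ℂ} {g : ℝ → ℝ}
    (M : Model O V n F g) (i : ℕ) {t : ℝ} (h0 : 0 ≤ t) (h1 : t + i < n) :
    F (t + i) (g (t + i)) = V.getD (⌊t⌋₊ + i) 0 +
      (t - ⌊t⌋₊) • (V.getD (⌊t⌋₊ + i + 1) 0 - V.getD (⌊t⌋₊ + i) 0) := by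
  have hk : ⌊t⌋₊ + i < n := by
    have : ((⌊t⌋₊ + i : ℕ) : ℝ) < n := by
      push_cast
      have := Nat.floor_le h0
      linarith
    exact_mod_cast this
  have := M.bdry (⌊t⌋₊ + i) hk (t - ⌊t⌋₊) (by linarith [Nat.floor_le h0])
    (by linarith [Nat.lt_floor_add_one t])
  have e : ((⌊t⌋₊ + i : ℕ) : ℝ) + (t - ⌊t⌋₊) = t + i := by push_cast; ring
  rw [e] at this
  exact this

/-- The boundary walk of a disc is a limit of simple closed curves in the interior of the disc. -/
lemma Model.nearbyLoop {O : Set ℂ} {V : List ℂ} {n : ℕ} {F : ℝ → ℝ → ℂ} {g : ℝ → ℝ}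
    (M : Model O V n F g) {a : ℂ} (h1 : V.head? = some a) (h2 : V.getLast? = some a)
    (hn : 0 < n) : NearbyLoop O V.dropLast := by
  intro ε hε
  obtain ⟨r, hr0, hr1, hr⟩ := M.uniform hε
  have hlen : V.dropLast.length = n := by rw [List.length_dropLast, M.length]; rfl
  rw [hlen]
  have hg := M.contg
  have hc : Continuous fun t : ℝ => F t (g t + r) :=
    M.contF.comp (f := fun t : ℝ => (t, g t + r)) (by fun_prop)
  obtain ⟨γ, c1, c2, c3⟩ := exists_periodic hn hc (by rw [← M.g_per, M.F_per])
  refine ⟨γ, c1, c2, ?_, ?_, ?_⟩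
  · intro s t hs ht heq
    rw [c3 s hs, c3 t ht] at heq
    have := M.nonpos s
    have := M.nonpos t
    exact (M.inj s t hs.1 hs.2 ht.1 ht.2 _ _ (by linarith) (by linarith) (by linarith)
      (by linarith) heq).1
  · intro t ht
    rw [c3 t ht, curve_dropLast h1 h2 (by rw [M.length]; omega) ht.1 (by rw [hlen]; exact ht.2)]
    have := M.bdry_floor 0 ht.1 (by simpa using ht.2)
    simp only [Nat.cast_zero, add_zero] at this
    rw [← this]
    exact hr t t r ht.1 ht.2.le ht.1 ht.2.le (by simpa using hr0.le) hr0.le le_rfl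
  · intro t ht
    rw [c3 t ht]
    have := M.nonpos t
    exact M.mem t ht.1 ht.2 _ (by linarith) (by linarith)

/-- If the boundary walk of a disc contains both sides of a cut edge `q p`, separated by a
closed walk `U` from `p` to `p`, then `U` is a limit of simple closed curves: these run through the
interior of the disc and cross the cut edge near `p`. -/
lemma Model.nearbyLoop_cut {O : Set ℂ} {U W : List ℂ} {p q : ℂ} {n : ℕ} {F : ℝ → ℝ → ℂ}
    {g : ℝ → ℝ} (M : Model O (q :: (U ++ q :: W)) n F g) (h1 : U.head? = some p)
    (h2 : U.getLast? = some p) (h3 : 2 ≤ U.length) (hcut : Disjoint (openSeg (q, p)) O) :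
    NearbyLoop (O ∪ openSeg (q, p)) U.dropLast := by
  intro ε hε
  obtain ⟨r, hr0, hr1, hr⟩ := M.uniform hε
  obtain ⟨l, hl⟩ := exists_eq_of_closed h1 h2 h3
  set m := l.length + 1 with hm
  have hUlen : U.length = m + 1 := by rw [hl]; simp [hm]
  have hlen : U.dropLast.length = m := by rw [List.length_dropLast, hUlen]; rfl
  rw [hlen]
  have hn : m + 2 ≤ n := by
    have := M.length
    simp only [List.length_cons, List.length_append, hUlen] at this
    omega
  have hnR : (m : ℝ) + 2 ≤ n := by exact_mod_cast hn
  have hm0 : (0 : ℝ) < m := by rw [hm]; positivity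
  have hm1 : (1 : ℝ) ≤ m := by rw [hm]; push_cast; linarith [Nat.cast_nonneg (α := ℝ) l.length]
  have v0 : (q :: (U ++ q :: W)).getD 0 0 = q := rfl
  have vi : ∀ i, i < m + 1 → (q :: (U ++ q :: W)).getD (i + 1) 0 = U.getD i 0 := by
    intro i hi
    rw [List.getD_cons_succ, List.getD_append _ _ _ _ (by omega)]
  have vm : (q :: (U ++ q :: W)).getD (m + 2) 0 = q := by
    rw [List.getD_cons_succ, ← hUlen]
    exact getD_append_length U (q :: W) 0
  have u0 : U.getD 0 0 = p := by rw [hl]; rfl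
  have um : U.getD m 0 = p := by
    rw [hl, ← List.cons_append]
    exact getD_append_length (p :: l) [p] 0
  have hg := M.contg
  -- `γ₀` follows the boundary walk at time `ψ` and height `η` above the boundary; it starts and ends at
  -- height `0` on the cut edge, at distance `r` times its length from `p`
  let ψ : ℝ → ℝ := fun t => 1 - r + t * (1 + 2 * r / m)
  let η : ℝ → ℝ := fun t => r * (t * (m - t) / (m * m))
  let γ₀ : ℝ → ℂ := fun t => F (ψ t) (g (ψ t) + η t)
  have hψ : Continuous ψ := by simp only [ψ]; fun_prop
  have hη : Continuous η := by simp only [η]; fun_prop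
  have hc : Continuous γ₀ := M.contF.comp (f := fun t : ℝ => (ψ t, g (ψ t) + η t)) (by fun_prop)
  have hcut0 : γ₀ 0 = q + (1 - r) • (p - q) := by
    have := M.bdry 0 (by omega) (1 - r) (by linarith) (by linarith)
    simp only [Nat.cast_zero, zero_add] at this
    rw [v0, vi 0 (by omega), u0] at this
    rw [← this]
    simp [γ₀, ψ, η]
  have hcutm : γ₀ m = q + (1 - r) • (p - q) := by
    have := M.bdry (m + 1) (by omega) r hr0.le hr1.le
    rw [vi m (by omega), vm, um] at this
    have e1 : ψ m = ((m + 1 : ℕ) : ℝ) + r := by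
      simp only [ψ]; push_cast; field_simp; ring
    have e2 : η m = 0 := by simp [η]
    simp only [γ₀]
    rw [e1, e2, add_zero, this]
    simp only [Complex.real_smul]; push_cast; ring
  have hcutmem : γ₀ 0 ∈ openSeg (q, p) := by
    rw [hcut0]; exact mem_openSeg.2 ⟨1 - r, by linarith, by linarith, rfl⟩
  have hψmono : ∀ t : ℝ, 0 ≤ t → t ≤ m → 0 ≤ t * (2 * r / m) ∧ t * (2 * r / m) ≤ 2 * r := by
    intro t h0 h1
    refine ⟨by positivity, ?_⟩
    have : t * (2 * r / m) = (t / m) * (2 * r) := by ring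
    rw [this]
    have : t / m ≤ 1 := (div_le_one hm0).2 h1
    nlinarith
  have hψr : ∀ t : ℝ, 0 ≤ t → t ≤ m → 0 ≤ ψ t ∧ ψ t < n ∧ |ψ t - (t + 1)| ≤ r := by
    intro t h0 h1
    obtain ⟨a1, a2⟩ := hψmono t h0 h1
    have : ψ t = 1 - r + t + t * (2 * r / m) := by simp only [ψ]; ring
    rw [this]
    refine ⟨by linarith, by linarith, ?_⟩
    rw [abs_le]; constructor <;> linarith
  have hηr : ∀ t : ℝ, 0 ≤ t → t ≤ m → 0 ≤ η t ∧ η t ≤ r := by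
    intro t h0 h1
    have h3 : 0 ≤ t * (m - t) := mul_nonneg h0 (by linarith)
    have h4 : t * (m - t) / (m * m) ≤ 1 := by
      rw [div_le_one (by positivity)]; nlinarith
    have h5 : 0 ≤ t * (m - t) / (m * m) := by positivity
    simp only [η]
    constructor
    · positivity
    · nlinarith
  have hηpos : ∀ t : ℝ, 0 < t → t < m → 0 < η t := by
    intro t h0 h1
    have h3 : 0 < t * (m - t) := mul_pos h0 (by linarith)
    simp only [η]; positivity
  have hmem : ∀ t : ℝ, 0 < t → t < m → γ₀ t ∈ O := by
    intro t h0 h1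
    have := M.nonpos (ψ t)
    have := hηpos t h0 h1
    have := hηr t h0.le h1.le
    obtain ⟨a1, a2, -⟩ := hψr t h0.le h1.le
    exact M.mem _ a1 a2 _ (by linarith) (by linarith)
  obtain ⟨γ, c1, c2, c3⟩ := exists_periodic (by omega : 0 < m) hc (hcut0.trans hcutm.symm)
  refine ⟨γ, c1, c2, ?_, ?_, ?_⟩
  · intro s t hs ht heq
    rw [c3 s hs, c3 t ht] at heq
    rcases hs.1.eq_or_lt with e | hs0 <;> rcases ht.1.eq_or_lt with e' | ht0
    · rw [← e, ← e']
    · exfalso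
      rw [← e] at heq
      exact Set.disjoint_left.1 hcut hcutmem (heq ▸ hmem t ht0 ht.2)
    · exfalso
      rw [← e'] at heq
      exact Set.disjoint_left.1 hcut hcutmem (heq ▸ hmem s hs0 hs.2)
    · have := M.nonpos (ψ s)
      have := M.nonpos (ψ t)
      have := hηpos t ht0 ht.2
      have := hηpos s hs0 hs.2
      have := hηr t ht.1 ht.2.le
      have := hηr s hs.1 hs.2.le
      obtain ⟨a1, a2, -⟩ := hψr t ht.1 ht.2.le
      obtain ⟨b1, b2, -⟩ := hψr s hs.1 hs.2.le
      have h5 := (M.inj _ _ b1 b2 a1 a2 _ _ (by linarith) (by linarith) (by linarith)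
        (by linarith) heq).1
      simp only [ψ] at h5
      have h6 : (0 : ℝ) < 1 + 2 * r / m := by positivity
      exact mul_right_cancel₀ h6.ne' (by linarith)
  · intro t ht
    rw [c3 t ht, curve_dropLast h1 h2 h3 ht.1 (by rw [hlen]; exact ht.2)]
    have hk : ⌊t⌋₊ < m := (Nat.floor_lt ht.1).2 ht.2
    have := M.bdry_floor 1 ht.1 (by push_cast; linarith [ht.2])
    rw [vi _ (by omega), vi _ (by omega)] at this
    rw [← this]
    obtain ⟨a1, a2, a3⟩ := hψr t ht.1 ht.2.le
    obtain ⟨a4, a5⟩ := hηr t ht.1 ht.2.le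
    push_cast
    exact hr _ _ _ a1 a2.le (by linarith [ht.1]) (by linarith [ht.2]) a3 a4 a5
  · intro t ht
    rw [c3 t ht]
    rcases ht.1.eq_or_lt with e | ht0
    · rw [← e]; exact Or.inr hcutmem
    · exact Or.inl (hmem t ht0 ht.2)


/-! ### The sliced donut -/

/-- The sides of the rectangle and both directions of the cut edge; these are the edges of the
sliced donut that are not reversed edges of `P`. -/
def frame (P : List ℂ) (B : Box) : List (ℂ × ℂ) :=
  [(B.q₁, B.q₂), (B.q₂, B.q₃), (B.q₃, B.q₄), (B.q₄, B.q₁), (B.q₁, P.headI), (P.headI, B.q₁)]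

lemma edges_donut {P : List ℂ} (hP : P ≠ []) (B : Box) :
    (edges (donut P B)).Perm (frame P B ++ (edges P).map Prod.swap) := by
  obtain ⟨p, l, rfl⟩ := List.exists_cons_of_ne_nil hP
  have h1 : edges (donut (p :: l) B) = (B.q₁, B.q₂) :: (B.q₂, B.q₃) :: (B.q₃, B.q₄) ::
      (B.q₄, B.q₁) :: (B.q₁, p) :: (((edges (p :: l)).map Prod.swap).reverse ++ [(p, B.q₁)]) := by
    have h2 : donut (p :: l) B = B.q₁ :: ([B.q₂, B.q₃, B.q₄, B.q₁] ++ (p :: l.reverse) ++ [p]) := by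
      simp [donut]
    rw [h2, edges_cons, edges_cons, ← pairs_reverse]
    have h3 : pairs ((p :: l.reverse) ++ p :: [B.q₁]) =
        pairs ((p :: l.reverse) ++ [p]) ++ pairs [p, B.q₁] := pairs_append _ _ _
    have h4 : (p :: (l ++ [p])).reverse = p :: l.reverse ++ [p] := by simp
    rw [h4]
    have h5 : [B.q₂, B.q₃, B.q₄, B.q₁] ++ (p :: l.reverse) ++ [p] ++ [B.q₁] =
        B.q₂ :: B.q₃ :: B.q₄ :: B.q₁ :: ((p :: l.reverse) ++ p :: [B.q₁]) := by simp
    rw [h5, List.cons_append]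
    simp only [pairs_cons]
    rw [← List.cons_append, h3, pairs_cons, pairs_single]
  rw [h1]
  simp only [frame, List.headI_cons, List.cons_append, List.nil_append]
  refine List.Perm.cons _ (List.Perm.cons _ (List.Perm.cons _ (List.Perm.cons _
    (List.Perm.cons _ ?_))))
  refine (List.perm_append_comm).trans ?_
  rw [List.singleton_append]
  exact List.Perm.cons _ (List.reverse_perm _)

lemma mem_edges_donut {P : List ℂ} (hP : P ≠ []) {B : Box} {x y : ℂ} :
    (x, y) ∈ edges (donut P B) ↔ (x, y) ∈ frame P B ∨ (y, x) ∈ edges P := by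
  rw [(edges_donut hP B).mem_iff, List.mem_append]
  apply or_congr_right
  rw [List.mem_map]
  constructor
  · rintro ⟨⟨u, v⟩, h, he⟩
    simp only [Prod.swap_prod_mk, Prod.mk.injEq] at he
    obtain ⟨rfl, rfl⟩ := he
    exact h
  · intro h; exact ⟨_, h, rfl⟩

lemma asum_map_swap {es : List (ℂ × ℂ)} {z : ℂ} (h : ∀ e ∈ es, z ∉ seg e) :
    asum (es.map Prod.swap) z = -asum es z := by
  induction es with
  | nil => simp [asum_nil]
  | cons e es ih =>
    rw [List.map_cons, asum_cons, asum_cons, ang_swap (h e List.mem_cons_self),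
      ih fun f hf => h f (List.mem_cons_of_mem _ hf)]
    ring

lemma IsInput.ne_nil {P : List ℂ} (hP : IsInput P) : P ≠ [] :=
  hP.weaklySimple.nonempty P List.mem_cons_self

lemma headI_mem {P : List ℂ} (hP : P ≠ []) : P.headI ∈ P := by
  obtain ⟨p, l, rfl⟩ := List.exists_cons_of_ne_nil hP
  simp

lemma IsInput.head_mem {P : List ℂ} (hP : IsInput P) : P.headI ∈ P := headI_mem hP.ne_nil

lemma IsInput.im_le {P : List ℂ} (hP : IsInput P) {v : ℂ} (hv : v ∈ P) : v.im ≤ P.headI.im := by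
  by_cases h : v = P.headI
  · rw [h]
  · exact (hP.topmost v hv h).le

lemma bdry_solid (P : List ℂ) : (solid P).bdry = edges P := by
  simp [solid, HoledPolygon.bdry, HoledPolygon.cycles]

lemma winding_solid (P : List ℂ) (z : ℂ) : (solid P).winding z = winding P z := by
  simp [solid, HoledPolygon.winding, HoledPolygon.cycles]

lemma trace_solid (P : List ℂ) : (solid P).trace = trace P := by
  unfold HoledPolygon.trace trace; rw [bdry_solid]

lemma IsInput.asum_cases {P : List ℂ} (hP : IsInput P) {z : ℂ} (hz : z ∉ trace P) :
    asum (edges P) z = 0 ∨ asum (edges P) z = -(2 * Real.pi) := by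
  have hpi := Real.pi_pos
  rcases hP.weaklySimple.outer_clockwise z hz with h | h
  · left
    rw [show (solid P).outer = P from rfl, winding_eq, div_eq_zero_iff] at h
    rcases h with h | h
    · exact h
    · linarith
  · right
    rw [show (solid P).outer = P from rfl, winding_eq, div_eq_iff (by positivity)] at h
    linarith

/-- A closed chain of edges in an open rectangle does not wind around points outside of it. -/
lemma Box.asum_eq_zero (B : Box) {es : List (ℂ × ℂ)} (hes : IsCycle es)
    (h : ∀ e ∈ es, e.1 ∈ B.inside ∧ e.2 ∈ B.inside) {z : ℂ} (hz : z ∉ B.inside) :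
    asum es z = 0 := by
  have hz' : z.re ≤ B.left ∨ B.right ≤ z.re ∨ z.im ≤ B.bottom ∨ B.top ≤ z.im := by
    by_contra hc
    push Not at hc
    exact hz hc
  have key : ∀ n : ℂ, (∀ v ∈ B.inside, 0 < ((starRingEnd ℂ) n * (v - z)).re) → asum es z = 0 :=
    fun n hn => ShortcutHull.asum_eq_zero hes (n := n)
      fun e he => ⟨hn _ (h e he).1, hn _ (h e he).2⟩
  rcases hz' with hz | hz | hz | hz
  · apply key 1
    rintro v ⟨h1, h2, h3, h4⟩
    simp; linarith
  · apply key (-1)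
    rintro v ⟨h1, h2, h3, h4⟩
    simp; linarith
  · apply key Complex.I
    rintro v ⟨h1, h2, h3, h4⟩
    simp; linarith
  · apply key (-Complex.I)
    rintro v ⟨h1, h2, h3, h4⟩
    simp; linarith

/-- A closed chain of edges between vertices of `P` does not wind around points above `P`. -/
lemma IsInput.asum_above {P : List ℂ} (hP : IsInput P) {es : List (ℂ × ℂ)} (hes : IsCycle es)
    (h : ∀ e ∈ es, e.1 ∈ P ∧ e.2 ∈ P) {z : ℂ} (hz : P.headI.im < z.im) : asum es z = 0 := by
  apply asum_eq_zero hes (n := -Complex.I)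
  intro e he
  have h1 := hP.im_le (h e he).1
  have h2 := hP.im_le (h e he).2
  simp; constructor <;> linarith

lemma im_le_of_mem_seg {e : ℂ × ℂ} {z : ℂ} {m : ℝ} (h : z ∈ seg e) (h1 : e.1.im ≤ m)
    (h2 : e.2.im ≤ m) : z.im ≤ m := by
  obtain ⟨s, h3, h4, rfl⟩ := mem_seg.1 h
  simp
  nlinarith

lemma IsInput.im_le_of_mem_trace {P : List ℂ} (hP : IsInput P) {z : ℂ} (hz : z ∈ trace P) :
    z.im ≤ P.headI.im := by
  obtain ⟨e, he, hz⟩ := hz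
  exact im_le_of_mem_seg hz (hP.im_le (mem_of_mem_edges he).1) (hP.im_le (mem_of_mem_edges he).2)

lemma IsContainingBox.mem_inside {P : List ℂ} {B : Box} (hB : IsContainingBox P B) {v : ℂ}
    (hv : v ∈ P) : v ∈ B.inside := hB.mem v hv

lemma IsContainingBox.lt {P : List ℂ} {B : Box} (hB : IsContainingBox P B) (hP : P ≠ []) :
    B.left < B.right ∧ B.bottom < B.top := by
  obtain ⟨h1, h2, h3, h4⟩ := hB.mem _ (headI_mem hP)
  exact ⟨h1.trans h2, h3.trans h4⟩

lemma Box.q₁_notMem (B : Box) : B.q₁ ∉ B.inside := fun h => lt_irrefl _ h.1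
lemma Box.q₂_notMem (B : Box) : B.q₂ ∉ B.inside := fun h => lt_irrefl _ h.2.1
lemma Box.q₃_notMem (B : Box) : B.q₃ ∉ B.inside := fun h => lt_irrefl _ h.2.1
lemma Box.q₄_notMem (B : Box) : B.q₄ ∉ B.inside := fun h => lt_irrefl _ h.1

lemma IsContainingBox.seg_subset {P : List ℂ} {B : Box} (hB : IsContainingBox P B) {e : ℂ × ℂ}
    (h : e.1 ∈ P ∧ e.2 ∈ P) : seg e ⊆ B.inside :=
  B.convex_inside.segment_subset (hB.mem_inside h.1) (hB.mem_inside h.2)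

lemma IsContainingBox.trace_subset {P : List ℂ} {B : Box} (hB : IsContainingBox P B) :
    trace P ⊆ B.inside := by
  rintro z ⟨e, he, hz⟩
  exact hB.seg_subset (mem_of_mem_edges he) hz

/-- The points of the cut edge other than `p₁` lie above `P`. -/
lemma IsContainingBox.cut_im {P : List ℂ} {B : Box} (hB : IsContainingBox P B) (hP : P ≠ [])
    {z : ℂ} (hz : z ∈ openSeg (B.q₁, P.headI)) : P.headI.im < z.im ∧ z ∈ B.inside := by
  obtain ⟨h1, h2, h3, h4⟩ := hB.mem _ (headI_mem hP)
  obtain ⟨s, hs0, hs1, rfl⟩ := mem_openSeg.1 hz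
  simp only [Box.q₁, Box.inside, Set.mem_ofPred_eq, Complex.add_re, Complex.add_im,
    Complex.real_smul, Complex.re_ofReal_mul, Complex.im_ofReal_mul, Complex.sub_re,
    Complex.sub_im]
  refine ⟨?_, ?_, ?_, ?_, ?_⟩ <;> nlinarith

lemma mem_frame {P : List ℂ} {B : Box} {e : ℂ × ℂ} : e ∈ frame P B ↔ e.swap ∈ B.ccw ∨
    e = (B.q₁, P.headI) ∨ e = (P.headI, B.q₁) := by
  obtain ⟨x, y⟩ := e
  simp only [frame, Box.ccw, List.mem_cons, List.not_mem_nil, or_false, Prod.swap_prod_mk,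
    Prod.mk.injEq]
  tauto

/-- Every edge of the frame has an endpoint at a corner of the rectangle. -/
lemma IsContainingBox.frame_notMem {P : List ℂ} {B : Box} (hB : IsContainingBox P B) {e : ℂ × ℂ}
    (he : e ∈ frame P B) : ¬ (e.1 ∈ P ∧ e.2 ∈ P) := by
  rintro ⟨h1, h2⟩
  have h1 := hB.mem_inside h1
  have h2 := hB.mem_inside h2
  simp only [frame, List.mem_cons, List.not_mem_nil, or_false] at he
  rcases he with rfl | rfl | rfl | rfl | rfl | rfl
  · exact B.q₁_notMem h1
  · exact B.q₂_notMem h1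
  · exact B.q₃_notMem h1
  · exact B.q₄_notMem h1
  · exact B.q₁_notMem h1
  · exact B.q₁_notMem h2

/-- The edges of the frame do not pass through points of `P`, except for the point `p₁`. -/
lemma frame_disjoint {P : List ℂ} (hP : IsInput P) {B : Box} (hB : IsContainingBox P B)
    {e : ℂ × ℂ} (he : e ∈ frame P B) {z : ℂ} (hz : z ∈ openSeg e) (hzt : z ∈ trace P) : False := by
  have hin := hB.trace_subset hzt
  have hcut : z ∈ openSeg (B.q₁, P.headI) → False := fun h => by
    have := (hB.cut_im hP.ne_nil h).1
    have := hP.im_le_of_mem_trace hzt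
    linarith
  rcases mem_frame.1 he with h | rfl | rfl
  · refine B.off_ccw z hin _ h ?_
    rw [Prod.swap, seg_swap]; exact openSeg_subset_seg _ hz
  · exact hcut hz
  · exact hcut (by rw [openSeg_swap]; exact hz)

lemma Box.strictly_outside (B : Box) {z : ℂ} (hz : z ∉ B.inside) (h : B.left < B.right)
    (h' : B.bottom < B.top) (hoff : ∀ e ∈ B.ccw, z ∉ seg e) :
    z.re < B.left ∨ B.right < z.re ∨ z.im < B.bottom ∨ B.top < z.im := by
  by_contra hc
  push Not at hc
  obtain ⟨h1, h2, h3, h4⟩ := hc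
  have hv : ∀ a b : ℂ, a.re = b.re → b.im < a.im → z.re = a.re → b.im ≤ z.im → z.im ≤ a.im →
      z ∈ seg (a, b) := by
    intro a b e1 e2 e3 e4 e5
    refine mem_seg.2 ⟨(a.im - z.im) / (a.im - b.im), div_nonneg (by linarith) (by linarith),
      (div_le_one (by linarith)).2 (by linarith), ?_⟩
    have : a.im - b.im ≠ 0 := by linarith
    apply Complex.ext
    · simp only [Complex.add_re, Complex.real_smul, Complex.re_ofReal_mul, Complex.sub_re, e1, e3]
      ring
    · simp only [Complex.add_im, Complex.real_smul, Complex.im_ofReal_mul, Complex.sub_im]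
      field_simp; ring
  have hh : ∀ a b : ℂ, a.im = b.im → b.re < a.re → z.im = a.im → b.re ≤ z.re → z.re ≤ a.re →
      z ∈ seg (a, b) := by
    intro a b e1 e2 e3 e4 e5
    refine mem_seg.2 ⟨(a.re - z.re) / (a.re - b.re), div_nonneg (by linarith) (by linarith),
      (div_le_one (by linarith)).2 (by linarith), ?_⟩
    have : a.re - b.re ≠ 0 := by linarith
    apply Complex.ext
    · simp only [Complex.add_re, Complex.real_smul, Complex.re_ofReal_mul, Complex.sub_re]
      field_simp; ring
    · simp only [Complex.add_im, Complex.real_smul, Complex.im_ofReal_mul, Complex.sub_im, e1, e3]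
      ring
  by_cases e1 : z.re = B.left
  · exact hoff (B.q₁, B.q₄) (by simp [Box.ccw]) (hv _ _ rfl h' e1 h3 h4)
  by_cases e2 : z.re = B.right
  · refine hoff (B.q₃, B.q₂) (by simp [Box.ccw]) ?_
    rw [seg_swap]; exact hv _ _ rfl h' e2 h3 h4
  by_cases e3 : z.im = B.bottom
  · refine hoff (B.q₄, B.q₃) (by simp [Box.ccw]) ?_
    rw [seg_swap]; exact hh _ _ rfl h e3 h1 h2
  by_cases e4 : z.im = B.top
  · exact hoff (B.q₂, B.q₁) (by simp [Box.ccw]) (hh _ _ rfl h e4 h1 h2)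
  exact hz ⟨lt_of_le_of_ne h1 (Ne.symm e1), lt_of_le_of_ne h2 e2, lt_of_le_of_ne h3 (Ne.symm e3),
    lt_of_le_of_ne h4 e4⟩

lemma Box.asum_ccw_cases (B : Box) (h : B.left < B.right) (h' : B.bottom < B.top) {z : ℂ}
    (hoff : ∀ e ∈ B.ccw, z ∉ seg e) : (z ∈ B.inside ∧ asum B.ccw z = 2 * Real.pi) ∨
      (z ∉ B.inside ∧ asum B.ccw z = 0) := by
  by_cases hz : z ∈ B.inside
  · exact Or.inl ⟨hz, B.asum_inside h h' hz⟩
  · exact Or.inr ⟨hz, B.asum_outside h h' (B.strictly_outside hz h h' hoff)⟩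

lemma notMem_trace_donut {P : List ℂ} (hP : P ≠ []) {B : Box} {z : ℂ}
    (hz : z ∉ trace (donut P B)) : z ∉ trace P ∧ (∀ e ∈ B.ccw, z ∉ seg e) ∧
      z ∉ seg (B.q₁, P.headI) := by
  rw [notMem_trace] at hz
  refine ⟨notMem_trace.2 ?_, ?_, ?_⟩
  · rintro ⟨x, y⟩ he
    rw [seg_swap]; exact hz _ ((mem_edges_donut hP).2 (Or.inr he))
  · rintro ⟨x, y⟩ he
    rw [seg_swap]; exact hz _ ((mem_edges_donut hP).2 (Or.inl (mem_frame.2 (Or.inl he))))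
  · exact hz _ ((mem_edges_donut hP).2 (Or.inl (mem_frame.2 (Or.inr (Or.inl rfl)))))

lemma trace_subset_donut {P : List ℂ} (hP : P ≠ []) (B : Box) : trace P ⊆ trace (donut P B) := by
  intro z hz
  by_contra h
  exact (notMem_trace_donut hP h).1 hz

lemma asum_donut {P : List ℂ} (hP : P ≠ []) {B : Box} {z : ℂ} (hz : z ∉ trace (donut P B)) :
    asum (edges (donut P B)) z = -(asum B.ccw z + asum (edges P) z) := by
  obtain ⟨h1, h2, h3⟩ := notMem_trace_donut hP hz
  rw [asum_perm (edges_donut hP B), asum_append, asum_map_swap (notMem_trace.1 h1)]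
  have h4 := ang_swap h3
  have h5 : frame P B = [(B.q₁, B.q₂), (B.q₂, B.q₃), (B.q₃, B.q₄), (B.q₄, B.q₁)] ++
      [(B.q₁, P.headI), (P.headI, B.q₁)] := rfl
  have h6 := asum_map_swap h2
  rw [asum_perm (fs := [(B.q₁, B.q₂), (B.q₂, B.q₃), (B.q₃, B.q₄), (B.q₄, B.q₁)])
    (List.reverse_perm _).symm] at h6
  rw [h5, asum_append, h6]
  simp only [asum_cons, asum_nil]
  simp only [Prod.swap_prod_mk] at h4
  rw [h4]; ring

/-- The interior of the sliced donut consists of the points in the rectangle that are not in `P`. -/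
lemma mem_inner_donut {P : List ℂ} (hP : IsInput P) {B : Box} (hB : IsContainingBox P B) {z : ℂ}
    (hz : z ∉ trace (donut P B)) :
    z ∈ inner (donut P B) ↔ z ∈ B.inside ∧ asum (edges P) z = 0 := by
  obtain ⟨h1, h2, -⟩ := notMem_trace_donut hP.ne_nil hz
  obtain ⟨hlr, hbt⟩ := hB.lt hP.ne_nil
  have hpi := Real.pi_pos
  have hin : z ∈ inner (donut P B) ↔ asum B.ccw z + asum (edges P) z ≠ 0 := by
    unfold inner
    simp only [Set.mem_ofPred_eq, hz, not_false_iff, true_and, winding_eq, asum_donut hP.ne_nil hz]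
    simp [hpi.ne']
    constructor
    · intro h h'; apply h; linarith
    · intro h h'; apply h; linarith
  rw [hin]
  rcases B.asum_ccw_cases hlr hbt h2 with ⟨h3, h4⟩ | ⟨h3, h4⟩
  · rw [h4]
    rcases hP.asum_cases h1 with h5 | h5
    · rw [h5]; simp [h3, hpi.ne']
    · rw [h5]; simp [hpi.ne']
  · have : asum (edges P) z = 0 := B.asum_eq_zero (isCycle_edges P)
      (fun e he => ⟨hB.mem_inside (mem_of_mem_edges he).1, hB.mem_inside (mem_of_mem_edges he).2⟩) h3
    rw [h4, this]; simp [h3]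

lemma inner_donut_subset {P : List ℂ} (hP : IsInput P) {B : Box} (hB : IsContainingBox P B) :
    inner (donut P B) ⊆ B.inside := fun _ hz => ((mem_inner_donut hP hB hz.1).1 hz).1

/-- There is a triangle on the left of the cut edge, directed from `q₁` to `p₁`. -/
lemma exists_cut_triangle {P : List ℂ} (hP : IsInput P) {B : Box} (hB : IsContainingBox P B)
    {T : Finset (Finset ℂ)} (hT : VertexTriangulation (donut P B) T) :
    ∃ t ∈ T, IsSide t B.q₁ P.headI := by
  have hne : B.q₁ ≠ P.headI := fun h => B.q₁_notMem (h ▸ hB.mem_inside hP.head_mem)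
  obtain ⟨z, hz, -, -, hgen⟩ := exists_generic (e := (B.q₁, P.headI)) hne isOpen_univ
    (left_mem_seg _) (Set.mem_univ _) Set.finite_empty (finite_sides T)
  have hcutD : (B.q₁, P.headI) ∈ edges (donut P B) :=
    (mem_edges_donut hP.ne_nil).2 (Or.inl (mem_frame.2 (Or.inr (Or.inl rfl))))
  have hzD : z ∈ trace (donut P B) := ⟨_, hcutD, openSeg_subset_seg _ hz⟩
  have hd : P.headI - B.q₁ ≠ 0 := sub_ne_zero.2 hne.symm
  obtain ⟨him, hin⟩ := hB.cut_im hP.ne_nil hz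
  have hopen : IsOpen {w : ℂ | P.headI.im < w.im} := isOpen_lt continuous_const Complex.continuous_im
  have hinner : ∀ᶠ ε : ℝ in 𝓝[>] 0,
      z + ε * (Complex.I * (P.headI - B.q₁)) ∈ inner (donut P B) := by
    filter_upwards [(tendsto_normal z (P.headI - B.q₁)).eventually (hopen.mem_nhds him),
      (tendsto_normal z (P.headI - B.q₁)).eventually (B.isOpen_inside.mem_nhds hin),
      self_mem_nhdsWithin] with ε h1 h2 h3
    have h3 : 0 < ε := h3
    have hoff : z + ε * (Complex.I * (P.headI - B.q₁)) ∉ seg (B.q₁, P.headI) := fun h => by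
      have h4 := orient_eq_zero_of_mem_seg h
      rw [orient_add_normal _ _ _ _ _ 1 (by simp),
        orient_eq_zero_of_mem_seg (openSeg_subset_seg _ hz)] at h4
      have := mul_pos h3 (Complex.normSq_pos.2 hd)
      linarith
    have hoffD : z + ε * (Complex.I * (P.headI - B.q₁)) ∉ trace (donut P B) := by
      rw [notMem_trace]
      rintro ⟨x, y⟩ he
      rcases (mem_edges_donut hP.ne_nil).1 he with h | h
      · rcases mem_frame.1 h with h | h | h
        · rw [seg_swap]; exact B.off_ccw _ h2 _ h
        · rw [h]; exact hoff
        · rw [h, seg_swap]; exact hoff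
      · intro h4
        have := hP.im_le_of_mem_trace ⟨_, h, by rw [seg_swap]; exact h4⟩
        have h1 : P.headI.im < _ := h1
        linarith
    rw [mem_inner_donut hP hB hoffD]
    exact ⟨h2, hP.asum_above (isCycle_edges P) (fun e he => mem_of_mem_edges he) h1⟩
  obtain ⟨t, ht, x, y, hxy, hzo, r, hr, hrd⟩ := exists_side_of_frequently hT.triangle hd
    (fun e he => hgen e he) (fun t ht h => (hT.inside t ht h).1 hzD)
    (hinner.mono fun ε h => hT.cover h).frequently
  refine ⟨t, ht, ?_⟩
  rcases hT.side t ht x y hxy with h | h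
  · rcases (mem_edges_donut hP.ne_nil).1 h with h | h
    · rcases mem_frame.1 h with h | h | h
      · exact absurd (openSeg_subset_seg _ hzo) (B.off_ccw z hin _ h)
      · obtain ⟨rfl, rfl⟩ := Prod.mk.inj h
        exfalso
        have h2 : (1 + r) • (P.headI - B.q₁) = 0 := by
          rw [add_smul, ← hrd, one_smul]; ring
        rcases smul_eq_zero.1 h2 with h | h
        · linarith
        · exact hd h
      · obtain ⟨rfl, rfl⟩ := Prod.mk.inj h
        exact hxy
    · have := hP.im_le_of_mem_trace ⟨_, h, openSeg_subset_seg _ hzo⟩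
      linarith
  · exact absurd hzD (h hzo).1


/-! ### Partition into discs -/

/-- The disc is not glued to any further triangle of `R`. -/
def Saturated (H : List ℂ) (R : Finset (Finset ℂ)) (V : List ℂ) : Prop :=
  ∀ x y, (x, y) ∈ pairs V → openSeg (x, y) ⊆ inner H → ∀ t ∈ R, ¬ IsSide t y x

/-- `R'` is a union of components of `R` with respect to adjacency along diagonals. -/
def ClosedIn (H : List ℂ) (R R' : Finset (Finset ℂ)) : Prop :=
  R' ⊆ R ∧ ∀ t ∈ R', ∀ x y, IsSide t x y → openSeg (x, y) ⊆ inner H →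
    ∀ t' ∈ R, IsSide t' y x → t' ∈ R'

/-- A disc: its triangles, its glued diagonals, and its boundary walk. -/
structure Piece where
  S : Finset (Finset ℂ)
  Γ : Set (ℂ × ℂ)
  V : List ℂ

/-- A saturated disc with triangles in `R`. -/
def IsPiece (H : List ℂ) (T R : Finset (Finset ℂ)) (p : Piece) : Prop :=
  (∃ a b, Disc H T a b p.S p.Γ p.V) ∧ p.S ⊆ R ∧ p.S.Nonempty ∧ Saturated H R p.V

section
variable {H : List ℂ} {T R : Finset (Finset ℂ)}

/-- Removing a saturated disc leaves a union of components. -/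
lemma ClosedIn.sdiff (hT : VertexTriangulation H T) (hR : R ⊆ T) {R' : Finset (Finset ℂ)}
    (h : ClosedIn H R R') {p : Piece} (hp : IsPiece H T R p) : ClosedIn H R (R' \ p.S) := by
  obtain ⟨⟨a, b, D⟩, hS, -, hsat⟩ := hp
  refine ⟨Finset.sdiff_subset.trans h.1, ?_⟩
  intro t ht x y hs hin t' ht' hs'
  rw [Finset.mem_sdiff] at ht ⊢
  refine ⟨h.2 t ht.1 x y hs hin t' ht' hs', fun htS => ht.2 ?_⟩
  have htT := hR (h.1 ht.1)
  rcases D.pair_of_side t' htS y x hs' with h1 | h1 | h1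
  · exact absurd hs (hsat y x h1 (by rw [openSeg_swap]; exact hin) t (h.1 ht.1))
  · obtain ⟨-, t1, ht1, hs1⟩ := D.glued_side _ h1
    rwa [hT.eq_of_side htT (D.sub ht1) hs hs1]
  · obtain ⟨⟨t1, ht1, hs1⟩, -⟩ := D.glued_side _ h1
    rwa [hT.eq_of_side htT (D.sub ht1) hs hs1]

/-- The saturated disc of a triangle, with a prescribed first edge. -/
lemma exists_piece (hT : VertexTriangulation H T) (hR : R ⊆ T) {R' : Finset (Finset ℂ)}
    (h : ClosedIn H R R') {t : Finset ℂ} (ht : t ∈ R') {a b : ℂ} (hs : IsSide t a b) :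
    ∃ p : Piece, Disc H T a b p.S p.Γ p.V ∧ p.S ⊆ R' ∧ t ∈ p.S ∧ IsPiece H T R p := by
  obtain ⟨S, Γ, V, D, h1, h2, h3⟩ := exists_saturated_disc hT (h.1.trans hR) ht hs
  refine ⟨⟨S, Γ, V⟩, D, h1, h2, ⟨a, b, D⟩, h1.trans h.1, ⟨t, h2⟩, ?_⟩
  intro x y hxy hin t' ht' hs'
  obtain ⟨t1, ht1, hs1⟩ := D.side_of_pair _ hxy
  exact h3 x y hxy hin t' (h.2 t1 (h1 ht1) x y hs1 hin t' ht' hs') hs'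

/-- A set of triangles decomposes into saturated discs. -/
lemma exists_pieces (hT : VertexTriangulation H T) (hR : R ⊆ T) {R' : Finset (Finset ℂ)}
    (h : ClosedIn H R R') : ∃ L : List Piece, (∀ p ∈ L, IsPiece H T R p) ∧
      L.Pairwise (fun p q => Disjoint p.S q.S) ∧ ∀ t, t ∈ R' ↔ ∃ p ∈ L, t ∈ p.S := by
  induction hn : R'.card using Nat.strong_induction_on generalizing R' with
  | _ n ih =>
    rcases R'.eq_empty_or_nonempty with rfl | ⟨t, ht⟩
    · exact ⟨[], by simp, List.Pairwise.nil, by simp⟩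
    · obtain ⟨a, b, hs⟩ := hT.triangle t (hR (h.1 ht))
      obtain ⟨p, -, hpS, htp, hp⟩ := exists_piece hT hR h ht hs
      have hlt : (R' \ p.S).card < n := by
        rw [← hn]
        exact Finset.card_lt_card ⟨Finset.sdiff_subset, fun hc =>
          (Finset.mem_sdiff.1 (hc ht)).2 htp⟩
      obtain ⟨L, h1, h2, h3⟩ := ih _ hlt (h.sdiff hT hR hp) rfl
      refine ⟨p :: L, ?_, ?_, ?_⟩
      · intro q hq
        rcases List.mem_cons.1 hq with rfl | hq
        · exact hp
        · exact h1 q hq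
      · refine List.pairwise_cons.2 ⟨fun q hq => ?_, h2⟩
        rw [Finset.disjoint_left]
        intro u hu hu'
        exact (Finset.mem_sdiff.1 ((h3 u).2 ⟨q, hq, hu'⟩)).2 hu
      · intro u
        have := h3 u
        rw [Finset.mem_sdiff] at this
        simp only [List.mem_cons, exists_eq_or_imp]
        rw [← this]
        by_cases hu : u ∈ p.S
        · simp [hu, hpS hu]
        · simp [hu]

/-- Points in general position with respect to a triangulation. -/
def offFrontiers (T : Finset (Finset ℂ)) : Set ℂ := {z | ∀ t ∈ T, z ∉ frontier (body t)}

lemma ae_offFrontiers (T : Finset (Finset ℂ)) : ∀ᵐ z : ℂ, z ∈ offFrontiers T := by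
  have : ∀ᵐ z : ℂ, ∀ t ∈ (T : Set (Finset ℂ)), z ∉ frontier (body t) := by
    rw [ae_ball_iff T.countable_toSet]
    intro t _
    exact measure_eq_zero_iff_ae_notMem.1 (volume_frontier_body t)
  exact this

lemma sum_indicator_of_mem (hT : VertexTriangulation H T) {S : Finset (Finset ℂ)} (hS : S ⊆ T)
    {t : Finset ℂ} (ht : t ∈ S) {z : ℂ} (hz : z ∈ interior (body t)) :
    ∑ t ∈ S, (interior (body t)).indicator (fun _ => 2 * Real.pi) z = 2 * Real.pi := by
  rw [Finset.sum_eq_single_of_mem t ht, Set.indicator_of_mem hz]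
  intro t' ht' hne
  exact Set.indicator_of_notMem (fun h => hne (hT.eq_of_mem_interior (hS ht') (hS ht) h hz)) _

lemma sum_indicator_of_notMem {S : Finset (Finset ℂ)} {z : ℂ}
    (hz : ∀ t ∈ S, z ∉ interior (body t)) :
    ∑ t ∈ S, (interior (body t)).indicator (fun _ => 2 * Real.pi) z = 0 :=
  Finset.sum_eq_zero fun t ht => Set.indicator_of_notMem (hz t ht) _

lemma sum_indicator_cases (hT : VertexTriangulation H T) {S : Finset (Finset ℂ)} (hS : S ⊆ T)
    (z : ℂ) : ((∃ t ∈ S, z ∈ interior (body t)) ∧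
        ∑ t ∈ S, (interior (body t)).indicator (fun _ => 2 * Real.pi) z = 2 * Real.pi) ∨
      ((∀ t ∈ S, z ∉ interior (body t)) ∧
        ∑ t ∈ S, (interior (body t)).indicator (fun _ => 2 * Real.pi) z = 0) := by
  by_cases h : ∃ t ∈ S, z ∈ interior (body t)
  · obtain ⟨t, ht, hz⟩ := h
    exact Or.inl ⟨⟨t, ht, hz⟩, sum_indicator_of_mem hT hS ht hz⟩
  · push Not at h
    exact Or.inr ⟨h, sum_indicator_of_notMem h⟩

lemma exists_mem_offFrontiers {N : Set ℂ} (hN : IsOpen N) (hne : N.Nonempty) :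
    ∃ z ∈ N, z ∈ offFrontiers T := by
  have hd : Dense (offFrontiers T) := Measure.dense_of_ae (ae_offFrontiers T)
  exact hd.inter_open_nonempty N hN hne

lemma Disc.two_le {a b : ℂ} {S : Finset (Finset ℂ)} {Γ : Set (ℂ × ℂ)} {V : List ℂ}
    (hT : VertexTriangulation H T) (D : Disc H T a b S Γ V) (hS : S.Nonempty) : 2 ≤ V.length := by
  obtain ⟨t, ht⟩ := hS
  obtain ⟨x, y, hxy⟩ := hT.triangle t (D.sub ht)
  obtain ⟨z, hz, hoff⟩ := exists_mem_offFrontiers (T := T) isOpen_interior hxy.interior_nonempty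
  have h := D.wind z hoff
  rw [sum_indicator_of_mem hT D.sub ht hz] at h
  match V, h with
  | [], h => rw [pairs_nil, asum_nil] at h; linarith [Real.pi_pos]
  | [_], h => rw [pairs_single, asum_nil] at h; linarith [Real.pi_pos]
  | _ :: _ :: _, _ => simp

lemma IsPiece.edges (hT : VertexTriangulation H T) {p : Piece} (hp : IsPiece H T R p) :
    edges p.V.dropLast = pairs p.V := by
  obtain ⟨⟨a, b, D⟩, -, hne, -⟩ := hp
  exact edges_dropLast D.head D.last (D.two_le hT hne)

lemma IsPiece.dropLast_ne (hT : VertexTriangulation H T) {p : Piece} (hp : IsPiece H T R p) :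
    p.V.dropLast ≠ [] := by
  obtain ⟨⟨a, b, D⟩, -, hne, -⟩ := hp
  have := D.two_le hT hne
  intro h
  have h1 := congrArg List.length h
  rw [List.length_dropLast, List.length_nil] at h1
  omega

lemma IsPiece.nearbyLoop (hT : VertexTriangulation H T) {p : Piece} (hp : IsPiece H T R p) :
    NearbyLoop (discOpen p.S p.Γ) p.V.dropLast := by
  obtain ⟨⟨a, b, D⟩, -, hne, -⟩ := hp
  obtain ⟨n, F, g, M⟩ := D.model
  have h1 := D.two_le hT hne
  have h2 := M.length
  exact M.nearbyLoop D.head D.last (by omega)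

lemma IsPiece.disjoint (hT : VertexTriangulation H T) {p q : Piece} (hp : IsPiece H T R p)
    (hq : IsPiece H T R q) (h : Disjoint p.S q.S) :
    Disjoint (discOpen p.S p.Γ) (discOpen q.S q.Γ) := by
  obtain ⟨⟨a, b, D⟩, -, -, -⟩ := hp
  obtain ⟨⟨a', b', D'⟩, -, -, -⟩ := hq
  have hdis : ∀ t ∈ p.S, t ∉ q.S := fun t ht => Finset.disjoint_left.1 h ht
  rw [Set.disjoint_left]
  rintro z (⟨t, ht, hz⟩ | ⟨⟨x, y⟩, he, hz⟩) (⟨t', ht', hz'⟩ | ⟨⟨x', y'⟩, he', hz'⟩)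
  · exact hdis t ht (hT.eq_of_mem_interior (D'.sub ht') (D.sub ht) hz' hz ▸ ht')
  · obtain ⟨⟨t', ht', hs'⟩, -⟩ := D'.glued_side _ he'
    exact hT.notMem_interior (D'.sub ht') (D.sub ht) hs' (openSeg_subset_seg _ hz') hz
  · obtain ⟨⟨t, ht, hs⟩, -⟩ := D.glued_side _ he
    exact hT.notMem_interior (D.sub ht) (D'.sub ht') hs (openSeg_subset_seg _ hz) hz'
  · obtain ⟨⟨t, ht, hs⟩, -⟩ := D.glued_side _ he
    obtain ⟨⟨t1, ht1, hs1⟩, t2, ht2, hs2⟩ := D'.glued_side _ he'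
    rcases hT.diagonal_unique (D.sub ht) (D'.sub ht1) hs hs1 (D.glued_inner _ he) hz hz' with
      ⟨h1, h2⟩ | ⟨h1, h2⟩
    · rw [h1, h2] at hs1
      exact hdis t ht (hT.eq_of_side (D.sub ht) (D'.sub ht1) hs hs1 ▸ ht1)
    · rw [h1, h2] at hs2
      exact hdis t ht (hT.eq_of_side (D.sub ht) (D'.sub ht2) hs hs2 ▸ ht2)

/-- The boundary walk does not meet the interior of the disc. -/
lemma Disc.notMem_seg {a b : ℂ} {S : Finset (Finset ℂ)} {Γ : Set (ℂ × ℂ)} {V : List ℂ}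
    (hT : VertexTriangulation H T) (D : Disc H T a b S Γ V) {z : ℂ} (hz : z ∈ discOpen S Γ)
    {e : ℂ × ℂ} (he : e ∈ pairs V) : z ∉ seg e := by
  obtain ⟨x, y⟩ := e
  intro hzs
  obtain ⟨t, ht, hs⟩ := D.side_of_pair _ he
  have hzi := D.discOpen_subset_inner hT hz
  have hzo : z ∈ openSeg (x, y) := by
    apply mem_openSeg_of_mem_seg hzs
    · rintro rfl; exact hT.vertex_notMem_inner (D.sub ht) hs.left_mem hzi
    · rintro rfl; exact hT.vertex_notMem_inner (D.sub ht) hs.right_mem hzi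
  exact Set.disjoint_left.1 (D.openSeg_disjoint hT (D.sub ht) hs
    (fun h => (D.glued_notMem _ h).1 he) (fun h => (D.glued_notMem _ h).2 he)) hzo hz

end

/-- A version of `nearlySimple_of_disjoint` for lists. -/
lemma nearlySimple_of_pairwise {L : List (Set ℂ × List ℂ)}
    (hd : L.Pairwise fun p q => Disjoint p.1 q.1) (h : ∀ p ∈ L, NearbyLoop p.1 p.2) :
    NearlySimple (L.map Prod.snd) := by
  have hlen : (L.map Prod.snd).length = L.length := List.length_map _
  apply nearlySimple_of_disjoint (fun i => (L.get (i.cast hlen)).1)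
  · intro i j hij
    rw [List.pairwise_iff_getElem] at hd
    rcases lt_or_gt_of_ne hij with h | h
    · exact hd i j (i.cast hlen).2 (j.cast hlen).2 h
    · exact (hd j i (j.cast hlen).2 (i.cast hlen).2 h).symm
  · intro i
    have := h (L.get (i.cast hlen)) (List.get_mem _ _)
    simpa using this

/-- A property of the winding angle that holds almost everywhere holds at all points off the
edges. -/
lemma asum_off_of_ae {es : List (ℂ × ℂ)} (hes : IsCycle es) {p : ℝ → Prop}
    (h : ∀ᵐ z : ℂ, p (asum es z)) {z : ℂ} (hz : ∀ e ∈ es, z ∉ seg e) : p (asum es z) := by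
  have hd : Dense {z : ℂ | p (asum es z)} := Measure.dense_of_ae h
  obtain ⟨U, hU, hUo, hzU⟩ := mem_nhds_iff.1 (asum_eventually hes hz)
  obtain ⟨w, hw, hpw⟩ := hd.inter_open_nonempty U hUo ⟨z, hzU⟩
  have hpw : p (asum es w) := hpw
  rwa [(hU hw).2] at hpw


/-! ### Decomposition of the inactive triangles -/

section
variable {P : List ℂ} {B : Box} {E : Set (ℂ × ℂ)}

open Classical in
lemma Labeled.mem_separators (T : Labeled P B E) {e : ℂ × ℂ} :
    e ∈ T.separators ↔ T.IsSeparator e := by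
  unfold Labeled.separators
  rw [Finset.mem_filter, and_iff_right_iff_imp]
  rintro ⟨⟨t, ht, -, hs⟩, -⟩
  exact Finset.mem_biUnion.2 ⟨t, ht, Finset.mem_product.2 ⟨hs.left_mem, hs.right_mem⟩⟩

/-- The inactive triangles. -/
def Labeled.inactive (T : Labeled P B E) : Finset (Finset ℂ) := T.tri.filter (T.label · = false)

/-- The active triangles. -/
def Labeled.active (T : Labeled P B E) : Finset (Finset ℂ) := T.tri.filter (T.label · = true)

lemma Labeled.mem_inactive {T : Labeled P B E} {t : Finset ℂ} :
    t ∈ T.inactive ↔ t ∈ T.tri ∧ T.label t = false := Finset.mem_filter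

lemma Labeled.mem_active {T : Labeled P B E} {t : Finset ℂ} :
    t ∈ T.active ↔ t ∈ T.tri ∧ T.label t = true := Finset.mem_filter

lemma Labeled.inactive_subset (T : Labeled P B E) : T.inactive ⊆ T.tri := Finset.filter_subset _ _

lemma Labeled.side_cases {T : Labeled P B E} (hP : P ≠ [])
    (hT : VertexTriangulation (donut P B) T.tri) {t : Finset ℂ} (ht : t ∈ T.inactive) {x y : ℂ}
    (hs : IsSide t x y) : T.IsSeparator (x, y) ∨ (y, x) ∈ frame P B ∨
      (openSeg (x, y) ⊆ inner (donut P B) ∧ ∃ t' ∈ T.inactive, IsSide t' y x) := by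
  obtain ⟨htT, hl⟩ := Labeled.mem_inactive.1 ht
  rcases hT.side t htT x y hs with h | h
  · rcases (mem_edges_donut hP).1 h with h | h
    · exact Or.inr (Or.inl h)
    · exact Or.inl ⟨⟨t, htT, hl, hs⟩, Or.inl h⟩
  · obtain ⟨t', ht', hs'⟩ := hT.exists_neighbour htT hs h
    cases hl' : T.label t' with
    | true => exact Or.inl ⟨⟨t, htT, hl, hs⟩, Or.inr ⟨t', ht', hl', hs'⟩⟩
    | false => exact Or.inr (Or.inr ⟨h, t', Labeled.mem_inactive.2 ⟨ht', hl'⟩, hs'⟩)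

lemma Labeled.not_isSeparator {T : Labeled P B E} (hP : P ≠ [])
    (hT : VertexTriangulation (donut P B) T.tri) {x y : ℂ}
    (hin : openSeg (x, y) ⊆ inner (donut P B)) {t : Finset ℂ} (ht : t ∈ T.inactive)
    (hs : IsSide t y x) : ¬ T.IsSeparator (x, y) := by
  obtain ⟨htT, hl⟩ := Labeled.mem_inactive.1 ht
  rintro ⟨-, h | ⟨t', ht', hl', hs'⟩⟩
  · have hm := openSeg_midpoint (x, y)
    exact (hin hm).1 (trace_subset_donut hP B ⟨_, h, openSeg_subset_seg _ hm⟩)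
  · have := hT.eq_of_side htT ht' hs hs'
    rw [← this, hl] at hl'
    exact Bool.false_ne_true hl'

/-- The edges that may occur on the boundary walk of a disc of inactive triangles. -/
def Admissible (P : List ℂ) (B : Box) (e : ℂ × ℂ) : Prop :=
  (e.1 ∈ P ∧ e.2 ∈ P) ∨ e.swap ∈ frame P B

lemma Admissible.cases {e : ℂ × ℂ} (h : Admissible P B e) : (e.1 ∈ P ∧ e.2 ∈ P) ∨
    e = (B.q₂, B.q₁) ∨ e = (B.q₃, B.q₂) ∨ e = (B.q₄, B.q₃) ∨ e = (B.q₁, B.q₄) ∨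
      e = (P.headI, B.q₁) ∨ e = (B.q₁, P.headI) := by
  obtain ⟨x, y⟩ := e
  refine h.imp_right fun h => ?_
  simp only [frame, List.mem_cons, List.not_mem_nil, or_false, Prod.swap_prod_mk,
    Prod.mk.injEq] at h
  simp only [Prod.mk.injEq]
  tauto

lemma Admissible.of_mem (hB : IsContainingBox P B) {x y : ℂ} (h : Admissible P B (x, y))
    (hx : x ∈ P) : y ∈ P ∨ (x = P.headI ∧ y = B.q₁) := by
  have hin := hB.mem_inside hx
  rcases h.cases with h | h | h | h | h | h | h
  · exact Or.inl h.2
  all_goals obtain ⟨rfl, rfl⟩ := Prod.mk.inj h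
  · exact absurd hin B.q₂_notMem
  · exact absurd hin B.q₃_notMem
  · exact absurd hin B.q₄_notMem
  · exact absurd hin B.q₁_notMem
  · exact Or.inr ⟨rfl, rfl⟩
  · exact absurd hin B.q₁_notMem

lemma IsContainingBox.corners_ne (hB : IsContainingBox P B) (hP : P ≠ []) :
    B.q₁ ≠ B.q₂ ∧ B.q₁ ≠ B.q₃ ∧ B.q₁ ≠ B.q₄ ∧ B.q₂ ≠ B.q₃ ∧ B.q₂ ≠ B.q₄ ∧ B.q₃ ≠ B.q₄ := by
  obtain ⟨h1, h2⟩ := hB.lt hP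
  refine ⟨?_, ?_, ?_, ?_, ?_, ?_⟩ <;> intro h
  · exact h1.ne (congrArg Complex.re h)
  · exact h1.ne (congrArg Complex.re h)
  · exact h2.ne' (congrArg Complex.im h)
  · exact h2.ne' (congrArg Complex.im h)
  · exact h1.ne' (congrArg Complex.re h)
  · exact h1.ne' (congrArg Complex.re h)

lemma Admissible.of_corner (hB : IsContainingBox P B) (hP : P ≠ []) {x y : ℂ}
    (h : Admissible P B (x, y)) : (x = B.q₁ → y = P.headI ∨ y = B.q₄) ∧ (x = B.q₂ → y = B.q₁) ∧
      (x = B.q₃ → y = B.q₂) ∧ (x = B.q₄ → y = B.q₃) := by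
  obtain ⟨n1, n2, n3, n4, n5, n6⟩ := hB.corners_ne hP
  have hq : ∀ q, q ∉ B.inside → q ∉ P := fun q hq h => hq (hB.mem_inside h)
  have m1 := hq _ B.q₁_notMem
  have m2 := hq _ B.q₂_notMem
  have m3 := hq _ B.q₃_notMem
  have m4 := hq _ B.q₄_notMem
  have hp := headI_mem hP
  have p1 : P.headI ≠ B.q₁ := fun h => m1 (h ▸ hp)
  have p2 : P.headI ≠ B.q₂ := fun h => m2 (h ▸ hp)
  have p3 : P.headI ≠ B.q₃ := fun h => m3 (h ▸ hp)
  have p4 : P.headI ≠ B.q₄ := fun h => m4 (h ▸ hp)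
  rcases h.cases with ⟨h, -⟩ | h | h | h | h | h | h
  · refine ⟨?_, ?_, ?_, ?_⟩ <;> rintro rfl <;> contradiction
  all_goals
    obtain ⟨rfl, rfl⟩ := Prod.mk.inj h
    refine ⟨?_, ?_, ?_, ?_⟩ <;> intro h' <;> first | exact absurd h' ‹_› | exact absurd h'.symm ‹_› |
      simp

lemma pairs_cons_subset (x : ℂ) (W : List ℂ) : ∀ e ∈ pairs W, e ∈ pairs (x :: W) := by
  intro e he
  cases W with
  | nil => simp [pairs_nil] at he
  | cons y W => rw [pairs_cons]; exact List.mem_cons_of_mem _ he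

/-- A walk that starts in `P` and ends at `q₁` enters `q₁` from `p₁`. -/
lemma exists_walk_to_corner (hB : IsContainingBox P B) {W : List ℂ} {x : ℂ} (hx : x ∈ P)
    (hW : ∀ e ∈ pairs (x :: W), Admissible P B e) (hlast : (x :: W).getLast? = some B.q₁) :
    ∃ U W', x :: W = U ++ B.q₁ :: W' ∧ U.head? = some x ∧ U.getLast? = some P.headI ∧
      ∀ v ∈ U, v ∈ P := by
  induction W generalizing x with
  | nil =>
    simp only [List.getLast?_singleton, Option.some.injEq] at hlast
    subst hlast
    exact absurd (hB.mem_inside hx) B.q₁_notMem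
  | cons y W ih =>
    have h1 := hW (x, y) (by rw [pairs_cons]; exact List.mem_cons_self)
    rcases h1.of_mem hB hx with hy | ⟨h3, h2⟩
    · obtain ⟨U, W', e1, e2, e3, e4⟩ := ih hy (fun e he => hW e (pairs_cons_subset _ _ e he))
        (by rwa [List.getLast?_cons_cons] at hlast)
      refine ⟨x :: U, W', by rw [e1, List.cons_append], rfl, ?_, ?_⟩
      · cases U with
        | nil => simp at e2
        | cons u U => rw [List.getLast?_cons_cons]; exact e3
      · intro v hv
        rcases List.mem_cons.1 hv with rfl | hv
        · exact hx
        · exact e4 v hv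
    · subst h2
      refine ⟨[x], W, rfl, rfl, by rw [h3]; rfl, ?_⟩
      intro v hv
      rw [List.mem_singleton] at hv
      exact hv ▸ hx

/-- The boundary walk of the disc at the cut edge either follows the cut edge to a closed walk `U`
in `P` and back, or moreover surrounds the rectangle. -/
lemma exists_outer_walk (hP : P ≠ []) (hB : IsContainingBox P B) {V V' : List ℂ}
    (hV : V = B.q₁ :: P.headI :: V') (hn : (pairs V).Nodup) (hlast : V.getLast? = some B.q₁)
    (hadm : ∀ e ∈ pairs V, Admissible P B e) :
    ∃ U, U.head? = some P.headI ∧ U.getLast? = some P.headI ∧ (∀ v ∈ U, v ∈ P) ∧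
      (V = B.q₁ :: (U ++ [B.q₁]) ∨ V = B.q₁ :: (U ++ [B.q₁, B.q₄, B.q₃, B.q₂, B.q₁])) := by
  obtain ⟨n1, n2, n3, n4, n5, n6⟩ := hB.corners_ne hP
  obtain ⟨U, W, e1, e2, e3, e4⟩ := exists_walk_to_corner hB (W := V') (headI_mem hP)
    (fun e he => hadm e (by rw [hV]; exact pairs_cons_subset _ _ e he))
    (by rw [hV, List.getLast?_cons_cons] at hlast; exact hlast)
  refine ⟨U, e2, e3, e4, ?_⟩
  rw [e1] at hV
  have hp : pairs V = pairs (B.q₁ :: U ++ [B.q₁]) ++ pairs (B.q₁ :: W) := by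
    rw [hV, ← List.cons_append, pairs_append]
  have hmem : (B.q₁, P.headI) ∈ pairs (B.q₁ :: U ++ [B.q₁]) := by
    cases U with
    | nil => simp at e2
    | cons u U =>
      simp only [List.head?_cons, Option.some.injEq] at e2
      subst e2
      rw [List.cons_append, List.cons_append, pairs_cons]; exact List.mem_cons_self
  rw [hp, List.nodup_append] at hn
  obtain ⟨-, hn1, hn2⟩ := hn
  have hadm' : ∀ x y, (x, y) ∈ pairs (B.q₁ :: W) → Admissible P B (x, y) := fun x y h =>
    hadm _ (by rw [hp]; exact List.mem_append_right _ h)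
  have hcut : ∀ y, (B.q₁, y) ∈ pairs (B.q₁ :: W) → y = B.q₄ := by
    intro y hy
    rcases ((hadm' _ _ hy).of_corner hB hP).1 rfl with rfl | h
    · exact absurd rfl (hn2 _ hmem _ hy)
    · exact h
  have hl : (B.q₁ :: W).getLast? = some B.q₁ := by
    rw [hV, ← List.cons_append, List.getLast?_append_of_ne_nil _ (by simp)] at hlast
    exact hlast
  match W, hV, hn1, hadm', hcut, hl with
  | [], hV, _, _, _, _ => exact Or.inl hV
  | [y], hV, hn1, hadm', hcut, hl =>
    have h1 := hcut y (by simp [pairs_cons])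
    simp [h1] at hl
    exact absurd hl.symm n3
  | [y, z], hV, hn1, hadm', hcut, hl =>
    have h1 := hcut y (by simp [pairs_cons])
    have h2 := ((hadm' y z (by simp [pairs_cons])).of_corner hB hP).2.2.2 h1
    simp [h2] at hl
    exact absurd hl.symm n2
  | [y, z, w], hV, hn1, hadm', hcut, hl =>
    have h1 := hcut y (by simp [pairs_cons])
    have h2 := ((hadm' y z (by simp [pairs_cons])).of_corner hB hP).2.2.2 h1
    have h3 := ((hadm' z w (by simp [pairs_cons])).of_corner hB hP).2.2.1 h2
    simp [h3] at hl
    exact absurd hl.symm n1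
  | [y, z, w, v], hV, hn1, hadm', hcut, hl =>
    have h1 := hcut y (by simp [pairs_cons])
    have h2 := ((hadm' y z (by simp [pairs_cons])).of_corner hB hP).2.2.2 h1
    have h3 := ((hadm' z w (by simp [pairs_cons])).of_corner hB hP).2.2.1 h2
    have h4 := ((hadm' w v (by simp [pairs_cons])).of_corner hB hP).2.1 h3
    rw [h1, h2, h3, h4] at hV
    exact Or.inr hV
  | y :: z :: w :: v :: u :: W, hV, hn1, hadm', hcut, hl =>
    exfalso
    have h1 := hcut y (by simp [pairs_cons])
    have h2 := ((hadm' y z (by simp [pairs_cons])).of_corner hB hP).2.2.2 h1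
    have h3 := ((hadm' z w (by simp [pairs_cons])).of_corner hB hP).2.2.1 h2
    have h4 := ((hadm' w v (by simp [pairs_cons])).of_corner hB hP).2.1 h3
    subst h4
    have h5 := hcut u (by simp [pairs_cons])
    rw [h1, h5] at hn1
    simp [pairs_cons] at hn1

lemma pairs_cut {U W : List ℂ} {p q : ℂ} (h1 : U.head? = some p) (h2 : U.getLast? = some p) :
    pairs (q :: (U ++ q :: W)) = (q, p) :: (pairs U ++ (p, q) :: pairs (q :: W)) := by
  obtain ⟨A, rfl⟩ : ∃ A, U = A ++ [p] := by
    rcases List.eq_nil_or_concat U with rfl | ⟨A, x, rfl⟩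
    · simp at h1
    · simp at h2; exact ⟨A, by rw [h2, List.concat_eq_append]⟩
  have h3 : q :: (A ++ [p] ++ q :: W) = (q :: A) ++ p :: (q :: W) := by simp
  have h4 : pairs (q :: A ++ [p]) = (q, p) :: pairs (A ++ [p]) := by
    cases A with
    | nil => rfl
    | cons x A =>
      simp only [List.cons_append, List.head?_cons, Option.some.injEq] at h1
      subst h1; rfl
  rw [h3, pairs_append, h4, pairs_cons, List.cons_append]

lemma mem_pairs_walk {U : List ℂ} (h1 : U.head? = some P.headI) (h2 : U.getLast? = some P.headI)
    {e : ℂ × ℂ} : e ∈ pairs (B.q₁ :: (U ++ [B.q₁, B.q₄, B.q₃, B.q₂, B.q₁])) ↔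
      e ∈ pairs U ∨ e.swap ∈ frame P B := by
  obtain ⟨x, y⟩ := e
  rw [pairs_cut h1 h2]
  simp only [frame, pairs_cons, pairs_single, List.mem_cons, List.mem_append, List.not_mem_nil,
    or_false, Prod.swap_prod_mk, Prod.mk.injEq]
  tauto

lemma asum_cut {U W : List ℂ} {p q z : ℂ} (h1 : U.head? = some p) (h2 : U.getLast? = some p)
    (hz : z ∉ seg (q, p)) :
    asum (pairs (q :: (U ++ q :: W))) z = asum (pairs U) z + asum (pairs (q :: W)) z := by
  rw [pairs_cut h1 h2, asum_cons, asum_append, asum_cons]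
  have := ang_swap hz
  simp only [Prod.swap_prod_mk] at this
  rw [this]; ring

lemma isCycle_pairs {U : List ℂ} {p : ℂ} (h1 : U.head? = some p) (h2 : U.getLast? = some p) :
    IsCycle (pairs U) := by
  rcases Nat.lt_or_ge U.length 2 with h | h
  · match U, h with
    | [], _ => exact List.Perm.refl _
    | [_], _ => exact List.Perm.refl _
  · rw [← edges_dropLast h1 h2 h]; exact isCycle_edges _

lemma mem_of_mem_pairs {V : List ℂ} {e : ℂ × ℂ} (h : e ∈ pairs V) : e.1 ∈ V ∧ e.2 ∈ V := by
  have := List.of_mem_zip (l₁ := V) (l₂ := V.tail) (a := e.1) (b := e.2) h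
  exact ⟨this.1, List.mem_of_mem_tail this.2⟩

/-- The inactive triangles form saturated discs: the disc `p₀` at the cut edge, whose boundary
walk is the cut edge, the closed walk `U` in `P`, the cut edge and the rectangle, and the discs
`L` in the holes. -/
structure Decomposition (T : Labeled P B E) (U : List ℂ) (p₀ : Piece) (L : List Piece) :
    Prop where
  root : Disc (donut P B) T.tri B.q₁ P.headI p₀.S p₀.Γ p₀.V
  walk : p₀.V = B.q₁ :: (U ++ [B.q₁, B.q₄, B.q₃, B.q₂, B.q₁])
  head : U.head? = some P.headI
  last : U.getLast? = some P.headI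
  two_le : 2 ≤ U.length
  mem : ∀ v ∈ U, v ∈ P
  piece : ∀ p ∈ p₀ :: L, IsPiece (donut P B) T.tri T.inactive p
  disjoint : (p₀ :: L).Pairwise fun p q => Disjoint p.S q.S
  cover : ∀ t, t ∈ T.inactive ↔ ∃ p ∈ p₀ :: L, t ∈ p.S

lemma Labeled.exists_decomposition (hP : IsInput P) (hB : IsContainingBox P B)
    (T : Labeled P B E) (hT : VertexTriangulation (donut P B) T.tri)
    (hsep : ∀ e, T.IsSeparator e → e.1 ∈ P ∧ e.2 ∈ P) :
    ∃ U p₀ L, Decomposition T U p₀ L := by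
  have hpi := Real.pi_pos
  obtain ⟨hlr, hbt⟩ := hB.lt hP.ne_nil
  obtain ⟨t₀, ht₀, hs₀⟩ := exists_cut_triangle hP hB hT
  have ht₀R : t₀ ∈ T.inactive := Labeled.mem_inactive.2 ⟨ht₀, T.cut t₀ ht₀ (Or.inr hs₀)⟩
  have hclosed : ClosedIn (donut P B) T.inactive T.inactive :=
    ⟨Finset.Subset.refl _, fun _ _ _ _ _ _ t' ht' _ => ht'⟩
  obtain ⟨p, D, hpS, htp, hp⟩ := exists_piece hT T.inactive_subset hclosed ht₀R hs₀
  have hcutD : (B.q₁, P.headI) ∈ edges (donut P B) :=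
    (mem_edges_donut hP.ne_nil).2 (Or.inl (mem_frame.2 (Or.inr (Or.inl rfl))))
  have hroot : ¬ openSeg (B.q₁, P.headI) ⊆ inner (donut P B) := fun h =>
    (h (openSeg_midpoint _)).1 ⟨_, hcutD, openSeg_subset_seg _ (openSeg_midpoint _)⟩
  obtain ⟨V', hV'⟩ := D.root hroot
  have hadm : ∀ e ∈ pairs p.V, Admissible P B e := by
    rintro ⟨x, y⟩ he
    obtain ⟨t, ht, hs⟩ := D.side_of_pair _ he
    rcases Labeled.side_cases hP.ne_nil hT (hpS ht) hs with h | h | ⟨h, t', ht', hs'⟩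
    · exact Or.inl (hsep _ h)
    · exact Or.inr h
    · exact absurd hs' (hp.2.2.2 x y he h t' ht')
  obtain ⟨U, e1, e2, e3, e4⟩ := exists_outer_walk hP.ne_nil hB hV' D.nodup D.last hadm
  have hcycU := isCycle_pairs e1 e2
  have hpU : ∀ e ∈ pairs U, e.1 ∈ P ∧ e.2 ∈ P := fun e he =>
    ⟨e3 _ (mem_of_mem_pairs he).1, e3 _ (mem_of_mem_pairs he).2⟩
  have hoffcut : ∀ z ∈ offFrontiers T.tri, z ∉ seg (B.q₁, P.headI) := fun z hz =>
    hs₀.notMem_seg (hz t₀ ht₀)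
  have hV : p.V = B.q₁ :: (U ++ [B.q₁, B.q₄, B.q₃, B.q₂, B.q₁]) := by
    refine e4.resolve_left fun e4 => ?_
    -- the walk `U` does not wind around the points near the cut edge
    have hm := openSeg_midpoint (B.q₁, P.headI)
    have hopen : IsOpen {w : ℂ | P.headI.im < w.im} :=
      isOpen_lt continuous_const Complex.continuous_im
    obtain ⟨ε, h1, h2⟩ := ((hs₀.eventually_left hm one_pos (d := P.headI - B.q₁) (by simp)).and
      ((tendsto_normal _ (P.headI - B.q₁)).eventually
        (hopen.mem_nhds (hB.cut_im hP.ne_nil hm).1))).exists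
    obtain ⟨z, ⟨hz1, hz2⟩, hz⟩ := exists_mem_offFrontiers (T := T.tri)
      (isOpen_interior.inter hopen) ⟨_, h1, h2⟩
    have h3 := D.wind z hz
    rw [sum_indicator_of_mem hT D.sub htp hz1, e4, asum_cut e1 e2 (hoffcut z hz), pairs_single,
      asum_nil, hP.asum_above hcycU hpU hz2] at h3
    linarith
  have hU2 : 2 ≤ U.length := by
    by_contra hlt
    have hU : U = [P.headI] := by
      match U, e1, hlt with
      | [u], e1, _ => simpa using e1
      | _ :: _ :: _, _, hlt => simp at hlt
    -- otherwise the disc covers the rectangle and meets an edge of `P`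
    have hcov : ∀ᵐ z : ℂ, z ∈ B.inside → ∃ t ∈ p.S, z ∈ body t := by
      filter_upwards [ae_offFrontiers T.tri] with z hz hzB
      have h3 := D.wind z hz
      rw [hV, asum_cut e1 e2 (hoffcut z hz), hU, pairs_single, asum_nil, zero_add] at h3
      have h4 : asum B.ccw z = _ := h3
      rw [B.asum_inside hlr hbt hzB] at h4
      rcases sum_indicator_cases hT D.sub z with ⟨⟨t, ht, h⟩, -⟩ | ⟨-, h⟩
      · exact ⟨t, ht, interior_subset h⟩
      · rw [h] at h4; linarith
    obtain ⟨e, he, hhe⟩ : ∃ e ∈ edges P, P.headI ∈ seg e := mem_trace_of_mem hP.head_mem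
    obtain ⟨t, ht, x, y, hs, -, -, z, hzN, hz1, hz2⟩ := hT.exists_side_of_cover D.sub B.isOpen_inside
      hcov (hP.weaklySimple.nondegenerate e (by rw [bdry_solid]; exact he))
      (fun w hw => trace_subset_donut hP.ne_nil B ⟨e, he, hw⟩) hhe (hB.mem_inside hP.head_mem)
    have hzP : z ∈ trace P := ⟨e, he, openSeg_subset_seg _ hz2⟩
    have hzD := trace_subset_donut hP.ne_nil B hzP
    rcases D.pair_of_side t ht x y hs with h | h | h
    · rw [hV, mem_pairs_walk e1 e2, hU, pairs_single] at h
      exact frame_disjoint hP hB (h.resolve_left List.not_mem_nil)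
        (by rw [Prod.swap, openSeg_swap]; exact hz1) hzP
    · exact (D.glued_inner _ h hz1).1 hzD
    · exact (D.glued_inner _ h (by rw [openSeg_swap]; exact hz1)).1 hzD
  obtain ⟨L, l1, l2, l3⟩ := exists_pieces hT T.inactive_subset (hclosed.sdiff hT T.inactive_subset hp)
  refine ⟨U, p, L, D, hV, e1, e2, hU2, e3, ?_, ?_, ?_⟩
  · intro q hq
    rcases List.mem_cons.1 hq with rfl | hq
    · exact hp
    · exact l1 q hq
  · refine List.pairwise_cons.2 ⟨fun q hq => ?_, l2⟩
    rw [Finset.disjoint_left]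
    intro t ht ht'
    exact (Finset.mem_sdiff.1 ((l3 t).2 ⟨q, hq, ht'⟩)).2 ht
  · intro t
    have := l3 t
    rw [Finset.mem_sdiff] at this
    simp only [List.mem_cons, exists_eq_or_imp]
    rw [← this]
    by_cases h : t ∈ p.S
    · simp [h, hpS h]
    · simp [h]

end


/-! ### The hull formed by the separators -/

lemma sum_pieces {f : Finset ℂ → ℝ} {L : List Piece}
    (hd : L.Pairwise fun p q => Disjoint p.S q.S) {R : Finset (Finset ℂ)}
    (hR : ∀ t, t ∈ R ↔ ∃ p ∈ L, t ∈ p.S) :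
    (L.map fun p => ∑ t ∈ p.S, f t).sum = ∑ t ∈ R, f t := by
  induction L generalizing R with
  | nil =>
    have : R = ∅ := by ext t; simp [hR t]
    simp [this]
  | cons p L ih =>
    rw [List.pairwise_cons] at hd
    have hpR : p.S ⊆ R := fun t ht => (hR t).2 ⟨p, List.mem_cons_self, ht⟩
    rw [List.map_cons, List.sum_cons, ih hd.2 (R := R \ p.S), add_comm, Finset.sum_sdiff hpR]
    intro t
    rw [Finset.mem_sdiff, hR t]
    simp only [List.mem_cons, exists_eq_or_imp]
    constructor
    · rintro ⟨h | h, h'⟩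
      · exact absurd h h'
      · exact h
    · rintro ⟨q, hq, ht⟩
      exact ⟨Or.inr ⟨q, hq, ht⟩, fun h => Finset.disjoint_left.1 (hd.1 q hq) h ht⟩

lemma asum_flatMap {ι : Type*} (L : List ι) (f : ι → List (ℂ × ℂ)) (z : ℂ) :
    asum (L.flatMap f) z = (L.map fun p => asum (f p) z).sum := by
  induction L with
  | nil => simp [asum_nil]
  | cons p L ih => rw [List.flatMap_cons, asum_append, List.map_cons, List.sum_cons, ih]

/-- The polygon with holes that is bounded by the boundary walks of the discs. -/
def hull (U : List ℂ) (L : List Piece) : HoledPolygon :=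
  ⟨U.dropLast, L.map fun p => p.V.dropLast⟩

/-- The complement of the open rectangle is connected. -/
lemma Box.isPreconnected_compl (B : Box) : IsPreconnected B.insideᶜ := by
  have h1 : IsPreconnected {z : ℂ | z.re ≤ B.left} := (convex_halfSpace_re_le _).isPreconnected
  have h2 : IsPreconnected {z : ℂ | B.right ≤ z.re} := (convex_halfSpace_re_ge _).isPreconnected
  have h3 : IsPreconnected {z : ℂ | z.im ≤ B.bottom} := (convex_halfSpace_im_le _).isPreconnected
  have h4 : IsPreconnected {z : ℂ | B.top ≤ z.im} := (convex_halfSpace_im_ge _).isPreconnected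
  have h5 := IsPreconnected.union B.q₂ (le_refl B.top) (Or.inl (le_refl B.right) :
    B.q₂ ∈ {z : ℂ | B.right ≤ z.re} ∪ {z : ℂ | z.im ≤ B.bottom}) h4
    (IsPreconnected.union B.q₃ (le_refl B.right) (le_refl B.bottom) h2 h3)
  have h6 := IsPreconnected.union B.q₁ (le_refl B.left) (Or.inl (le_refl B.top)) h1 h5
  convert h6 using 1
  ext z
  simp only [Box.inside, Set.mem_compl_iff, Set.mem_ofPred_eq, Set.mem_union, not_and_or, not_lt]
  tauto

section
variable {P : List ℂ} {B : Box} {E : Set (ℂ × ℂ)} {T : Labeled P B E} {U : List ℂ} {p₀ : Piece}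
  {L : List Piece}

lemma Decomposition.edges_outer (h : Decomposition T U p₀ L) : edges U.dropLast = pairs U :=
  edges_dropLast h.head h.last h.two_le

lemma Decomposition.bdry (hT : VertexTriangulation (donut P B) T.tri)
    (h : Decomposition T U p₀ L) :
    (hull U L).bdry = pairs U ++ L.flatMap fun p => pairs p.V := by
  unfold HoledPolygon.bdry HoledPolygon.cycles hull
  rw [List.flatMap_cons, h.edges_outer, List.flatMap_map]
  congr 1
  simp only [List.flatMap]
  congr 1
  exact List.map_congr_left fun p hp => (h.piece p (List.mem_cons_of_mem _ hp)).edges hT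

lemma Decomposition.mem_outer (h : Decomposition T U p₀ L) : ∀ e ∈ pairs U, e.1 ∈ P ∧ e.2 ∈ P :=
  fun _ he => ⟨h.mem _ (mem_of_mem_pairs he).1, h.mem _ (mem_of_mem_pairs he).2⟩

lemma Decomposition.mem_walk (h : Decomposition T U p₀ L) {e : ℂ × ℂ} :
    e ∈ pairs p₀.V ↔ e ∈ pairs U ∨ e.swap ∈ frame P B := by
  rw [h.walk, mem_pairs_walk h.head h.last]

lemma Decomposition.disjoint_pairs (hT : VertexTriangulation (donut P B) T.tri)
    (h : Decomposition T U p₀ L) {p q : Piece} (hp : p ∈ p₀ :: L) (hq : q ∈ p₀ :: L)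
    (hd : Disjoint p.S q.S) {e : ℂ × ℂ} (he : e ∈ pairs p.V) : e ∉ pairs q.V := by
  intro he'
  obtain ⟨⟨a, b, D⟩, -⟩ := h.piece p hp
  obtain ⟨⟨a', b', D'⟩, -⟩ := h.piece q hq
  obtain ⟨t, ht, hs⟩ := D.side_of_pair e he
  obtain ⟨t', ht', hs'⟩ := D'.side_of_pair e he'
  have := hT.eq_of_side (D.sub ht) (D'.sub ht') hs hs'
  subst this
  exact Finset.disjoint_left.1 hd ht ht'

lemma Decomposition.mem_bdry (hP : IsInput P) (hB : IsContainingBox P B)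
    (hT : VertexTriangulation (donut P B) T.tri)
    (hsep : ∀ e, T.IsSeparator e → e.1 ∈ P ∧ e.2 ∈ P) (h : Decomposition T U p₀ L) {e : ℂ × ℂ} :
    e ∈ (hull U L).bdry ↔ T.IsSeparator e := by
  rw [h.bdry hT, List.mem_append, List.mem_flatMap]
  have hd := List.pairwise_cons.1 h.disjoint
  constructor
  · intro he
    have key : ∀ p ∈ p₀ :: L, e ∈ pairs p.V → T.IsSeparator e ∨ e.swap ∈ frame P B := by
      intro p hp he
      obtain ⟨⟨a, b, D⟩, h1, -, h2⟩ := h.piece p hp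
      obtain ⟨t, ht, hs⟩ := D.side_of_pair _ he
      rcases Labeled.side_cases hP.ne_nil hT (h1 ht) hs with h3 | h3 | ⟨h3, t', ht', hs'⟩
      · exact Or.inl h3
      · exact Or.inr h3
      · exact absurd hs' (h2 _ _ he h3 t' ht')
    rcases he with he | ⟨p, hp, he⟩
    · refine (key p₀ List.mem_cons_self (h.mem_walk.2 (Or.inl he))).resolve_right fun hf => ?_
      have := h.mem_outer e he
      exact hB.frame_notMem hf ⟨this.2, this.1⟩
    · refine (key p (List.mem_cons_of_mem _ hp) he).resolve_right fun hf => ?_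
      exact h.disjoint_pairs hT List.mem_cons_self (List.mem_cons_of_mem _ hp) (hd.1 p hp)
        (h.mem_walk.2 (Or.inr hf)) he
  · intro he
    obtain ⟨⟨t, ht, hl, hs⟩, -⟩ := id he
    obtain ⟨p, hp, htp⟩ := (h.cover t).1 (Labeled.mem_inactive.2 ⟨ht, hl⟩)
    obtain ⟨⟨a, b, D⟩, h1, -, -⟩ := h.piece p hp
    have hep : e ∈ pairs p.V := by
      rcases D.pair_of_side t htp _ _ hs with h2 | h2 | h2
      · exact h2
      · obtain ⟨-, t', ht', hs'⟩ := D.glued_side _ h2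
        exact absurd he (Labeled.not_isSeparator hP.ne_nil hT (D.glued_inner _ h2) (h1 ht') hs')
      · obtain ⟨⟨t', ht', hs'⟩, -⟩ := D.glued_side _ h2
        refine absurd he (Labeled.not_isSeparator hP.ne_nil hT ?_ (h1 ht') hs')
        rw [openSeg_swap]; exact D.glued_inner _ h2
    rcases List.mem_cons.1 hp with rfl | hp
    · refine Or.inl ((h.mem_walk.1 hep).resolve_right fun hf => ?_)
      have := hsep e he
      exact hB.frame_notMem hf ⟨this.2, this.1⟩
    · exact Or.inr ⟨p, hp, hep⟩

lemma Decomposition.nodup (hT : VertexTriangulation (donut P B) T.tri)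
    (h : Decomposition T U p₀ L) : (hull U L).bdry.Nodup := by
  rw [h.bdry hT]
  have hd := List.pairwise_cons.1 h.disjoint
  rw [List.nodup_append]
  refine ⟨?_, ?_, ?_⟩
  · have := h.root.nodup
    rw [h.walk, pairs_cut h.head h.last, List.nodup_cons] at this
    exact (List.nodup_append.1 this.2).1
  · rw [List.nodup_flatMap]
    refine ⟨fun p hp => ?_, ?_⟩
    · obtain ⟨⟨a, b, D⟩, -⟩ := h.piece p (List.mem_cons_of_mem _ hp)
      exact D.nodup
    · refine List.Pairwise.imp_of_mem ?_ hd.2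
      intro p q hp hq hpq e he he'
      exact h.disjoint_pairs hT (List.mem_cons_of_mem _ hp) (List.mem_cons_of_mem _ hq) hpq he he'
  · rintro e he _ he' rfl
    obtain ⟨p, hp, he'⟩ := List.mem_flatMap.1 he'
    exact h.disjoint_pairs hT List.mem_cons_self (List.mem_cons_of_mem _ hp) (hd.1 p hp)
      (h.mem_walk.2 (Or.inl he)) he'

lemma Decomposition.forms (hP : IsInput P) (hB : IsContainingBox P B)
    (hT : VertexTriangulation (donut P B) T.tri)
    (hsep : ∀ e, T.IsSeparator e → e.1 ∈ P ∧ e.2 ∈ P) (h : Decomposition T U p₀ L) :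
    T.Forms (hull U L) := by
  unfold Labeled.Forms
  refine (Multiset.Nodup.ext (Multiset.coe_nodup.2 (h.nodup hT)) T.separators.nodup).2 fun e => ?_
  rw [Multiset.mem_coe, h.mem_bdry hP hB hT hsep, Finset.mem_val, T.mem_separators]

/-- The outer boundary surrounds what is left of the rectangle when the disc at the cut edge is
removed. -/
lemma Decomposition.asum_outer (h : Decomposition T U p₀ L) {z : ℂ} (hz : z ∈ offFrontiers T.tri) :
    asum (pairs U) z = (∑ t ∈ p₀.S, (interior (body t)).indicator (fun _ => 2 * Real.pi) z) -
      asum B.ccw z := by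
  have h1 := h.root.wind z hz
  have hcut : z ∉ seg (B.q₁, P.headI) := by
    have hm : (B.q₁, P.headI) ∈ pairs p₀.V := by
      rw [h.walk, pairs_cut h.head h.last]; exact List.mem_cons_self
    obtain ⟨t, ht, hs⟩ := h.root.side_of_pair _ hm
    exact IsSide.notMem_seg hs (hz t (h.root.sub ht))
  rw [h.walk, asum_cut h.head h.last hcut] at h1
  have h2 : asum (pairs [B.q₁, B.q₄, B.q₃, B.q₂, B.q₁]) z = asum B.ccw z := rfl
  rw [h2] at h1
  linarith

/-- The hull is what is left of the rectangle when the inactive triangles are removed. -/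
lemma Decomposition.asum_bdry (hT : VertexTriangulation (donut P B) T.tri)
    (h : Decomposition T U p₀ L) {z : ℂ} (hz : z ∈ offFrontiers T.tri) :
    asum (hull U L).bdry z = (∑ t ∈ T.inactive, (interior (body t)).indicator
      (fun _ => 2 * Real.pi) z) - asum B.ccw z := by
  rw [h.bdry hT, asum_append, asum_flatMap, h.asum_outer hz, ← sum_pieces h.disjoint h.cover,
    List.map_cons, List.sum_cons]
  have : (L.map fun p => asum (pairs p.V) z) = L.map fun p => ∑ t ∈ p.S,
      (interior (body t)).indicator (fun _ => 2 * Real.pi) z := by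
    apply List.map_congr_left
    intro p hp
    obtain ⟨⟨a, b, D⟩, -⟩ := h.piece p (List.mem_cons_of_mem _ hp)
    exact D.wind z hz
  rw [this]; ring

/-- Removing the triangles of `S` from the rectangle leaves a region with winding number `-1`. -/
lemma sum_sub_ccw (hP : IsInput P) (hB : IsContainingBox P B)
    (hT : VertexTriangulation (donut P B) T.tri) {S : Finset (Finset ℂ)} (hS : S ⊆ T.tri) {z : ℂ}
    (hz : ∀ e ∈ B.ccw, z ∉ seg e) :
    ((z ∈ B.inside ∧ ∀ t ∈ S, z ∉ interior (body t)) ∧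
      (∑ t ∈ S, (interior (body t)).indicator (fun _ => 2 * Real.pi) z) - asum B.ccw z =
        -(2 * Real.pi)) ∨
    ((z ∈ B.inside → ∃ t ∈ S, z ∈ interior (body t)) ∧
      (∑ t ∈ S, (interior (body t)).indicator (fun _ => 2 * Real.pi) z) - asum B.ccw z = 0) := by
  obtain ⟨hlr, hbt⟩ := hB.lt hP.ne_nil
  rcases B.asum_ccw_cases hlr hbt hz with ⟨h1, h2⟩ | ⟨h1, h2⟩ <;>
    rcases sum_indicator_cases hT hS z with ⟨h3, h4⟩ | ⟨h3, h4⟩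
  · exact Or.inr ⟨fun _ => h3, by rw [h2, h4]; ring⟩
  · exact Or.inl ⟨⟨h1, h3⟩, by rw [h2, h4]; ring⟩
  · obtain ⟨t, ht, hzt⟩ := h3
    exact absurd (inner_donut_subset hP hB (hT.inside t (hS ht) hzt)) h1
  · exact Or.inr ⟨fun h => absurd h h1, by rw [h2, h4]; ring⟩

lemma Decomposition.asum_outer_cases (hP : IsInput P) (hB : IsContainingBox P B)
    (hT : VertexTriangulation (donut P B) T.tri) (h : Decomposition T U p₀ L) {z : ℂ}
    (hz : ∀ e ∈ pairs U, z ∉ seg e) :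
    asum (pairs U) z = 0 ∨ asum (pairs U) z = -(2 * Real.pi) := by
  apply asum_off_of_ae (isCycle_pairs h.head h.last) (p := fun x => x = 0 ∨ x = -(2 * Real.pi)) _ hz
  filter_upwards [ae_offFrontiers T.tri, ae_off B.ccw] with w h1 h2
  rw [h.asum_outer h1]
  rcases sum_sub_ccw hP hB hT h.root.sub h2 with ⟨-, h3⟩ | ⟨-, h3⟩
  · exact Or.inr h3
  · exact Or.inl h3

/-- The exterior consists, up to boundary points, of the disc at the cut edge and the complement
of the rectangle. -/
lemma Decomposition.connectedExterior (hP : IsInput P) (hB : IsContainingBox P B)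
    (hT : VertexTriangulation (donut P B) T.tri) (h : Decomposition T U p₀ L) :
    (hull U L).ConnectedExterior := by
  have hpi := Real.pi_pos
  obtain ⟨hlr, hbt⟩ := hB.lt hP.ne_nil
  have hcyc := isCycle_pairs h.head h.last
  have hout : ∀ z, z ∈ outside (hull U L).outer ↔
      (∀ e ∈ pairs U, z ∉ seg e) ∧ asum (pairs U) z = 0 := by
    intro z
    unfold outside
    rw [Set.mem_ofPred_eq, notMem_trace, winding_eq, show (hull U L).outer = U.dropLast from rfl,
      h.edges_outer, div_eq_zero_iff, or_iff_left (by positivity)]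
  -- the disc at the cut edge and the complement of the rectangle are joined across the upper side
  set m : ℂ := (B.q₂, B.q₁).1 + (1 / 2 : ℝ) • ((B.q₂, B.q₁).2 - (B.q₂, B.q₁).1) with hm
  have hmo : m ∈ openSeg (B.q₂, B.q₁) := openSeg_midpoint _
  have hmc : (B.q₂, B.q₁) ∈ B.ccw := by simp [Box.ccw]
  have hmB : m ∈ B.insideᶜ := fun hmB => B.off_ccw m hmB _ hmc (openSeg_subset_seg _ hmo)
  obtain ⟨t₁, ht₁, hs₁⟩ := h.root.side_of_pair (B.q₂, B.q₁)
    (h.mem_walk.2 (Or.inr (mem_frame.2 (Or.inl hmc))))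
  have hpre₀ : IsPreconnected (discOpen p₀.S p₀.Γ) := PolyJoined.isPreconnected h.root.joined
  have hmcl : m ∈ closure (discOpen p₀.S p₀.Γ) :=
    closure_mono (fun w hw => Or.inl ⟨t₁, ht₁, hw⟩)
      (hs₁.body_subset_closure (hs₁.seg_subset_body (openSeg_subset_seg _ hmo)))
  have hpre₁ : IsPreconnected (discOpen p₀.S p₀.Γ ∪ {m}) :=
    hpre₀.subset_closure Set.subset_union_left
      (Set.union_subset subset_closure (Set.singleton_subset_iff.2 hmcl))
  have hpre := IsPreconnected.union m (Or.inr rfl) hmB hpre₁ B.isPreconnected_compl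
  have hsub₂ : B.insideᶜ ⊆ outside (hull U L).outer := by
    intro z hz
    refine (hout z).2 ⟨fun e he hze => hz (hB.seg_subset (h.mem_outer e he) hze), ?_⟩
    exact B.asum_eq_zero hcyc (fun e he => ⟨hB.mem_inside (h.mem_outer e he).1,
      hB.mem_inside (h.mem_outer e he).2⟩) hz
  have hsub₁ : discOpen p₀.S p₀.Γ ⊆ outside (hull U L).outer := by
    have hoff : ∀ z ∈ discOpen p₀.S p₀.Γ, ∀ e ∈ pairs U, z ∉ seg e := fun z hz e he =>
      h.root.notMem_seg hT hz (h.mem_walk.2 (Or.inl he))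
    obtain ⟨w, hw, hwoff⟩ := exists_mem_offFrontiers (T := T.tri) isOpen_interior
      hs₁.interior_nonempty
    intro z hz
    refine (hout z).2 ⟨hoff z hz, ?_⟩
    rw [asum_const hcyc hpre₀ hoff hz (Or.inl ⟨t₁, ht₁, hw⟩), h.asum_outer hwoff,
      sum_indicator_of_mem hT h.root.sub ht₁ hw, B.asum_inside hlr hbt
        (inner_donut_subset hP hB (hT.inside _ (h.root.sub ht₁) hw)), sub_self]
  refine ⟨⟨m, hsub₂ hmB⟩, hpre.subset_closure
    (Set.union_subset (Set.union_subset hsub₁ (Set.singleton_subset_iff.2 (hsub₂ hmB))) hsub₂) ?_⟩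
  intro z hz
  obtain ⟨h1, h2⟩ := (hout z).1 hz
  rw [mem_closure_iff_nhds]
  intro N hN
  obtain ⟨N', hN', hN'o, hzN'⟩ := mem_nhds_iff.1 (Filter.inter_mem hN (asum_eventually hcyc h1))
  have hd : Dense {w : ℂ | w ∈ offFrontiers T.tri ∧ ∀ e ∈ B.ccw, w ∉ seg e} :=
    Measure.dense_of_ae ((ae_offFrontiers T.tri).and (ae_off B.ccw))
  obtain ⟨w, hw, hw1, hw2⟩ := hd.inter_open_nonempty N' hN'o ⟨z, hzN'⟩
  refine ⟨w, (hN' hw).1, ?_⟩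
  have h3 : asum (pairs U) w = asum (pairs U) z := (hN' hw).2.2
  rw [h2, h.asum_outer hw1] at h3
  by_cases hwB : w ∈ B.inside
  · rcases sum_sub_ccw hP hB hT h.root.sub hw2 with ⟨-, h4⟩ | ⟨h4, -⟩
    · linarith
    · exact Or.inl (Or.inl (Or.inl (h4 hwB)))
  · exact Or.inr hwB

lemma Decomposition.asum_bdry_ae (hP : IsInput P) (hB : IsContainingBox P B)
    (hT : VertexTriangulation (donut P B) T.tri) (h : Decomposition T U p₀ L) : ∀ᵐ z : ℂ,
    ((z ∈ B.inside ∧ ∀ t ∈ T.inactive, z ∉ interior (body t)) ∧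
      asum (hull U L).bdry z = -(2 * Real.pi)) ∨
    ((z ∈ B.inside → ∃ t ∈ T.inactive, z ∈ interior (body t)) ∧ asum (hull U L).bdry z = 0) := by
  filter_upwards [ae_offFrontiers T.tri, ae_off B.ccw] with w h1 h2
  rw [h.asum_bdry hT h1]
  exact sum_sub_ccw hP hB hT T.inactive_subset h2

lemma Decomposition.weaklySimple (hP : IsInput P) (hB : IsContainingBox P B)
    (hT : VertexTriangulation (donut P B) T.tri)
    (hsep : ∀ e, T.IsSeparator e → e.1 ∈ P ∧ e.2 ∈ P) (h : Decomposition T U p₀ L) :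
    (hull U L).WeaklySimple := by
  have hpi := Real.pi_pos
  have hside : ∀ e ∈ (hull U L).bdry, ∃ t ∈ T.tri, IsSide t e.1 e.2 := by
    intro e he
    obtain ⟨⟨t, ht, -, hs⟩, -⟩ := (h.mem_bdry hP hB hT hsep).1 he
    exact ⟨t, ht, hs⟩
  refine ⟨?_, ?_, ?_, ?_, ?_, ?_, ?_⟩
  · intro l hl
    rcases List.mem_cons.1 hl with rfl | hl
    · intro h0
      have h1 := congrArg List.length h0
      rw [show (hull U L).outer = U.dropLast from rfl, List.length_dropLast, List.length_nil] at h1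
      have := h.two_le
      omega
    · obtain ⟨p, hp, rfl⟩ := List.mem_map.1 hl
      exact (h.piece p (List.mem_cons_of_mem _ hp)).dropLast_ne hT
  · intro e he
    obtain ⟨t, -, hs⟩ := hside e he
    exact hs.ne
  · intro e he f hf
    obtain ⟨t, ht, hs⟩ := hside e he
    obtain ⟨t', ht', hs'⟩ := hside f hf
    exact hT.not_cross ht ht' hs hs'
  · have hcut : ∀ z ∈ openSeg (B.q₁, P.headI), z ∉ inner (donut P B) := fun z hz hzi =>
      hzi.1 ⟨_, (mem_edges_donut hP.ne_nil).2 (Or.inl (mem_frame.2 (Or.inr (Or.inl rfl)))),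
        openSeg_subset_seg _ hz⟩
    have hd := List.pairwise_cons.1 h.disjoint
    have key := nearlySimple_of_pairwise (L :=
      (discOpen p₀.S p₀.Γ ∪ openSeg (B.q₁, P.headI), U.dropLast) ::
        L.map fun p => (discOpen p.S p.Γ, p.V.dropLast)) ?_ ?_
    · rw [List.map_cons, List.map_map] at key
      exact key
    · refine List.pairwise_cons.2 ⟨?_, ?_⟩
      · intro q hq
        obtain ⟨p, hp, rfl⟩ := List.mem_map.1 hq
        refine Set.disjoint_union_left.2 ⟨(h.piece p₀ List.mem_cons_self).disjoint hT
          (h.piece p (List.mem_cons_of_mem _ hp)) (hd.1 p hp), ?_⟩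
        rw [Set.disjoint_left]
        intro z hz hz'
        obtain ⟨⟨a, b, D⟩, -⟩ := h.piece p (List.mem_cons_of_mem _ hp)
        exact hcut z hz (D.discOpen_subset_inner hT hz')
      · rw [List.pairwise_map]
        refine List.Pairwise.imp_of_mem ?_ hd.2
        intro p q hp hq hpq
        exact (h.piece p (List.mem_cons_of_mem _ hp)).disjoint hT
          (h.piece q (List.mem_cons_of_mem _ hq)) hpq
    · intro q hq
      rcases List.mem_cons.1 hq with rfl | hq
      · obtain ⟨n, F, g, M⟩ := h.root.model
        rw [h.walk] at M
        refine M.nearbyLoop_cut h.head h.last h.two_le ?_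
        rw [Set.disjoint_left]
        intro z hz hz'
        exact hcut z hz (h.root.discOpen_subset_inner hT hz')
      · obtain ⟨p, hp, rfl⟩ := List.mem_map.1 hq
        exact (h.piece p (List.mem_cons_of_mem _ hp)).nearbyLoop hT
  · intro z hz
    rw [notMem_trace, show (hull U L).outer = U.dropLast from rfl, h.edges_outer] at hz
    rw [winding_eq, show (hull U L).outer = U.dropLast from rfl, h.edges_outer]
    rcases h.asum_outer_cases hP hB hT hz with h1 | h1
    · left; rw [h1, zero_div]
    · right; rw [h1]; field_simp
  · intro l hl z hz
    obtain ⟨p, hp, rfl⟩ := List.mem_map.1 hl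
    have hp' := h.piece p (List.mem_cons_of_mem _ hp)
    obtain ⟨⟨a, b, D⟩, -⟩ := id hp'
    rw [notMem_trace, hp'.edges hT] at hz
    rw [winding_eq, hp'.edges hT]
    have : asum (pairs p.V) z = 0 ∨ asum (pairs p.V) z = 2 * Real.pi := by
      apply asum_off_of_ae (isCycle_pairs D.head D.last) (p := fun x => x = 0 ∨ x = 2 * Real.pi) _ hz
      filter_upwards [ae_offFrontiers T.tri] with w h1
      rw [D.wind w h1]
      rcases sum_indicator_cases hT D.sub w with ⟨-, h3⟩ | ⟨-, h3⟩
      · exact Or.inr h3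
      · exact Or.inl h3
    rcases this with h1 | h1
    · left; rw [h1, zero_div]
    · right; rw [h1]; field_simp
  · intro z hz
    have hz' : ∀ e ∈ (hull U L).bdry, z ∉ seg e := fun e he hze => hz ⟨e, he, hze⟩
    rw [winding_bdry]
    have : asum (hull U L).bdry z = 0 ∨ asum (hull U L).bdry z = -(2 * Real.pi) := by
      apply asum_off_of_ae (isCycle_bdry _) (p := fun x => x = 0 ∨ x = -(2 * Real.pi)) _ hz'
      filter_upwards [h.asum_bdry_ae hP hB hT] with w h1
      rcases h1 with ⟨-, h1⟩ | ⟨-, h1⟩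
      · exact Or.inr h1
      · exact Or.inl h1
    rcases this with h1 | h1
    · left; rw [h1, zero_div]
    · right; rw [h1]; field_simp

/-- If a point of `P` were not covered by the hull, inactive triangles would fill a neighbourhood of
it. These do not meet the interior of `P`, and their sides along edges of `P` are boundary edges of
the hull. -/
lemma Decomposition.contains (hP : IsInput P) (hB : IsContainingBox P B)
    (hT : VertexTriangulation (donut P B) T.tri)
    (hsep : ∀ e, T.IsSeparator e → e.1 ∈ P ∧ e.2 ∈ P) (h : Decomposition T U p₀ L) :
    (solid P).region ⊆ (hull U L).region := by
  have hpi := Real.pi_pos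
  intro z hz
  by_contra hc
  unfold HoledPolygon.region at hz hc
  rw [Set.mem_ofPred_eq, trace_solid, winding_solid] at hz
  rw [Set.mem_ofPred_eq, not_or, not_not, winding_bdry, div_eq_zero_iff,
    or_iff_left (by positivity)] at hc
  obtain ⟨hc1, hc2⟩ := hc
  have hoff : ∀ e ∈ (hull U L).bdry, z ∉ seg e := fun e he hze => hc1 ⟨e, he, hze⟩
  have hzB : z ∈ B.inside := by
    rcases hz with hz | hz
    · exact hB.trace_subset hz
    · by_contra hzB
      apply hz
      rw [winding_eq, B.asum_eq_zero (isCycle_edges P) (fun e he =>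
        ⟨hB.mem_inside (mem_of_mem_edges he).1, hB.mem_inside (mem_of_mem_edges he).2⟩) hzB, zero_div]
  obtain ⟨N, hN, hNo, hzN⟩ := mem_nhds_iff.1 (Filter.inter_mem (B.isOpen_inside.mem_nhds hzB)
    (asum_eventually (isCycle_bdry _) hoff))
  -- near `z` there are only inactive triangles
  have hcov : ∀ᵐ w : ℂ, w ∈ N → ∃ t ∈ T.inactive, w ∈ interior (body t) := by
    filter_upwards [h.asum_bdry_ae hP hB hT] with w h1 hw
    rcases h1 with ⟨-, h1⟩ | ⟨h1, -⟩
    · have h2 : asum (hull U L).bdry w = asum (hull U L).bdry z := (hN hw).2.2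
      rw [h1, hc2] at h2
      linarith
    · exact h1 (hN hw).1
  by_cases hzP : z ∈ trace P
  · obtain ⟨e, he, hze⟩ := hzP
    obtain ⟨t, ht, x, y, hs, hyx, -, w, hwN, hw1, hw2⟩ := hT.exists_side_of_cover T.inactive_subset
      hNo (hcov.mono fun w h1 hw => (h1 hw).imp fun t ht => ⟨ht.1, interior_subset ht.2⟩)
      (hP.weaklySimple.nondegenerate e (by rw [bdry_solid]; exact he))
      (fun w hw => trace_subset_donut hP.ne_nil B ⟨e, he, hw⟩) hze hzN
    obtain ⟨htT, hl⟩ := Labeled.mem_inactive.1 ht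
    have hxy : (x, y) ∈ edges P := by
      refine ((mem_edges_donut hP.ne_nil).1 hyx).resolve_left fun hf => ?_
      exact frame_disjoint hP hB hf (by rw [openSeg_swap]; exact hw1)
        ⟨e, he, openSeg_subset_seg _ hw2⟩
    have hb : (x, y) ∈ (hull U L).bdry :=
      (h.mem_bdry hP hB hT hsep).2 ⟨⟨t, htT, hl, hs⟩, Or.inl hxy⟩
    exact (hN hwN).2.1 _ hb (openSeg_subset_seg _ hw1)
  · have hz := hz.resolve_left hzP
    obtain ⟨N', hN', hN'o, hzN'⟩ := mem_nhds_iff.1 (Filter.inter_mem (hNo.mem_nhds hzN)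
      (asum_eventually (isCycle_edges P) (notMem_trace.1 hzP)))
    have hd : Dense {w : ℂ | w ∈ N → ∃ t ∈ T.inactive, w ∈ interior (body t)} :=
      Measure.dense_of_ae hcov
    obtain ⟨w, hw, hw'⟩ := hd.inter_open_nonempty N' hN'o ⟨z, hzN'⟩
    obtain ⟨t, ht, hwt⟩ := hw' (hN' hw).1
    have hwi := hT.inside t (T.inactive_subset ht) hwt
    have h1 := ((mem_inner_donut hP hB hwi.1).1 hwi).2
    have h2 : asum (edges P) w = asum (edges P) z := (hN' hw).2.2
    apply hz
    rw [winding_eq, ← h2, h1, zero_div]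

end


/-! ### Area and cost -/

section
variable {P : List ℂ} {C : Set (ℂ × ℂ)} {B : Box} {E : Set (ℂ × ℂ)}

lemma notMem_interior_of_mem_inner (hP : IsInput P) (hB : IsContainingBox P B)
    {T : Finset (Finset ℂ)} (hT : VertexTriangulation (donut P B) T) {z : ℂ} (hz : z ∈ inner P) :
    ∀ t ∈ T, z ∉ interior (body t) := by
  intro t ht hzt
  have hzi := hT.inside t ht hzt
  apply hz.2
  rw [winding_eq, ((mem_inner_donut hP hB hzi.1).1 hzi).2, zero_div]

/-- The polygon `P` and the triangles fill the rectangle. -/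
lemma ae_mem_inside (hP : IsInput P) (hB : IsContainingBox P B) {T : Finset (Finset ℂ)}
    (hT : VertexTriangulation (donut P B) T) :
    ∀ᵐ z : ℂ, z ∈ B.inside ↔ z ∈ inner P ∨ ∃ t ∈ T, z ∈ interior (body t) := by
  have hpi := Real.pi_pos
  filter_upwards [ae_offFrontiers T, ae_off (edges (donut P B))] with z h1 h2
  have hzD : z ∉ trace (donut P B) := notMem_trace.2 h2
  have hzP := (notMem_trace_donut hP.ne_nil hzD).1
  have hin : z ∈ inner P ↔ asum (edges P) z ≠ 0 := by
    unfold inner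
    rw [Set.mem_ofPred_eq, winding_eq, and_iff_right hzP, Ne, div_eq_zero_iff,
      or_iff_left (by positivity)]
  constructor
  · intro hz
    rw [hin]
    by_cases h0 : asum (edges P) z = 0
    · right
      have := hT.cover ((mem_inner_donut hP hB hzD).2 ⟨hz, h0⟩)
      simp only [Set.mem_iUnion] at this
      obtain ⟨t, ht, hzt⟩ := this
      refine ⟨t, ht, ?_⟩
      by_contra hc
      exact h1 t ht ⟨subset_closure hzt, hc⟩
    · exact Or.inl h0
  · rintro (h | ⟨t, ht, h⟩)
    · by_contra hz
      exact hin.1 h (B.asum_eq_zero (isCycle_edges P) (fun e he =>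
        ⟨hB.mem_inside (mem_of_mem_edges he).1, hB.mem_inside (mem_of_mem_edges he).2⟩) hz)
    · exact inner_donut_subset hP hB (hT.inside t ht h)

/-- The interior of `P` together with the active triangles; up to a null set, this is the region
of the hull. -/
def Labeled.filled (T : Labeled P B E) : Set ℂ := inner P ∪ ⋃ t ∈ T.active, interior (body t)

lemma Labeled.mem_filled {T : Labeled P B E} {z : ℂ} :
    z ∈ T.filled ↔ z ∈ inner P ∨ ∃ t ∈ T.active, z ∈ interior (body t) := by
  simp [Labeled.filled]

lemma mem_region_iff {Q : HoledPolygon} {z : ℂ} (hz : ∀ e ∈ Q.bdry, z ∉ seg e) :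
    z ∈ Q.region ↔ asum Q.bdry z ≠ 0 := by
  have hpi := Real.pi_pos
  unfold HoledPolygon.region
  rw [Set.mem_ofPred_eq, or_iff_right, winding_bdry, Ne, div_eq_zero_iff,
    or_iff_left (by positivity)]
  rintro ⟨e, he, hze⟩
  exact hz e he hze

lemma region_solid_ae (P : List ℂ) : (solid P).region =ᵐ[volume] inner P := by
  rw [Filter.eventuallyEq_set]
  filter_upwards [ae_off (edges P)] with z hz
  have hz := notMem_trace.2 hz
  unfold HoledPolygon.region inner
  rw [Set.mem_ofPred_eq, Set.mem_ofPred_eq, trace_solid, winding_solid, or_iff_right hz,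
    and_iff_right hz]

lemma volume_interior_body (t : Finset ℂ) : volume (interior (body t)) = volume (body t) := by
  apply measure_congr
  rw [Filter.eventuallyEq_set]
  filter_upwards [measure_eq_zero_iff_ae_notMem.1 (volume_frontier_body t)] with z hz
  exact ⟨fun h => interior_subset h, fun h => by_contra fun hc => hz ⟨subset_closure h, hc⟩⟩

lemma volume_inner_lt_top (hB : IsContainingBox P B) : volume (inner P) < ⊤ := by
  have hsub : inner P ⊆ Set.Icc B.left B.right ×ℂ Set.Icc B.bottom B.top := by
    intro z hz
    have hzB : z ∈ B.inside := by
      by_contra hc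
      apply hz.2
      rw [winding_eq, B.asum_eq_zero (isCycle_edges P) (fun e he =>
        ⟨hB.mem_inside (mem_of_mem_edges he).1, hB.mem_inside (mem_of_mem_edges he).2⟩) hc, zero_div]
    obtain ⟨h1, h2, h3, h4⟩ := hzB
    exact Complex.mem_reProdIm.2 ⟨⟨h1.le, h2.le⟩, h3.le, h4.le⟩
  exact (measure_mono hsub).trans_lt (isCompact_Icc.reProdIm isCompact_Icc).measure_lt_top

lemma area_of_region_ae (hP : IsInput P) (hB : IsContainingBox P B) {T : Labeled P B E}
    (hT : VertexTriangulation (donut P B) T.tri) {Q : HoledPolygon}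
    (hQ : Q.region =ᵐ[volume] T.filled) : Q.area = T.area + (solid P).area := by
  have h1 : volume T.filled = volume (inner P) + ∑ t ∈ T.active, volume (body t) := by
    unfold Labeled.filled
    rw [measure_union _ (T.active.measurableSet_biUnion fun t _ => isOpen_interior.measurableSet),
      measure_biUnion_finset _ fun t _ => isOpen_interior.measurableSet]
    · simp only [volume_interior_body]
    · intro t ht t' ht' hne
      exact hT.disjoint t (Labeled.mem_active.1 ht).1 t' (Labeled.mem_active.1 ht').1 hne
    · rw [Set.disjoint_left]
      intro z hz hz'
      simp only [Set.mem_iUnion] at hz'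
      obtain ⟨t, ht, hzt⟩ := hz'
      exact notMem_interior_of_mem_inner hP hB hT hz t (Labeled.mem_active.1 ht).1 hzt
  have hfin : ∀ t ∈ T.active, volume (body t) ≠ ⊤ := fun t _ =>
    (isCompact_body t).measure_lt_top.ne
  unfold HoledPolygon.area Labeled.area
  rw [measure_congr hQ, measure_congr (region_solid_ae P), h1,
    ENNReal.toReal_add (volume_inner_lt_top hB).ne (ENNReal.sum_lt_top.2 fun t ht =>
      (hfin t ht).lt_top).ne, ENNReal.toReal_sum hfin, add_comm]
  rfl

lemma Labeled.cost_add {lam : ℝ} (hlam : lam ∈ Set.Icc (0 : ℝ) 1) {T : Labeled P B E}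
    (hC : ∀ e, T.IsSeparator e → e ∈ C) :
    T.cost C lam + ENNReal.ofReal ((1 - lam) * (solid P).area) = ENNReal.ofReal
      (lam * ∑ e ∈ T.separators, dist e.1 e.2 + (1 - lam) * (T.area + (solid P).area)) := by
  have h1 : 0 ≤ 1 - lam := by linarith [hlam.2]
  have h2 : 0 ≤ T.area := Finset.sum_nonneg fun _ _ => ENNReal.toReal_nonneg
  have h3 : 0 ≤ (solid P).area := ENNReal.toReal_nonneg
  have h4 : 0 ≤ ∑ e ∈ T.separators, dist e.1 e.2 := Finset.sum_nonneg fun _ _ => dist_nonneg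
  unfold Labeled.cost
  rw [if_pos fun e he => hC e (T.mem_separators.1 he), ← ENNReal.ofReal_add
    (add_nonneg (mul_nonneg hlam.1 h4) (mul_nonneg h1 h2)) (mul_nonneg h1 h3)]
  congr 1
  ring

lemma Labeled.mem_of_cost_lt_top {lam : ℝ} {T : Labeled P B E} (h : T.cost C lam < ⊤) :
    ∀ e, T.IsSeparator e → e ∈ C := by
  intro e he
  unfold Labeled.cost at h
  split_ifs at h with h1
  · exact h1 e (T.mem_separators.2 he)
  · exact absurd h (lt_irrefl _)

lemma Labeled.Forms.perimeter {T : Labeled P B E} {Q : HoledPolygon} (h : T.Forms Q) :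
    Q.perimeter = ∑ e ∈ T.separators, dist e.1 e.2 := by
  unfold HoledPolygon.perimeter Finset.sum
  rw [← h, Multiset.map_coe, Multiset.sum_coe]

/-- The separators of a labeled triangulation of finite cost form a hull. -/
lemma Labeled.exists_hull (hP : IsInput P) (hC : IsShortcuts P C) (hB : IsContainingBox P B)
    {T : Labeled P B E} (hT : VertexTriangulation (donut P B) T.tri)
    (hsepC : ∀ e, T.IsSeparator e → e ∈ C) :
    ∃ Q, IsHull P C Q ∧ T.Forms Q ∧ Q.region =ᵐ[volume] T.filled := by
  have hpi := Real.pi_pos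
  have hsep : ∀ e, T.IsSeparator e → e.1 ∈ P ∧ e.2 ∈ P := fun e he =>
    ⟨(hC e (hsepC e he)).2.1, (hC e (hsepC e he)).2.2.1⟩
  obtain ⟨U, p₀, L, h⟩ := T.exists_decomposition hP hB hT hsep
  refine ⟨hull U L, ⟨h.weaklySimple hP hB hT hsep, h.connectedExterior hP hB hT,
    fun e he => hsepC e ((h.mem_bdry hP hB hT hsep).1 he), h.contains hP hB hT hsep⟩,
    h.forms hP hB hT hsep, ?_⟩
  rw [Filter.eventuallyEq_set]
  filter_upwards [h.asum_bdry_ae hP hB hT, ae_off (hull U L).bdry, ae_mem_inside hP hB hT]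
    with z h1 h2 h3
  have h4 := mem_region_iff h2
  rw [h4, Labeled.mem_filled]
  constructor
  · intro h5
    rcases h1 with ⟨⟨h6, h7⟩, -⟩ | ⟨-, h6⟩
    · refine (h3.1 h6).imp_right ?_
      rintro ⟨t, ht, hzt⟩
      refine ⟨t, Labeled.mem_active.2 ⟨ht, ?_⟩, hzt⟩
      cases hl : T.label t with
      | true => rfl
      | false => exact absurd hzt (h7 t (Labeled.mem_inactive.2 ⟨ht, hl⟩))
    · exact absurd h6 h5
  · intro h5
    rcases h1 with ⟨-, h6⟩ | ⟨h6, -⟩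
    · rw [h6]; linarith
    · exfalso
      rcases h5 with h5 | ⟨t, ht, hzt⟩
      · obtain ⟨t, ht, hzt⟩ := h6 (h3.2 (Or.inl h5))
        exact notMem_interior_of_mem_inner hP hB hT h5 t (T.inactive_subset ht) hzt
      · obtain ⟨ht, hl⟩ := Labeled.mem_active.1 ht
        obtain ⟨t', ht', hzt'⟩ := h6 (h3.2 (Or.inr ⟨t, ht, hzt⟩))
        obtain ⟨ht', hl'⟩ := Labeled.mem_inactive.1 ht'
        rw [hT.eq_of_mem_interior ht ht' hzt hzt', hl'] at hl
        exact Bool.false_ne_true hl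

/-! ### The triangulation of a hull -/

lemma IsHull.asum_cases {Q : HoledPolygon} (hQ : IsHull P C Q) {z : ℂ}
    (hz : ∀ e ∈ Q.bdry, z ∉ seg e) : asum Q.bdry z = 0 ∨ asum Q.bdry z = -(2 * Real.pi) := by
  have hpi := Real.pi_pos
  have hz' : z ∉ Q.trace := by
    rintro ⟨e, he, hze⟩
    exact hz e he hze
  rcases hQ.weaklySimple.total z hz' with h | h
  · left
    rw [winding_bdry, div_eq_zero_iff] at h
    exact h.resolve_right (by positivity)
  · right
    rw [winding_bdry, div_eq_iff (by positivity)] at h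
    linarith

/-- A triangulation that contains the boundary of a hull, with the triangles in the hull active. -/
lemma IsHull.exists_labeled (hP : IsInput P) (hC : IsShortcuts P C) (hB : IsContainingBox P B)
    (hE : IsEnrichment C (donut P B) E) {Q : HoledPolygon} (hQ : IsHull P C Q) :
    ∃ T : Labeled P B E, (∀ e ∈ Q.bdry, IsPartOf e T.tri) ∧ ∀ t ∈ T.tri, ∀ z ∈ interior (body t),
      asum Q.bdry z = if T.label t then -(2 * Real.pi) else 0 := by
  classical
  have hpi := Real.pi_pos
  obtain ⟨T, hT, hpart⟩ := hE.extend {e | e ∈ Q.bdry} (fun e he => hQ.bdry_mem e he)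
    hQ.weaklySimple.noncrossing
  have hV := hT.vertexTriangulation hE.endpoints
  have hoff : ∀ t ∈ T, ∀ z ∈ interior (body t), ∀ e ∈ Q.bdry, z ∉ seg e := by
    intro t ht z hz e he hze
    obtain ⟨⟨t', ht', hs | hs⟩, -⟩ := hpart e he
    · exact hV.notMem_interior ht' ht hs hze hz
    · exact hV.notMem_interior ht' ht hs (by rw [seg_swap]; exact hze) hz
  have hconst : ∀ t ∈ T, ∀ z ∈ interior (body t), ∀ w ∈ interior (body t),
      asum Q.bdry z = asum Q.bdry w := fun t ht z hz w hw =>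
    asum_const (isCycle_bdry Q) (convex_body t).interior.isPreconnected (hoff t ht) hz hw
  let label : Finset ℂ → Bool := fun t => decide (∃ z ∈ interior (body t), asum Q.bdry z ≠ 0)
  refine ⟨⟨T, hT, label, ?_⟩, hpart, ?_⟩
  · intro t ht hs
    have hopen : IsOpen {w : ℂ | P.headI.im < w.im} :=
      isOpen_lt continuous_const Complex.continuous_im
    -- near the cut edge, the triangle lies above `P`
    obtain ⟨w, hw1, hw2⟩ : ∃ w ∈ interior (body t), P.headI.im < w.im := by
      rcases hs with hs | hs
      · have hm := openSeg_midpoint (P.headI, B.q₁)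
        exact mem_closure_iff.1 (hs.body_subset_closure
          (hs.seg_subset_body (openSeg_subset_seg _ hm))) _ hopen
          (hB.cut_im hP.ne_nil (by rw [openSeg_swap]; exact hm)).1 |>.imp fun w hw => ⟨hw.2, hw.1⟩
      · have hm := openSeg_midpoint (B.q₁, P.headI)
        exact mem_closure_iff.1 (hs.body_subset_closure
          (hs.seg_subset_body (openSeg_subset_seg _ hm))) _ hopen
          (hB.cut_im hP.ne_nil hm).1 |>.imp fun w hw => ⟨hw.2, hw.1⟩
    have hw0 := hP.asum_above (isCycle_bdry Q) (fun e he =>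
      ⟨(hC e (hQ.bdry_mem e he)).2.1, (hC e (hQ.bdry_mem e he)).2.2.1⟩) hw2
    apply decide_eq_false
    rintro ⟨z, hz, hz0⟩
    exact hz0 ((hconst t ht z hz w hw1).trans hw0)
  · intro t ht z hz
    by_cases h : ∃ z ∈ interior (body t), asum Q.bdry z ≠ 0
    · have hl : label t = true := decide_eq_true h
      simp only [hl, if_true]
      obtain ⟨w, hw, hw0⟩ := h
      rw [hconst t ht z hz w hw]
      exact (hQ.asum_cases (hoff t ht w hw)).resolve_left hw0
    · have hl : label t = false := decide_eq_false h
      simp only [hl, Bool.false_eq_true, if_false]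
      by_contra hc
      exact h ⟨z, hz, hc⟩

lemma GenericAt.eventually_notMem {z d : ℂ} {e : ℂ × ℂ} (hd : d ≠ 0) (h : GenericAt z d e) :
    ∀ᶠ ε : ℝ in 𝓝[>] 0, z - ε * (Complex.I * d) ∉ seg e := by
  by_cases hz : z ∈ seg e
  · obtain ⟨-, r, hr, hrd⟩ := h hz
    filter_upwards [self_mem_nhdsWithin] with ε hε hmem
    have hε : 0 < ε := hε
    have h1 := orient_eq_zero_of_mem_seg hmem
    have h2 : z - ε * (Complex.I * d) = z + ((-ε : ℝ) : ℂ) * (Complex.I * d) := by push_cast; ring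
    rw [h2, orient_add_normal _ _ _ _ _ r hrd, orient_eq_zero_of_mem_seg hz, zero_add] at h1
    have h3 := (Complex.normSq_pos.2 hd).ne'
    simp [hr, hε.ne', h3] at h1
  · exact (tendsto_normal' z d).eventually ((isClosed_seg e).isOpen_compl.mem_nhds hz)

/-- Every separator is a boundary edge of the hull. Across it the winding number of the hull
jumps, except at edges of `P` where the hull has no interior on either side; these are covered by
the boundary of the hull, which then passes through them in both directions. -/
lemma IsHull.separator_mem {Q : HoledPolygon} (hQ : IsHull P C Q)
    {T : Labeled P B E} (hpart : ∀ e ∈ Q.bdry, IsPartOf e T.tri)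
    (hlab : ∀ t ∈ T.tri, ∀ z ∈ interior (body t),
      asum Q.bdry z = if T.label t then -(2 * Real.pi) else 0)
    {e : ℂ × ℂ} (he : T.IsSeparator e) : e ∈ Q.bdry := by
  have hpi := Real.pi_pos
  obtain ⟨x, y⟩ := e
  obtain ⟨⟨t, ht, hl, hs⟩, hright⟩ := he
  have hd : y - x ≠ 0 := sub_ne_zero.2 hs.ne.symm
  obtain ⟨z, hz, -, -, hgen⟩ := exists_generic (e := (x, y)) hs.ne isOpen_univ
    (left_mem_seg _) (Set.mem_univ _) Set.finite_empty (F := {f | f ∈ Q.bdry})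
    (List.finite_toSet Q.bdry)
  have hgen : ∀ f ∈ Q.bdry, GenericAt z (y - x) f := fun f hf => hgen f hf
  have hleft : ∀ᶠ ε : ℝ in 𝓝[>] 0, asum Q.bdry (z + ε * (Complex.I * (y - x))) = 0 :=
    (hs.eventually_left hz one_pos (d := y - x) (by simp)).mono fun ε h => by
      rw [hlab t ht _ h, hl]; simp
  suffices h : ∃ f ∈ Q.bdry, z ∈ openSeg f ∧ ∃ r : ℝ, 0 < r ∧ f.2 - f.1 = r • (y - x) by
    obtain ⟨f, hf, hzf, r, hr, hrd⟩ := h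
    have := (hpart f hf).2 t ht (x, y) hs ⟨⟨z, hzf, hz⟩, r⁻¹, inv_pos.2 hr, by
      rw [hrd, smul_smul, inv_mul_cancel₀ hr.ne', one_smul]⟩
    rw [this]; exact hf
  have hjump : (∃ᶠ ε : ℝ in 𝓝[>] 0, asum Q.bdry (z - ε * (Complex.I * (y - x))) = -(2 * Real.pi)) →
      ∃ f ∈ Q.bdry, z ∈ openSeg f ∧ ∃ r : ℝ, 0 < r ∧ f.2 - f.1 = r • (y - x) := by
    intro hf
    have h1 := jump_eq hd hgen ((hf.and_eventually hleft).mono fun ε h => ⟨h.2, h.1⟩)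
    apply exists_of_jmp_pos
    by_contra hc
    nlinarith
  rcases hright with heP | ⟨t', ht', hl', hs'⟩
  · by_cases hf : ∃ᶠ ε : ℝ in 𝓝[>] 0,
        asum Q.bdry (z - ε * (Complex.I * (y - x))) = -(2 * Real.pi)
    · exact hjump hf
    · rw [Filter.not_frequently] at hf
      have hoff : ∀ᶠ ε : ℝ in 𝓝[>] 0, ∀ f ∈ {f | f ∈ Q.bdry},
          z - ε * (Complex.I * (y - x)) ∉ seg f :=
        (Filter.eventually_all_finite (List.finite_toSet Q.bdry)).2
          fun f hf => (hgen f hf).eventually_notMem hd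
      have hzero : ∀ᶠ ε : ℝ in 𝓝[>] 0, asum Q.bdry (z - ε * (Complex.I * (y - x))) = 0 := by
        filter_upwards [hf, hoff] with ε h1 h2
        exact (hQ.asum_cases h2).resolve_right h1
      have h1 := jump_eq hd hgen (hleft.and hzero).frequently
      have hzQ : z ∈ Q.region := hQ.contains (Or.inl (by
        rw [trace_solid]; exact ⟨_, heP, openSeg_subset_seg _ hz⟩))
      by_cases hzt : ∃ f ∈ Q.bdry, z ∈ seg f
      · obtain ⟨f, hf, hzf⟩ := hzt
        apply exists_of_jmp_zero _ hf (hgen f hf hzf).1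
        have : 2 * Real.pi ≠ 0 := by positivity
        have h2 : 2 * Real.pi * (Q.bdry.map (jmp z (y - x))).sum = 0 := by linarith
        exact (mul_eq_zero.1 h2).resolve_left this
      · exfalso
        push Not at hzt
        have hw := hzQ.resolve_left fun ⟨f, hf, hzf⟩ => hzt f hf hzf
        rw [winding_bdry] at hw
        obtain ⟨ε, h2, h3⟩ := (((tendsto_normal z (y - x)).eventually
          (asum_eventually (isCycle_bdry Q) hzt)).and hleft).exists
        rw [← h2.2, h3, zero_div] at hw
        exact hw rfl
  · apply hjump
    refine ((hs'.eventually_left (z := z) (by rw [openSeg_swap]; exact hz) one_pos (d := x - y)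
      (by simp)).mono fun ε h => ?_).frequently
    have h2 : z - ε * (Complex.I * (y - x)) = z + ε * (Complex.I * (x - y)) := by ring
    rw [h2, hlab t' ht' _ h, hl']; simp

/-- Up to a null set, the hull consists of `P` and the active triangles. -/
lemma IsHull.region_ae (hP : IsInput P) (hC : IsShortcuts P C) (hB : IsContainingBox P B)
    {Q : HoledPolygon} (hQ : IsHull P C Q) {T : Labeled P B E}
    (hT : VertexTriangulation (donut P B) T.tri)
    (hlab : ∀ t ∈ T.tri, ∀ z ∈ interior (body t),
      asum Q.bdry z = if T.label t then -(2 * Real.pi) else 0) :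
    Q.region =ᵐ[volume] T.filled := by
  have hpi := Real.pi_pos
  rw [Filter.eventuallyEq_set]
  filter_upwards [ae_off Q.bdry, ae_mem_inside hP hB hT] with z h2 h3
  have h4 := mem_region_iff h2
  rw [Labeled.mem_filled]
  constructor
  · intro hz
    have hzB : z ∈ B.inside := by
      by_contra hc
      refine h4.1 hz (B.asum_eq_zero (isCycle_bdry Q) (fun e he => ?_) hc)
      have := hC e (hQ.bdry_mem e he)
      exact ⟨hB.mem_inside this.2.1, hB.mem_inside this.2.2.1⟩
    refine (h3.1 hzB).imp_right ?_
    rintro ⟨t, ht, hzt⟩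
    refine ⟨t, Labeled.mem_active.2 ⟨ht, ?_⟩, hzt⟩
    by_contra hl
    exact h4.1 hz (by rw [hlab t ht z hzt, if_neg hl])
  · rintro (hz | ⟨t, ht, hzt⟩)
    · exact hQ.contains (Or.inr (by rw [winding_solid]; exact hz.2))
    · obtain ⟨ht, hl⟩ := Labeled.mem_active.1 ht
      rw [h4, hlab t ht z hzt, if_pos hl]
      linarith

lemma sum_le_perimeter {Q : HoledPolygon} {s r : Multiset (ℂ × ℂ)}
    (h : (Q.bdry : Multiset (ℂ × ℂ)) = s + r) : (s.map fun e => dist e.1 e.2).sum ≤ Q.perimeter := by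
  have h1 : Q.perimeter = ((Q.bdry : Multiset (ℂ × ℂ)).map fun e => dist e.1 e.2).sum := by
    rw [Multiset.map_coe, Multiset.sum_coe]; rfl
  rw [h1, h, Multiset.map_add, Multiset.sum_add]
  have : 0 ≤ (r.map fun e => dist e.1 e.2).sum := by
    apply Multiset.sum_nonneg
    intro x hx
    obtain ⟨e, -, rfl⟩ := Multiset.mem_map.1 hx
    exact dist_nonneg
  linarith

/-- Every hull arises from a labeled triangulation of at most its cost. -/
lemma IsHull.exists_labeled_cost {lam : ℝ} (hlam : lam ∈ Set.Icc (0 : ℝ) 1) (hP : IsInput P)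
    (hC : IsShortcuts P C) (hB : IsContainingBox P B) (hE : IsEnrichment C (donut P B) E)
    {Q : HoledPolygon} (hQ : IsHull P C Q) : ∃ T : Labeled P B E,
      T.separators.val ≤ (Q.bdry : Multiset (ℂ × ℂ)) ∧
      T.cost C lam + ENNReal.ofReal ((1 - lam) * (solid P).area) ≤ ENNReal.ofReal (Q.cost lam) ∧
      (Irredundant P C Q → T.Forms Q ∧
        T.cost C lam + ENNReal.ofReal ((1 - lam) * (solid P).area)
          = ENNReal.ofReal (Q.cost lam)) := by
  obtain ⟨T, hpart, hlab⟩ := hQ.exists_labeled hP hC hB hE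
  have hT := T.isTriangulation.vertexTriangulation hE.endpoints
  have hsub : ∀ e, T.IsSeparator e → e ∈ Q.bdry := fun e he => hQ.separator_mem hpart hlab he
  have hsepC : ∀ e, T.IsSeparator e → e ∈ C := fun e he => hQ.bdry_mem e (hsub e he)
  have hle : T.separators.val ≤ (Q.bdry : Multiset (ℂ × ℂ)) := by
    refine (Multiset.le_iff_subset T.separators.nodup).2 fun e he => ?_
    exact hsub e (T.mem_separators.1 he)
  have hreg := hQ.region_ae hP hC hB hT hlab
  have harea := area_of_region_ae hP hB hT hreg
  have hcost := Labeled.cost_add hlam hsepC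
  refine ⟨T, hle, ?_, ?_⟩
  · rw [hcost]
    apply ENNReal.ofReal_le_ofReal
    obtain ⟨r, hr⟩ := Multiset.le_iff_exists_add.1 hle
    have h1 : ∑ e ∈ T.separators, dist e.1 e.2 ≤ Q.perimeter := sum_le_perimeter hr
    unfold HoledPolygon.cost
    rw [harea]
    have := mul_le_mul_of_nonneg_left h1 hlam.1
    linarith
  · intro hirr
    have hforms : T.Forms Q := by
      obtain ⟨Q', hQ', hf, hreg'⟩ := Labeled.exists_hull hP hC hB hT hsepC
      by_contra hne
      refine hirr ⟨Q', hQ', ?_, hreg'.trans hreg.symm⟩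
      rw [hf]
      exact lt_of_le_of_ne hle fun h => hne h.symm
    refine ⟨hforms, ?_⟩
    rw [hcost, ← hforms.perimeter, ← harea]
    rfl

/-- The separators of a labeled triangulation of finite cost form a hull of the same cost. -/
lemma Labeled.exists_hull_cost {lam : ℝ} (hlam : lam ∈ Set.Icc (0 : ℝ) 1) (hP : IsInput P)
    (hC : IsShortcuts P C) (hB : IsContainingBox P B) (hE : IsEnrichment C (donut P B) E)
    {T : Labeled P B E} (h : T.cost C lam < ⊤) : ∃ Q, IsHull P C Q ∧ T.Forms Q ∧
      T.cost C lam + ENNReal.ofReal ((1 - lam) * (solid P).area)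
        = ENNReal.ofReal (Q.cost lam) := by
  have hT := T.isTriangulation.vertexTriangulation hE.endpoints
  have hsepC := Labeled.mem_of_cost_lt_top h
  obtain ⟨Q, hQ, hf, hreg⟩ := Labeled.exists_hull hP hC hB hT hsepC
  refine ⟨Q, hQ, hf, ?_⟩
  rw [Labeled.cost_add hlam hsepC, ← hf.perimeter, ← area_of_region_ae hP hB hT hreg]
  rfl

end


end ShortcutHull

open ShortcutHull in
theorem mainTheorem2 (P : List ℂ) (hP : IsInput P) (C : Set (ℂ × ℂ)) (hC : IsShortcuts P C)
    (lam : ℝ) (hlam : lam ∈ Set.Icc (0 : ℝ) 1) (B : Box) (hB : IsContainingBox P B)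
    (E : Set (ℂ × ℂ)) (hE : IsEnrichment C (donut P B) E) :
    -- the separators of an optimal triangulation of finite cost form an optimal hull
    (∀ T : Labeled P B E, T.IsOptimal C lam → T.cost C lam < ⊤ →
      ∃ Q, IsOptimalHull P C lam Q ∧ T.Forms Q) ∧
    -- every hull arises from a labeled triangulation of equal cost
    (∀ Q, IsHull P C Q → ∃ T : Labeled P B E,
      T.separators.val ≤ (Q.bdry : Multiset (ℂ × ℂ)) ∧
      T.cost C lam + ENNReal.ofReal ((1 - lam) * (solid P).area) ≤ ENNReal.ofReal (Q.cost lam) ∧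
      (Irredundant P C Q → T.Forms Q ∧
        T.cost C lam + ENNReal.ofReal ((1 - lam) * (solid P).area)
          = ENNReal.ofReal (Q.cost lam))) ∧
    -- the separators of every labeled triangulation of finite cost form a hull of equal cost
    (∀ T : Labeled P B E, T.cost C lam < ⊤ →
      ∃ Q, IsHull P C Q ∧ T.Forms Q ∧
        T.cost C lam + ENNReal.ofReal ((1 - lam) * (solid P).area)
          = ENNReal.ofReal (Q.cost lam)) := by
  refine ⟨fun T hopt hT => ?_, fun Q hQ => hQ.exists_labeled_cost hlam hP hC hB hE,
    fun T hT => Labeled.exists_hull_cost hlam hP hC hB hE hT⟩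
  obtain ⟨Q, hQ, hf, hcost⟩ := Labeled.exists_hull_cost hlam hP hC hB hE hT
  refine ⟨Q, ⟨hQ, fun Q' hQ' => ?_⟩, hf⟩
  obtain ⟨T', -, hle, -⟩ := hQ'.exists_labeled_cost (E := E) hlam hP hC hB hE
  have hpos : 0 ≤ Q'.cost lam := by
    have h1 : 0 ≤ Q'.perimeter := List.sum_nonneg fun x hx => by
      obtain ⟨e, -, rfl⟩ := List.mem_map.1 hx
      exact dist_nonneg
    have h2 : 0 ≤ Q'.area := ENNReal.toReal_nonneg
    exact add_nonneg (mul_nonneg hlam.1 h1) (mul_nonneg (by linarith [hlam.2]) h2)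
  rw [← ENNReal.ofReal_le_ofReal_iff hpos, ← hcost]
  exact (add_le_add_left (hopt T') _).trans hle
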